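/- Let $\alpha\in(0,1)$, let $c,a\in C^\infty(\mathbb{R}^n)$ be real-valued with $c(x)\ge c_0>0$ and $a(x)\ge 0$, and let $u$ be a (real-valued, locally finite energy) solution of $$\partial_t^2u-c^2(x)\Delta u+a(x)\,\partial_t^\alpha u=0\ \text{ in }(0,\infty)\times\mathbb{R}^n,\qquad (u,\partial_tu)|_{t=0}=\Big(u_0,\,-\frac{a(x)}{\Gamma(2-\alpha)}u_0\Big),$$ where $\partial_t^\alpha f(t)=\frac{1}{\Gamma(1-\alpha)}\int_0^t\frac{f'(s)}{(t-s)^\alpha}\,ds$ is the Caputo derivative; that is, $u\in C([0,\infty);H^1_{loc}(\mathbb{R}^n))\cap C^1([0,\infty);L^2_{loc}(\mathbb{R}^n))$, the equation holds in the sense of distributions, and the initial conditions hold in $L^2_{loc}(\mathbb{R}^n)$. For $V\subset\mathbb{R}^n$ put $$E_V(t)=\int_V|\partial_tu(t,x)|^2c^{-2}(x)\,dx+\int_V|\nabla u(t,x)|^2\,dx .$$ **(Finite propagation speed.)** (i) Let $\phi\in C^\infty(\mathbb{R}^n)$ be real-valued with $c^2|\nabla\phi|^2\le1$, let $\tau>0$,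 and put $\mathcal C(t)=\{x:\phi(x)<\tau-t\}$. Suppose that $\mathcal C(0)$ is bounded or that $c$ is bounded. If $E_{\mathcal C(0)}(0)=0$, then $E_{\mathcal C(t)}(t)=0$ for all $t\in[0,\tau]$; and if $u_0=0$ a.e. on $\mathcal C(0)$, then $u(t,\cdot)=0$ a.e. on $\mathcal C(t)$ for all $t\in[0,\tau]$. (ii) If $c\le M$ on $\mathbb{R}^n$ and $u_0=0$ a.e. outside a closed set $K$, then for every $t\ge0$, $u(t,\cdot)=0$ a.e. outside $\{x:\operatorname{dist}(x,K)\le Mt\}$ (the empty set if $K=\emptyset$). **(Dissipation.)** Let $\mathcal U\subset\mathbb{R}^n$ be a bounded open set with smooth boundary, let $T>0$, and suppose that $u=0$ on $(0,T)\times\partial\mathcal U$ (i.e. $u(t)|_{\mathcal U}\in H^1_0(\mathcal U)$ for $t\in(0,T)$). Then for every $t\in[0,T]$ the energy $E_{\mathcal U}(t)$ is finite, $(a\,\partial_t^\alpha u)\,(c^{-2}\partial_tu)$ is integrable on $(0,t)\times\mathcal U$, and $$E_{\mathcal U}(t)=E_{\mathcal U}(0)-2\langle a\,\partial_t^\alpha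 u,\,c^{-2}\partial_tu\rangle,\qquad \langle a\,\partial_t^\alpha u,\,c^{-2}\partial_tu\rangle\ge0,$$ where $\langle f,g\rangle=\int_{(0,t)\times\mathcal U}f\,g\,dx\,ds$. -/

import Mathlib

open MeasureTheory Filter Topology
open scoped ContDiff ENNReal

noncomputable section

namespace FracWave

/-- `ℝⁿ` with its Euclidean norm. -/
abbrev Sp (n : ℕ) : Type := EuclideanSpace ℝ (Fin n)

/-- The Caputo derivative of order `α ∈ (0,1)` of an absolutely continuous function of time, as a
function of its time derivative `f'`: `Γ(1-α)⁻¹ ∫₀ᵗ f'(s) (t-s)^(-α) ds`. -/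
def caputo (α : ℝ) (f' : ℝ → ℝ) (t : ℝ) : ℝ :=
  (Real.Gamma (1 - α))⁻¹ * ∫ s in (0 : ℝ)..t, f' s / (t - s) ^ α

variable {n : ℕ}

/-- `p` is the weak gradient of `f` on `ℝⁿ`. -/
def IsWeakGradient (f : Sp n → ℝ) (p : Sp n → Sp n) : Prop :=
  ∀ η : Sp n → ℝ, ContDiff ℝ ∞ η → HasCompactSupport η →
    ∫ x, f x • gradient η x = -∫ x, η x • p x

/-- `w ∈ C([0,∞); L²_loc(ℝⁿ))`, and `w` is represented by a jointly measurable function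
of `(t,x)`. -/
def ContL2Loc {F : Type*} [NormedAddCommGroup F] (w : ℝ → Sp n → F) : Prop :=
  AEStronglyMeasurable (fun z : ℝ × Sp n => w z.1 z.2)
      (volume.restrict (Set.Ioi (0 : ℝ) ×ˢ Set.univ)) ∧
  ∀ K : Set (Sp n), IsCompact K →
    (∀ t : ℝ, 0 ≤ t → MemLp (w t) 2 (volume.restrict K)) ∧
    (∀ t : ℝ, 0 ≤ t → Tendsto (fun s => eLpNorm (fun x => w s x - w t x) 2 (volume.restrict K))
      (𝓝[Set.Ici 0] t) (𝓝 0))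

/-- `v` is the time derivative on `[0,∞)` of `u`, as curves in `L²_loc(ℝⁿ)`
(one-sided at `t = 0`). -/
def HasTimeDerivL2Loc (u v : ℝ → Sp n → ℝ) : Prop :=
  ∀ K : Set (Sp n), IsCompact K → ∀ t : ℝ, 0 ≤ t →
    Tendsto
      (fun s => eLpNorm (fun x => (s - t)⁻¹ * (u s x - u t x) - v t x) 2 (volume.restrict K))
      (𝓝[Set.Ici 0 \ {t}] t) (𝓝 0)

/-- `u` is a solution with locally finite energy of the fractionally attenuated wave system
`∂ₜ²u - c²Δu + a ∂ₜ^α u = 0` in `(0,∞) × ℝⁿ`,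
`(u, ∂ₜu)|ₜ₌₀ = (u₀, -a u₀ / Γ(2-α))`,
with time derivative `ut` and spatial gradient `Du`. That is,
`u ∈ C([0,∞); H¹_loc) ∩ C¹([0,∞); L²_loc)`, the initial conditions hold in these spaces, and the
equation holds in the sense of distributions. -/
structure IsSolution (α : ℝ) (c a u₀ : Sp n → ℝ) (u ut : ℝ → Sp n → ℝ)
    (Du : ℝ → Sp n → Sp n) : Prop where
  cont_u : ContL2Loc u
  cont_ut : ContL2Loc ut
  cont_Du : ContL2Loc Du
  weakGradient : ∀ t : ℝ, 0 ≤ t → IsWeakGradient (u t) (Du t)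
  timeDeriv : HasTimeDerivL2Loc u ut
  init_u : ∀ᵐ x, u 0 x = u₀ x
  init_ut : ∀ᵐ x, ut 0 x = -(a x / Real.Gamma (2 - α)) * u₀ x
  equation : ∀ φ : ℝ × Sp n → ℝ, ContDiff ℝ ∞ φ → HasCompactSupport φ →
    tsupport φ ⊆ Set.Ioi (0 : ℝ) ×ˢ Set.univ →
    ∫ z : ℝ × Sp n,
      (-(ut z.1 z.2 * deriv (fun s => φ (s, z.2)) z.1)
        + inner ℝ (Du z.1 z.2) (gradient (fun y => c y ^ 2 * φ (z.1, y)) z.2)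
        + a z.2 * caputo α (fun s => ut s z.2) z.1 * φ z) = 0

/-- The energy `∫_U |w|² c⁻² dx + ∫_U |p|² dx` of a state with velocity `w` and
gradient `p`, with values in `[0,∞]`. -/
def energy (c : Sp n → ℝ) (U : Set (Sp n)) (w : Sp n → ℝ) (p : Sp n → Sp n) : ℝ≥0∞ :=
  (∫⁻ x in U, ENNReal.ofReal (w x ^ 2 / c x ^ 2)) + ∫⁻ x in U, ENNReal.ofReal (‖p x‖ ^ 2)

/-- The region `U ⊆ ℝⁿ` is open, bounded and has a smooth boundary: near each boundary point
it is the sublevel set `{ρ < 0}` of a smooth function with nonvanishing differential. -/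
structure IsSmoothBounded (U : Set (Sp n)) : Prop where
  isOpen : IsOpen U
  isBounded : Bornology.IsBounded U
  smooth_boundary : ∀ x ∈ frontier U, ∃ ρ : Sp n → ℝ, ContDiff ℝ ∞ ρ ∧ fderiv ℝ ρ x ≠ 0 ∧
    ∀ᶠ y in 𝓝 x, (y ∈ U ↔ ρ y < 0)

/-- The function `f`, with weak gradient `p`, vanishes on `∂U` in the sense of traces: its
restriction to `U` belongs to `H¹₀(U)`, the closure of `C_c^∞(U)` in `H¹(U)`. -/
def VanishesOnBoundary (U : Set (Sp n)) (f : Sp n → ℝ) (p : Sp n → Sp n) : Prop :=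
  ∃ η : ℕ → Sp n → ℝ,
    (∀ k, ContDiff ℝ ∞ (η k) ∧ HasCompactSupport (η k) ∧ tsupport (η k) ⊆ U) ∧
    Tendsto (fun k => eLpNorm (fun x => f x - η k x) 2 (volume.restrict U)) atTop (𝓝 0) ∧
    Tendsto (fun k => eLpNorm (fun x => p x - gradient (η k) x) 2 (volume.restrict U))
      atTop (𝓝 0)

/-- The section `C(t) = {x : φ(x) < τ - t}` of the backward cone of height `τ` given by `φ`. -/
def coneSection (φ : Sp n → ℝ) (τ t : ℝ) : Set (Sp n) := {x | φ x < τ - t}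

/-- Smooth functions with `c²|∇φ|² ≤ 1`: their backward cones are bounded by non-timelike
surfaces for the speed `c`. -/
def IsConeFunction (c φ : Sp n → ℝ) : Prop :=
  ContDiff ℝ ∞ φ ∧ ∀ x, c x ^ 2 * ‖gradient φ x‖ ^ 2 ≤ 1

/-- Finite propagation speed (with local speed at most `c`) of the wave `u`, with time derivative
`ut`, gradient `Du` and initial value `u₀`. Domain of dependence: in each backward cone
whose base `C(0)` is bounded (or with an arbitrary base, if `c` is bounded), vanishing initial
energy, respectively vanishing initial value, on the base propagates to all sections of the cone.
Range of influence: if `c ≤ M` then the support of `u(t)` is within distance `M t` of the support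
of `u₀`. -/
structure HasFinitePropagationSpeed (c u₀ : Sp n → ℝ) (u ut : ℝ → Sp n → ℝ)
    (Du : ℝ → Sp n → Sp n) : Prop where
  energy_cone : ∀ (φ : Sp n → ℝ) (τ : ℝ), IsConeFunction c φ → 0 < τ →
    (Bornology.IsBounded (coneSection φ τ 0) ∨ BddAbove (Set.range c)) →
    energy c (coneSection φ τ 0) (ut 0) (Du 0) = 0 →
    ∀ t ∈ Set.Icc 0 τ, energy c (coneSection φ τ t) (ut t) (Du t) = 0
  value_cone : ∀ (φ : Sp n → ℝ) (τ : ℝ), IsConeFunction c φ → 0 < τ →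
    (Bornology.IsBounded (coneSection φ τ 0) ∨ BddAbove (Set.range c)) →
    (∀ᵐ x, x ∈ coneSection φ τ 0 → u₀ x = 0) →
    ∀ t ∈ Set.Icc 0 τ, ∀ᵐ x, x ∈ coneSection φ τ t → u t x = 0
  support : ∀ M : ℝ, (∀ x, c x ≤ M) → ∀ K : Set (Sp n), IsClosed K →
    (∀ᵐ x, x ∉ K → u₀ x = 0) →
    ∀ t : ℝ, 0 ≤ t → ∀ᵐ x, x ∉ Metric.cthickening (M * t) K → u t x = 0

end FracWave

end

/-! Both halves come from multiplying the equation by `c⁻² ∂ₜu`. The Caputo derivative of `u` is the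
fractional integral of `∂ₜu` with kernel `(t - s)^(-α) / Γ(1-α)`, and this kernel is of positive
type: it is a superposition, with positive weights, of the exponentials `e^(-l(t - s))`, and for
each of these the quadratic form is an energy plus a dissipation (`integral_exp_volterra_nonneg`,
`integral_fracInt_nonneg`). So the work done by the damping up to any time is nonnegative, even
after multiplication by a nonnegative weight depending on `x` alone. Its instantaneous power has no
sign.

For a Dirichlet domain this is the dissipation law. For finite speed, take a weight `η(t, x) ≥ 0` of
compact support with `∂ₜη ≤ -c |∇η|`, and consider the `η(t)`-weighted energy plus twice the work
done on `[0, t]`, where the whole past is weighted by the present `η(t)`. In its time derivative the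
flux through `∇η` is absorbed by `∂ₜη` times the energy density, and the past work, now weighted by
`∂ₜη ≤ 0`, contributes a nonpositive term. Hence the quantity decreases; if it starts at zero, the
energy vanishes wherever `η(t) ≠ 0` (`IsSolution.ae_eq_zero_of_shrinking_weight`). Suitable weights
are products of two smooth one-sided cutoffs: one cuts out the given cone, the other makes the
support compact.

If `u₀` vanishes on the base, so do the initial velocity, a multiple of `u₀`, and the gradient; then
`∂ₜu = 0` in the cone and `u` keeps its initial value zero. Cones around single points give the
bound on the support.

The regularity is too low to test with `∂ₜu`, which is only in `L²`. The equation, integrated over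
`[t, t + h]`, is tested with `u(t + h) - u(t)`, that is, with `h` times a Steklov average of `∂ₜu`,
and `h → 0` at the level of the energy identity (`abstract_energy_identity`). All of this takes
place in `L²(D)` for bounded `D`. -/

namespace FracWave

/-! ### Energy identity for a second order equation in Hilbert space, by Steklov averages. -/

section Abstract

variable {H : Type*} [NormedAddCommGroup H] [InnerProductSpace ℝ H]

/-- The average of `f` over `[t, t + h]`. -/
noncomputable def steklov (h : ℝ) (f : ℝ → H) (t : ℝ) : H := h⁻¹ • ∫ s in t..t + h, f s

theorem hasDerivAt_steklov [CompleteSpace H] {f : ℝ → H} (hf : Continuous f) (h t : ℝ) :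
    HasDerivAt (steklov h f) (h⁻¹ • (f (t + h) - f t)) t := by
  have hi : ∀ a b, IntervalIntegrable f volume a b := fun a b => hf.intervalIntegrable a b
  have e : steklov h f = fun t => h⁻¹ • ((∫ s in (0 : ℝ)..t + h, f s) - ∫ s in (0 : ℝ)..t, f s) :=
    by
    funext t
    rw [steklov, intervalIntegral.integral_interval_sub_left (hi _ _) (hi _ _)]
  rw [e]
  have h1 : HasDerivAt (fun t => ∫ s in (0 : ℝ)..t, f s) (f t) t :=
    intervalIntegral.integral_hasDerivAt_right (hi _ _)
      (hf.stronglyMeasurableAtFilter _ _) hf.continuousAt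
  have h2 : HasDerivAt (fun t => ∫ s in (0 : ℝ)..t, f s) (f (t + h)) (t + h) :=
    intervalIntegral.integral_hasDerivAt_right (hi _ _)
      (hf.stronglyMeasurableAtFilter _ _) hf.continuousAt
  exact ((h2.comp_add_const t h).sub h1).const_smul _

theorem continuous_steklov [CompleteSpace H] {f : ℝ → H} (hf : Continuous f) (h : ℝ) :
    Continuous (steklov h f) :=
  continuous_iff_continuousAt.2 fun t => (hasDerivAt_steklov hf h t).continuousAt

theorem tendsto_steklov [CompleteSpace H] {f : ℝ → H} (hf : Continuous f) (t : ℝ) :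
    Tendsto (fun h => steklov h f t) (𝓝[>] 0) (𝓝 (f t)) := by
  have h1 : HasDerivAt (fun x => ∫ s in t..x, f s) (f t) t :=
    intervalIntegral.integral_hasDerivAt_right (hf.intervalIntegrable _ _)
      (hf.stronglyMeasurableAtFilter _ _) hf.continuousAt
  simpa [steklov] using h1.tendsto_slope_zero_right

theorem norm_steklov_le {f : ℝ → H} {h t C : ℝ} (hh : 0 < h)
    (hC : ∀ s ∈ Set.Icc t (t + h), ‖f s‖ ≤ C) : ‖steklov h f t‖ ≤ C := by
  have h1 : ‖∫ s in t..t + h, f s‖ ≤ C * |t + h - t| :=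
    intervalIntegral.norm_integral_le_of_norm_le_const fun s hs => by
      rw [Set.uIoc_of_le (by linarith)] at hs
      exact hC s ⟨hs.1.le, hs.2⟩
  rw [steklov, norm_smul, norm_inv, Real.norm_of_nonneg hh.le, inv_mul_le_iff₀ hh]
  simpa [abs_of_pos hh, mul_comm] using h1

variable {H₁ : Type*} [NormedAddCommGroup H₁] [InnerProductSpace ℝ H₁]

/-- The energy identity for the abstract second order equation `(K U')' + D* P + G = 0`, in which
the equation may only be tested against increments of `(M U, R P + Q U)`. -/
theorem abstract_energy_identity [CompleteSpace H] [CompleteSpace H₁]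
    {U W G : ℝ → H} {P : ℝ → H₁} {K M : H →L[ℝ] H} {R : H₁ →L[ℝ] H₁} {Q : H →L[ℝ] H₁} {T : ℝ}
    (hW : Continuous W) (hG : Continuous G) (hP : Continuous P)
    (hU : ∀ t, 0 < t → HasDerivAt U (W t) t)
    (hKM : ∀ x y, inner ℝ (K x) (M y) = inner ℝ (K y) (M x))
    (hR : ∀ x y, inner ℝ x (R y) = inner ℝ y (R x))
    (weak : ∀ s t, 0 < s → s < t → t < T →
      inner ℝ (K (W t - W s) + ∫ σ in s..t, G σ) (M (U t - U s))
        + inner ℝ (∫ σ in s..t, P σ) (R (P t - P s) + Q (U t - U s)) = 0)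
    {t : ℝ} (ht0 : 0 ≤ t) (htT : t ≤ T) :
    inner ℝ (K (W t)) (M (W t)) + inner ℝ (P t) (R (P t)) =
      inner ℝ (K (W 0)) (M (W 0)) + inner ℝ (P 0) (R (P 0))
        - 2 * ∫ σ in (0 : ℝ)..t, (inner ℝ (P σ) (Q (W σ)) + inner ℝ (G σ) (M (W σ))) := by
  set F : ℝ → ℝ := fun σ => inner ℝ (P σ) (Q (W σ)) + inner ℝ (G σ) (M (W σ)) with hF
  have hFc : Continuous F := by fun_prop
  set e : ℝ → ℝ := fun t => inner ℝ (K (W t)) (M (W t)) + inner ℝ (P t) (R (P t)) with he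
  have hec : Continuous e := by fun_prop
  -- the identity for the averages
  have avg : ∀ h s t, 0 < h → 0 < s → s ≤ t → t + h < T →
      (inner ℝ (K (steklov h W t)) (M (steklov h W t))
          + inner ℝ (steklov h P t) (R (steklov h P t)))
        - (inner ℝ (K (steklov h W s)) (M (steklov h W s))
          + inner ℝ (steklov h P s) (R (steklov h P s)))
      = ∫ σ in s..t, -2 * (inner ℝ (steklov h P σ) (Q (steklov h W σ))
          + inner ℝ (steklov h G σ) (M (steklov h W σ))) := by
    intro h s t hh hs hst htT
    symm
    have cW := continuous_steklov hW h
    have cP := continuous_steklov hP h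
    have cG := continuous_steklov hG h
    refine intervalIntegral.integral_eq_sub_of_hasDerivAt (fun σ hσ => ?_)
      (Continuous.intervalIntegrable (by fun_prop) _ _)
      (f := fun σ => inner ℝ (K (steklov h W σ)) (M (steklov h W σ))
          + inner ℝ (steklov h P σ) (R (steklov h P σ)))
    rw [Set.uIcc_of_le hst] at hσ
    have hσ0 : 0 < σ := hs.trans_le hσ.1
    have dW := hasDerivAt_steklov hW h σ
    have dP := hasDerivAt_steklov hP h σ
    have d := ((K.hasFDerivAt.comp_hasDerivAt σ dW).inner ℝ
      (M.hasFDerivAt.comp_hasDerivAt σ dW)).add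
      (dP.inner ℝ (R.hasFDerivAt.comp_hasDerivAt σ dP))
    refine d.congr_deriv ?_
    have hw := weak σ (σ + h) hσ0 (by linarith) (by linarith [hσ.2])
    -- The admissible increment of `U` is a multiple of the averaged velocity, so the averaged
    -- equation may be tested with the averaged velocity although `W` itself is not admissible.
    have hUW : U (σ + h) - U σ = h • steklov h W σ := by
      rw [steklov, smul_inv_smul₀ hh.ne']
      symm
      refine intervalIntegral.integral_eq_sub_of_hasDerivAt (fun x hx => hU x ?_)
        (hW.intervalIntegrable _ _)
      rw [Set.uIcc_of_le (by linarith)] at hx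
      exact hσ0.trans_le hx.1
    have hG' : ∫ x in σ..σ + h, G x = h • steklov h G σ := by
      rw [steklov, smul_inv_smul₀ hh.ne']
    have hP' : ∫ x in σ..σ + h, P x = h • steklov h P σ := by
      rw [steklov, smul_inv_smul₀ hh.ne']
    rw [hUW, hG', hP'] at hw
    have k1 := hKM (steklov h W σ) (h⁻¹ • (W (σ + h) - W σ))
    have k2 := hR (h⁻¹ • (P (σ + h) - P σ)) (steklov h P σ)
    simp only [map_smul, inner_add_left, inner_add_right, inner_smul_left, inner_smul_right,
      Function.comp_apply, RCLike.conj_to_real] at hw k1 k2 ⊢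
    rw [k1, k2]
    field_simp
    have : h * (inner ℝ (K (W (σ + h) - W σ)) (M (steklov h W σ))
      + h * inner ℝ (steklov h G σ) (M (steklov h W σ))
      + inner ℝ (steklov h P σ) (R (P (σ + h) - P σ))
      + h * inner ℝ (steklov h P σ) (Q (steklov h W σ))) = 0 := by linear_combination hw
    rcases mul_eq_zero.1 this with h0 | h0
    · exact absurd h0 hh.ne'
    · linear_combination 2 * h0
  -- Limit `h → 0`. The strict inequality `t < T` leaves room for `t + h < T`.
  have mid : ∀ s t, 0 < s → s ≤ t → t < T → e t - e s = ∫ σ in s..t, -2 * F σ := by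
    intro s t hs hst htT
    have cont : ∀ (x : ℝ), Tendsto (fun h => inner ℝ (K (steklov h W x)) (M (steklov h W x))
          + inner ℝ (steklov h P x) (R (steklov h P x))) (𝓝[>] 0) (𝓝 (e x)) := by
      intro x
      have aW := tendsto_steklov hW x
      have aP := tendsto_steklov hP x
      exact (((K.continuous.tendsto _).comp aW).inner ((M.continuous.tendsto _).comp aW)).add
        (aP.inner ((R.continuous.tendsto _).comp aP))
    obtain ⟨CW, hCW⟩ := (isCompact_Icc (a := (0:ℝ)) (b := T)).exists_bound_of_continuousOn
      hW.continuousOn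
    obtain ⟨CP, hCP⟩ := (isCompact_Icc (a := (0:ℝ)) (b := T)).exists_bound_of_continuousOn
      hP.continuousOn
    obtain ⟨CG, hCG⟩ := (isCompact_Icc (a := (0:ℝ)) (b := T)).exists_bound_of_continuousOn
      hG.continuousOn
    have hsmall : ∀ᶠ h : ℝ in 𝓝[>] 0, 0 < h ∧ t + h < T := by
      have : ∀ᶠ h : ℝ in 𝓝[>] 0, h ∈ Set.Ioo 0 (T - t) := Ioo_mem_nhdsGT (by linarith)
      filter_upwards [this] with h hh
      exact ⟨hh.1, by linarith [hh.2]⟩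
    have lim : Tendsto (fun h => ∫ σ in s..t, -2 * (inner ℝ (steklov h P σ) (Q (steklov h W σ))
          + inner ℝ (steklov h G σ) (M (steklov h W σ)))) (𝓝[>] 0)
        (𝓝 (∫ σ in s..t, -2 * F σ)) := by
      refine intervalIntegral.tendsto_integral_filter_of_dominated_convergence
        (fun _ => 2 * (CP * (‖Q‖ * CW) + CG * (‖M‖ * CW))) ?_ ?_ (by simp) ?_
      · refine Eventually.of_forall fun h => ?_
        have cW := continuous_steklov hW h
        have cP := continuous_steklov hP h
        have cG := continuous_steklov hG h
        exact Continuous.aestronglyMeasurable (by fun_prop)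
      · filter_upwards [hsmall] with h hh
        refine Eventually.of_forall fun σ hσ => ?_
        rw [Set.uIoc_of_le hst] at hσ
        have hsub : Set.Icc σ (σ + h) ⊆ Set.Icc 0 T := fun x hx =>
          ⟨by linarith [hx.1, hσ.1], by linarith [hx.2, hσ.2, hh.2]⟩
        have bW := norm_steklov_le hh.1 fun x hx => hCW x (hsub hx)
        have bP := norm_steklov_le hh.1 fun x hx => hCP x (hsub hx)
        have bG := norm_steklov_le hh.1 fun x hx => hCG x (hsub hx)
        have cP0 := (norm_nonneg _).trans bP
        have cG0 := (norm_nonneg _).trans bG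
        have i1 : ‖inner ℝ (steklov h P σ) (Q (steklov h W σ))‖ ≤ CP * (‖Q‖ * CW) :=
          (norm_inner_le_norm _ _).trans (mul_le_mul bP
            ((Q.le_opNorm _).trans (by gcongr)) (norm_nonneg _) cP0)
        have i2 : ‖inner ℝ (steklov h G σ) (M (steklov h W σ))‖ ≤ CG * (‖M‖ * CW) :=
          (norm_inner_le_norm _ _).trans (mul_le_mul bG
            ((M.le_opNorm _).trans (by gcongr)) (norm_nonneg _) cG0)
        rw [norm_mul]
        have : ‖(-2 : ℝ)‖ = 2 := by norm_num
        rw [this]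
        have := norm_add_le (inner ℝ (steklov h P σ) (Q (steklov h W σ)))
          (inner ℝ (steklov h G σ) (M (steklov h W σ)))
        linarith
      · refine Eventually.of_forall fun σ _ => ?_
        have aW := tendsto_steklov hW σ
        have aP := tendsto_steklov hP σ
        have aG := tendsto_steklov hG σ
        exact ((aP.inner ((Q.continuous.tendsto _).comp aW)).add
          (aG.inner ((M.continuous.tendsto _).comp aW))).const_mul _
    refine tendsto_nhds_unique ((cont t).sub (cont s)) (lim.congr' ?_)
    filter_upwards [hsmall] with h hh
    exact (avg h s t hh.1 hs hst hh.2).symm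
  have hI : ∀ a b, IntervalIntegrable F volume a b := fun a b => hFc.intervalIntegrable a b
  -- The quantity `Φ` is constant on the open interval, where the weak equation is available;
  -- continuity then carries the identity to the endpoints `0` and `T`.
  set Φ : ℝ → ℝ := fun t => e t + 2 * ∫ σ in (0 : ℝ)..t, F σ with hΦ
  have hΦc : Continuous Φ :=
    hec.add (continuous_const.mul (intervalIntegral.continuous_primitive hI 0))
  suffices hs : Φ t = Φ 0 by
    simp only [hΦ, intervalIntegral.integral_same, mul_zero, add_zero] at hs
    change e t = e 0 - 2 * _
    linarith
  rcases ht0.eq_or_lt with rfl | htpos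
  · rfl
  have hT : 0 < T := htpos.trans_le htT
  have hconst : Set.EqOn Φ (fun _ => Φ (T / 2)) (Set.Ioo 0 T) := by
    have key : ∀ s t, 0 < s → s ≤ t → t < T → Φ t = Φ s := by
      intro s t hs hst htT
      have h1 := mid s t hs hst htT
      rw [intervalIntegral.integral_const_mul] at h1
      have h2 := intervalIntegral.integral_interval_sub_left (hI 0 t) (hI 0 s)
      simp only [hΦ]
      linarith
    intro x hx
    rcases le_total x (T / 2) with h | h
    · exact (key x (T / 2) hx.1 h (by linarith)).symm
    · exact key (T / 2) x (by linarith) h hx.2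
  have hcl := hconst.closure hΦc continuous_const
  rw [closure_Ioo hT.ne] at hcl
  rw [hcl ⟨ht0, htT⟩, hcl ⟨le_rfl, hT.le⟩]

end Abstract

end FracWave

namespace FracWave

/-! ### Positivity of the fractional integral. -/

section Volterra

variable {H : Type*} [NormedAddCommGroup H] [InnerProductSpace ℝ H]

/-- The scaled form of the fractional integral `∫₀ᵗ (t - s) ^ (-α) W(s) ds`. -/
noncomputable def fracInt (α : ℝ) (W : ℝ → H) (t : ℝ) : H :=
  t ^ (1 - α) • ∫ σ in (0 : ℝ)..1, (1 - σ) ^ (-α) • W (t * σ)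

theorem intervalIntegrable_sub_rpow {α : ℝ} (hα1 : α < 1) (t a b : ℝ) :
    IntervalIntegrable (fun s : ℝ => (t - s) ^ (-α)) volume a b := by
  have := (intervalIntegral.intervalIntegrable_rpow' (a := t - a) (b := t - b)
    (by linarith : -1 < -α)).comp_sub_left t
  simpa using this

theorem fracInt_eq {α : ℝ} (hα1 : α < 1) (W : ℝ → H) {t : ℝ} (ht : 0 ≤ t) :
    fracInt α W t = ∫ s in (0 : ℝ)..t, (t - s) ^ (-α) • W s := by
  rcases ht.eq_or_lt with rfl | ht
  · simp [fracInt, Real.zero_rpow (sub_pos.2 hα1).ne']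
  · have := intervalIntegral.smul_integral_comp_mul_left
      (a := 0) (b := 1) (fun s => (t - s) ^ (-α) • W s) t
    simp only [mul_zero, mul_one] at this
    rw [← this, fracInt, show (1 - α) = 1 + -α by ring, Real.rpow_add ht, Real.rpow_one, mul_smul,
      ← intervalIntegral.integral_smul]
    congr 1
    refine intervalIntegral.integral_congr fun σ hσ => ?_
    rw [Set.uIcc_of_le zero_le_one] at hσ
    rw [smul_smul, ← Real.mul_rpow ht.le (by linarith [hσ.2])]
    ring_nf

/-- Rescaling to `[0, 1]` removes `t` from the singular kernel and from the limits of integration,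
so dominated convergence applies with the majorant `C (1 - σ)^(-α)`. -/
theorem continuous_fracInt {α : ℝ} (hα1 : α < 1) {W : ℝ → H} (hW : Continuous W) :
    Continuous (fracInt α W) := by
  refine (Real.continuous_rpow_const (by linarith)).smul ?_
  refine continuous_iff_continuousAt.2 fun t₀ => ?_
  obtain ⟨C, hC⟩ := (isCompact_Icc (a := -(|t₀| + 1)) (b := |t₀| + 1)).exists_bound_of_continuousOn
    hW.continuousOn
  refine intervalIntegral.continuousAt_of_dominated_interval
    (bound := fun σ => (1 - σ) ^ (-α) * C) ?_ ?_ ?_ ?_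
  · refine Eventually.of_forall fun t => ?_
    exact (intervalIntegrable_sub_rpow hα1 1 0 1).def'.aestronglyMeasurable.smul
      (Continuous.aestronglyMeasurable (by fun_prop))
  · filter_upwards [Metric.ball_mem_nhds t₀ one_pos] with t ht
    refine Eventually.of_forall fun σ hσ => ?_
    rw [Set.uIoc_of_le zero_le_one] at hσ
    have h0 : 0 ≤ (1 - σ) ^ (-α) := Real.rpow_nonneg (by linarith [hσ.2]) _
    rw [norm_smul, Real.norm_of_nonneg h0]
    refine mul_le_mul_of_nonneg_left (hC _ (abs_le.1 ?_)) h0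
    rw [abs_mul, abs_of_pos hσ.1]
    have h1 : |t| ≤ |t₀| + 1 := by
      have := abs_sub_abs_le_abs_sub t t₀
      rw [Metric.mem_ball, Real.dist_eq] at ht
      linarith
    nlinarith [hσ.1, hσ.2, abs_nonneg t]
  · exact (intervalIntegrable_sub_rpow hα1 1 0 1).mul_const C
  · exact Eventually.of_forall fun σ _ => by fun_prop

/-- The part of the square `(0, t]²` below the diagonal. -/
noncomputable def triangle (t : ℝ) : Measure (ℝ × ℝ) :=
  ((volume.restrict (Set.Ioc 0 t)).prod (volume.restrict (Set.Ioc 0 t))).restrict {p | p.2 < p.1}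

instance (t : ℝ) : IsFiniteMeasure (triangle t) := by unfold triangle; infer_instance

theorem measurableSet_lt_diag : MeasurableSet {p : ℝ × ℝ | p.2 < p.1} :=
  measurableSet_lt measurable_snd measurable_fst

theorem ae_triangle (t : ℝ) : ∀ᵐ p ∂triangle t, p.2 < p.1 ∧ p.1 ∈ Set.Ioc 0 t ∧ p.2 ∈ Set.Ioc 0 t
    := by
  rw [triangle, Measure.prod_restrict]
  filter_upwards [ae_restrict_mem measurableSet_lt_diag, ae_restrict_of_ae (ae_restrict_mem
    (measurableSet_Ioc.prod measurableSet_Ioc))] with p hp hq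
  exact ⟨hp, hq.1, hq.2⟩

theorem integral_triangle {t : ℝ} (ht : 0 ≤ t) {F : ℝ × ℝ → ℝ} (hF : Integrable F (triangle t)) :
    ∫ p, F p ∂triangle t = ∫ s in (0 : ℝ)..t, ∫ r in (0 : ℝ)..s, F (s, r) := by
  rw [triangle, ← integral_indicator measurableSet_lt_diag, integral_prod _
    ((integrable_indicator_iff measurableSet_lt_diag).2 hF), intervalIntegral.integral_of_le ht]
  refine setIntegral_congr_fun measurableSet_Ioc fun s hs => ?_
  rw [intervalIntegral.integral_of_le hs.1.le, integral_Ioc_eq_integral_Ioo (x := (0 : ℝ)) (y := s),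
    ← integral_indicator measurableSet_Ioc, ← integral_indicator measurableSet_Ioo]
  congr 1
  funext r
  by_cases h1 : r ∈ Set.Ioo 0 s
  · have h2 : r ∈ Set.Ioc 0 t := ⟨h1.1, h1.2.le.trans hs.2⟩
    have h3 : (s, r) ∈ {p : ℝ × ℝ | p.2 < p.1} := h1.2
    rw [Set.indicator_of_mem h1, Set.indicator_of_mem h2, Set.indicator_of_mem h3]
  · rw [Set.indicator_of_notMem h1]
    by_cases h2 : r ∈ Set.Ioc 0 t
    · rw [Set.indicator_of_mem h2, Set.indicator_of_notMem]
      exact fun h3 => h1 ⟨h2.1, h3⟩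
    · rw [Set.indicator_of_notMem h2]

/-- On the triangle the kernel coincides with the convolution integrand of two integrable functions,
the indicator of `(0, t]` and the truncation of `x^(-α)` to `(0, t]`. -/
theorem integrable_rpow_triangle {α : ℝ} (hα1 : α < 1) (t : ℝ) :
    Integrable (fun p : ℝ × ℝ => (p.1 - p.2) ^ (-α)) (triangle t) := by
  have h1 : Integrable (Set.indicator (Set.Ioc 0 t) fun _ => (1 : ℝ)) volume :=
    (integrable_indicator_iff measurableSet_Ioc).2 (integrable_const _)
  have h2 : Integrable (Set.indicator (Set.Ioc 0 t) fun x : ℝ => x ^ (-α)) volume := by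
    refine (integrable_indicator_iff measurableSet_Ioc).2 ?_
    rcases le_total t 0 with h | h
    · rw [Set.Ioc_eq_empty_of_le h]
      exact integrableOn_empty
    · exact (intervalIntegrable_iff_integrableOn_Ioc_of_le h).1
        (intervalIntegral.intervalIntegrable_rpow' (by linarith))
  have h3 := h1.convolution_integrand (ContinuousLinearMap.mul ℝ ℝ) h2
  refine (h3.mono_measure (μ := triangle t) ?_).congr ?_
  · rw [triangle, Measure.prod_restrict]
    exact Measure.restrict_le_self.trans Measure.restrict_le_self
  · filter_upwards [ae_triangle t] with p hp
    have : p.1 - p.2 ∈ Set.Ioc 0 t := ⟨by linarith [hp.1], by linarith [hp.2.1.2, hp.2.2.1]⟩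
    simp [Set.indicator_of_mem hp.2.2, Set.indicator_of_mem this]

/-- The function `y(s) = ∫₀ˢ e^(-l(s - r)) W(r) dr` solves `y' = W - l y`, `y(0) = 0`. Hence `⟪S W,
y⟫ = (½⟪S y, y⟫)' + l ⟪S y, y⟫`, and the integral equals `½⟪S y(t), y(t)⟫ + l ∫ ⟪S y, y⟫ ≥ 0`. -/
theorem integral_exp_volterra_nonneg [CompleteSpace H] {S : H →L[ℝ] H}
    (hS : ∀ x y, inner ℝ (S x) y = inner ℝ (S y) x)
    (hS0 : ∀ x, 0 ≤ inner ℝ (S x) x) {W : ℝ → H} (hW : Continuous W) {l t : ℝ} (hl : 0 ≤ l)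
    (ht : 0 ≤ t) :
    0 ≤ ∫ s in (0 : ℝ)..t, ∫ r in (0 : ℝ)..s, Real.exp (-(l * (s - r))) * inner ℝ (S (W s)) (W r)
      := by
  set z : ℝ → H := fun s => ∫ r in (0 : ℝ)..s, Real.exp (l * r) • W r with hz
  have hc : Continuous fun r => Real.exp (l * r) • W r := by fun_prop
  have hzd : ∀ s, HasDerivAt z (Real.exp (l * s) • W s) s := fun s =>
    intervalIntegral.integral_hasDerivAt_right (hc.intervalIntegrable _ _)
      (hc.stronglyMeasurableAtFilter _ _) hc.continuousAt
  set y : ℝ → H := fun s => Real.exp (-(l * s)) • z s with hy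
  have hyd : ∀ s, HasDerivAt y (W s - l • y s) s := by
    intro s
    have h1 : HasDerivAt (fun s => Real.exp (-(l * s))) (Real.exp (-(l * s)) * -(l * 1)) s :=
      (((hasDerivAt_id s).const_mul l).neg).exp
    refine (h1.smul (hzd s)).congr_deriv ?_
    rw [smul_smul, ← Real.exp_add, neg_add_cancel, Real.exp_zero, one_smul, hy]
    simp only [smul_smul, mul_one]
    rw [sub_eq_add_neg, ← neg_smul]
    congr 2
    ring
  have hyc : Continuous y := continuous_iff_continuousAt.2 fun s => (hyd s).continuousAt
  have hinner : ∀ s, ∫ r in (0 : ℝ)..s, Real.exp (-(l * (s - r))) * inner ℝ (S (W s)) (W r)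
      = inner ℝ (S (W s)) (y s) := by
    intro s
    rw [hy, hz]
    simp only
    rw [inner_smul_right, ← innerSL_apply_apply ℝ, ← ContinuousLinearMap.intervalIntegral_comp_comm
      _
      (hc.intervalIntegrable _ _), ← intervalIntegral.integral_const_mul]
    refine intervalIntegral.integral_congr fun r _ => ?_
    simp only [innerSL_apply_apply, inner_smul_right]
    rw [← mul_assoc, ← Real.exp_add]
    congr 2
    ring
  simp only [hinner]
  have hd : ∀ s, HasDerivAt (fun s => (1 / 2) * inner ℝ (S (y s)) (y s))
      (inner ℝ (S (W s)) (y s) - l * inner ℝ (S (y s)) (y s)) s := by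
    intro s
    refine (((S.hasFDerivAt.comp_hasDerivAt s (hyd s)).inner ℝ (hyd s)).const_mul _).congr_deriv ?_
    simp only [Function.comp_apply, map_sub, map_smul, inner_sub_left, inner_sub_right,
      inner_smul_left, inner_smul_right, RCLike.conj_to_real]
    rw [hS (y s) (W s)]
    ring
  have i1 : Continuous fun s => inner ℝ (S (W s)) (y s) := by fun_prop
  have i2 : Continuous fun s => l * inner ℝ (S (y s)) (y s) := by fun_prop
  have h3 := intervalIntegral.integral_eq_sub_of_hasDerivAt (a := 0) (b := t)
    (fun s _ => hd s) ((i1.sub i2).intervalIntegrable _ _)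
  rw [intervalIntegral.integral_sub (i1.intervalIntegrable _ _) (i2.intervalIntegrable _ _)] at h3
  have hy0 : y 0 = 0 := by simp [hy, hz]
  have h4 : 0 ≤ ∫ s in (0 : ℝ)..t, l * inner ℝ (S (y s)) (y s) :=
    intervalIntegral.integral_nonneg ht fun s _ => mul_nonneg hl (hS0 _)
  have h5 := hS0 (y t)
  simp only [hy0, map_zero, inner_zero_left, mul_zero, sub_zero] at h3
  linarith

/-- The fractional integral is a positive operator. -/
theorem integral_fracInt_nonneg [CompleteSpace H] {S : H →L[ℝ] H}
    (hS : ∀ x y, inner ℝ (S x) y = inner ℝ (S y) x)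
    (hS0 : ∀ x, 0 ≤ inner ℝ (S x) x) {W : ℝ → H} (hW : Continuous W) {α t : ℝ}
    (hα0 : 0 < α) (hα1 : α < 1) (ht : 0 ≤ t) :
    0 ≤ ∫ s in (0 : ℝ)..t, inner ℝ (S (W s)) (fracInt α W s) := by
  set k : ℝ × ℝ → ℝ := fun p => inner ℝ (S (W p.1)) (W p.2) with hk
  have hkc : Continuous k := by fun_prop
  obtain ⟨C, hC⟩ := ((isCompact_Icc (a := (0:ℝ)) (b := t)).prod
    (isCompact_Icc (a := (0:ℝ)) (b := t))).exists_bound_of_continuousOn hkc.continuousOn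
  have hkC : ∀ᵐ p ∂triangle t, ‖k p‖ ≤ C := by
    filter_upwards [ae_triangle t] with p hp
    exact hC p ⟨Set.Ioc_subset_Icc_self hp.2.1, Set.Ioc_subset_Icc_self hp.2.2⟩
  have hint : Integrable (fun p : ℝ × ℝ => (p.1 - p.2) ^ (-α) * k p) (triangle t) :=
    (integrable_rpow_triangle hα1 t).mul_bdd hkc.aestronglyMeasurable hkC
  have e1 : ∫ s in (0 : ℝ)..t, inner ℝ (S (W s)) (fracInt α W s)
      = ∫ p, (p.1 - p.2) ^ (-α) * k p ∂triangle t := by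
    rw [integral_triangle ht hint]
    refine intervalIntegral.integral_congr fun s hs => ?_
    rw [Set.uIcc_of_le ht] at hs
    simp only
    rw [fracInt_eq hα1 W hs.1, ← innerSL_apply_apply ℝ, ←
      ContinuousLinearMap.intervalIntegral_comp_comm]
    · simp [innerSL_apply_apply, hk]
    · exact (intervalIntegrable_sub_rpow hα1 s 0 s).smul_continuousOn hW.continuousOn
  -- The kernel `x^(-α)` as a superposition of decaying exponentials with positive density `l^(α -
  -- 1) / Γ(α)`.
  have hlap : ∀ x : ℝ, 0 < x → ∫ l in Set.Ioi (0 : ℝ), l ^ (α - 1) * Real.exp (-(x * l))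
      = Real.Gamma α * x ^ (-α) := by
    intro x hx
    rw [Real.integral_rpow_mul_exp_neg_mul_Ioi hα0 hx, one_div, Real.inv_rpow hx.le,
      Real.rpow_neg hx.le, mul_comm]
  have hlapi : ∀ x : ℝ, 0 < x → IntegrableOn (fun l : ℝ => l ^ (α - 1) * Real.exp (-(x * l)))
      (Set.Ioi 0) := by
    intro x hx
    -- A non-integrable function has integral `0` by convention, whereas the value in `hlap` is
    -- positive.
    by_contra h
    have h1 := hlap x hx
    rw [integral_undef h] at h1
    have := mul_pos (Real.Gamma_pos_of_pos hα0) (Real.rpow_pos_of_pos hx (-α))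
    linarith
  set g : ℝ × ℝ → ℝ → ℝ := fun p l => l ^ (α - 1) * Real.exp (-((p.1 - p.2) * l)) * k p with hg
  have hgm : Measurable (Function.uncurry g) := by
    have := hkc.measurable
    simp only [hg, Function.uncurry_def]
    fun_prop
  -- Hypothesis of Fubini: integrating the norm over `l` first returns `Γ(α) (s - r)^(-α) |k|`,
  -- which is integrable on the triangle.
  have hgi : Integrable (Function.uncurry g) ((triangle t).prod (volume.restrict (Set.Ioi 0))) := by
    refine (integrable_prod_iff hgm.aestronglyMeasurable).2 ⟨?_, ?_⟩
    · filter_upwards [ae_triangle t] with p hp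
      have := (hlapi (p.1 - p.2) (by linarith [hp.1])).mul_const (k p)
      exact this
    · refine (hint.norm.const_mul (Real.Gamma α)).congr ?_
      filter_upwards [ae_triangle t] with p hp
      have hp0 : 0 < p.1 - p.2 := by linarith [hp.1]
      have : ∀ l ∈ Set.Ioi (0 : ℝ), ‖Function.uncurry g (p, l)‖
          = l ^ (α - 1) * Real.exp (-((p.1 - p.2) * l)) * ‖k p‖ := by
        intro l hl
        have := Real.rpow_nonneg (le_of_lt hl) (α - 1)
        simp only [Function.uncurry_apply_pair, hg, norm_mul, Real.norm_of_nonneg this,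
          Real.norm_of_nonneg (Real.exp_pos _).le]
      rw [setIntegral_congr_fun measurableSet_Ioi this, integral_mul_const, hlap _ hp0, norm_mul,
        Real.norm_of_nonneg (Real.rpow_nonneg hp0.le _), mul_assoc]
  have hswap := integral_integral_swap hgi
  have e2 : ∫ p, (∫ l in Set.Ioi (0 : ℝ), g p l) ∂triangle t
      = Real.Gamma α * ∫ p, (p.1 - p.2) ^ (-α) * k p ∂triangle t := by
    rw [← integral_const_mul]
    refine integral_congr_ae ?_
    filter_upwards [ae_triangle t] with p hp
    simp only [hg]
    rw [integral_mul_const, hlap _ (by linarith [hp.1]), mul_assoc]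
  have hpos : 0 ≤ ∫ l in Set.Ioi (0 : ℝ), (∫ p, g p l ∂triangle t) := by
    refine setIntegral_nonneg measurableSet_Ioi fun l hl => ?_
    have hl' : (0 : ℝ) ≤ l := le_of_lt hl
    have hi : Integrable (fun p : ℝ × ℝ => Real.exp (-(l * (p.1 - p.2))) * k p) (triangle t) := by
      refine Integrable.mul_bdd (f := fun p : ℝ × ℝ => Real.exp (-(l * (p.1 - p.2)))) (c := C) ?_
        hkc.aestronglyMeasurable hkC
      refine Integrable.of_bound (Continuous.aestronglyMeasurable (by fun_prop)) 1 ?_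
      filter_upwards [ae_triangle t] with p hp
      rw [Real.norm_of_nonneg (Real.exp_pos _).le, Real.exp_le_one_iff]
      have := mul_nonneg hl' (by linarith [hp.1] : 0 ≤ p.1 - p.2)
      linarith
    have : ∫ p, g p l ∂triangle t
        = l ^ (α - 1) * ∫ p, Real.exp (-(l * (p.1 - p.2))) * k p ∂triangle t := by
      rw [← integral_const_mul]
      congr 1
      funext p
      simp only [hg]
      rw [mul_comm (p.1 - p.2) l, mul_assoc]
    rw [this, integral_triangle ht hi]
    exact mul_nonneg (Real.rpow_nonneg hl' _) (integral_exp_volterra_nonneg hS hS0 hW hl' ht)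
  rw [← hswap, e2] at hpos
  rw [e1]
  exact nonneg_of_mul_nonneg_right hpos (Real.Gamma_pos_of_pos hα0)

end Volterra

end FracWave

/-! ### Weak time derivatives of scalar functions, and classes in `L²`. -/

namespace FracWave

/-- The du Bois-Reymond lemma. -/
theorem sub_eq_neg_integral_of_weak_deriv {f k : ℝ → ℝ} (hf : Continuous f) (hk : Continuous k)
    (h : ∀ θ : ℝ → ℝ, ContDiff ℝ ∞ θ → HasCompactSupport θ → tsupport θ ⊆ Set.Ioi 0 →
      ∫ t, (-(deriv θ t * f t) + θ t * k t) = 0) {s t : ℝ} (hs : 0 < s) (hst : s ≤ t) :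
    f t - f s = -∫ r in s..t, k r := by
  -- Adding a primitive of `k` reduces the claim to a continuous function with weak derivative zero
  -- on `(0, ∞)`, which is shown to be constant there by mollification.
  set g : ℝ → ℝ := fun t => f t + ∫ r in (0 : ℝ)..t, k r with hg
  have hgc : Continuous g :=
    hf.add (intervalIntegral.continuous_primitive (fun a b => hk.intervalIntegrable a b) 0)
  have hkd : ∀ t, HasDerivAt (fun t => ∫ r in (0 : ℝ)..t, k r) (k t) t := fun t =>
    intervalIntegral.integral_hasDerivAt_right (hk.intervalIntegrable _ _)
      (hk.stronglyMeasurableAtFilter _ _) hk.continuousAt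
  have hgθ : ∀ θ : ℝ → ℝ, ContDiff ℝ ∞ θ → HasCompactSupport θ → tsupport θ ⊆ Set.Ioi 0 →
      ∫ t, deriv θ t * g t = 0 := by
    intro θ hθ hθc hθs
    have c1 : Continuous (deriv θ) := hθ.continuous_deriv (by simp)
    have hθ' : HasCompactSupport (deriv θ) := hθc.deriv
    have hkc : Continuous fun t => ∫ r in (0 : ℝ)..t, k r :=
      intervalIntegral.continuous_primitive (fun a b => hk.intervalIntegrable a b) 0
    have i1 : Integrable fun t => deriv θ t * f t :=
      (c1.mul hf).integrable_of_hasCompactSupport hθ'.mul_right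
    have i2 : Integrable fun t => θ t * k t :=
      (hθ.continuous.mul hk).integrable_of_hasCompactSupport hθc.mul_right
    have i3 : Integrable fun t => deriv θ t * ∫ r in (0 : ℝ)..t, k r :=
      (c1.mul hkc).integrable_of_hasCompactSupport hθ'.mul_right
    have i4 : Integrable fun t => θ t * ∫ r in (0 : ℝ)..t, k r :=
      (hθ.continuous.mul hkc).integrable_of_hasCompactSupport hθc.mul_right
    have hp := integral_mul_deriv_eq_deriv_mul_of_integrable
      (fun t _ => (hθ.differentiable (by simp) t).hasDerivAt) (fun t _ => hkd t) i2 i3 i4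
    have h0 := h θ hθ hθc hθs
    have h1 := integral_add i1.neg i2
    simp only [Pi.neg_apply, integral_neg] at h1
    rw [h1] at h0
    simp only [hg, mul_add]
    rw [integral_add i1 i3]
    linarith
  suffices hgst : g t = g s by
    have := intervalIntegral.integral_interval_sub_left (hk.intervalIntegrable (μ := volume) 0 t)
      (hk.intervalIntegrable 0 s)
    simp only [hg] at hgst
    linarith
  -- Radii below `s` keep the bump translated to any `x ≥ s` supported in `(0, ∞)`, so it is an
  -- admissible test function.
  have hb : ∀ m : ℕ, ∃ ρ : ContDiffBump (0 : ℝ), ρ.rOut = s / (m + 2) := fun m =>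
    ⟨⟨s / (m + 2) / 2, s / (m + 2), by positivity, half_lt_self (by positivity)⟩, rfl⟩
  choose ρ hρ using hb
  have hρ0 : Tendsto (fun m => (ρ m).rOut) atTop (𝓝 0) := by
    simp only [hρ]
    exact Tendsto.const_div_atTop (tendsto_atTop_add_const_right _ _ tendsto_natCast_atTop_atTop) _
  have lim : ∀ x, Tendsto (fun m => convolution ((ρ m).normed volume) g
      (ContinuousLinearMap.lsmul ℝ ℝ) volume x) atTop (𝓝 (g x)) := fun x =>
    ContDiffBump.convolution_tendsto_right_of_continuous hρ0 hgc x
  refine tendsto_nhds_unique (lim t) ((lim s).congr fun m => ?_)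
  set r := (ρ m).normed volume with hr
  have hrs : ContDiff ℝ ∞ r := (ρ m).contDiff_normed
  have hrc : HasCompactSupport r := (ρ m).hasCompactSupport_normed
  have hd : ∀ x, HasDerivAt (convolution r g (ContinuousLinearMap.lsmul ℝ ℝ) volume)
      (convolution (deriv r) g (ContinuousLinearMap.lsmul ℝ ℝ) volume x) x := fun x =>
    hrc.hasDerivAt_convolution_left _ (hrs.of_le (by simp)) hgc.locallyIntegrable x
  have hz : ∀ x ∈ Set.Ici s, convolution (deriv r) g (ContinuousLinearMap.lsmul ℝ ℝ) volume x = 0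
    := by
    intro x hx
    rw [convolution_eq_swap]
    have e : (fun y => r (x - y)) = r ∘ fun y => x - y := rfl
    have hθ := hgθ (fun y => r (x - y)) (hrs.comp (contDiff_const.sub contDiff_id))
      (by rw [e]; exact hrc.comp_homeomorph (Homeomorph.subLeft x)) ?_
    · simp only [ContinuousLinearMap.lsmul_apply, smul_eq_mul]
      simp only [deriv_comp_const_sub, neg_mul, integral_neg, neg_eq_zero] at hθ
      exact hθ
    · intro y hy
      rw [e] at hy
      have h1 := tsupport_comp_subset_preimage r (f := fun y => x - y) (by fun_prop) hy
      rw [Set.mem_preimage, hr, (ρ m).tsupport_normed_eq, Metric.mem_closedBall, dist_zero_right,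
        Real.norm_eq_abs, hρ] at h1
      have h2 : s / ((m : ℝ) + 2) < s := div_lt_self hs
        (by have := Nat.cast_nonneg (α := ℝ) m; linarith)
      have h3 := (abs_le.1 h1).2
      simp only [Set.mem_Ici] at hx
      simp only [Set.mem_Ioi]
      linarith
  have := intervalIntegral.integral_eq_sub_of_hasDerivAt (a := s) (b := t)
    (f := convolution r g (ContinuousLinearMap.lsmul ℝ ℝ) volume) (f' := fun _ => 0)
    (fun x hx => by
      rw [Set.uIcc_of_le hst] at hx
      exact (hd x).congr_deriv (hz x hx.1)) (by simp)
  simp only [intervalIntegral.integral_zero] at this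
  linarith

section L2

variable {X Y F : Type*} [MeasurableSpace X] [MeasurableSpace Y] [NormedAddCommGroup F]

open scoped Classical in
/-- The class of `f` in `L²(μ)`, or `0` if `f` is not square integrable. -/
noncomputable def toL2 (μ : Measure Y) (f : Y → F) : Lp F 2 μ :=
  if h : MemLp f 2 μ then h.toLp f else 0

variable {μ : Measure X} {ν : Measure Y}

theorem toL2_eq {f : Y → F} (h : MemLp f 2 ν) : toL2 ν f = h.toLp f := dif_pos h

theorem coeFn_toL2 {f : Y → F} (h : MemLp f 2 ν) : toL2 ν f =ᵐ[ν] f := by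
  rw [toL2_eq h]
  exact h.coeFn_toLp

theorem norm_toL2 {f : Y → F} (h : MemLp f 2 ν) : ‖toL2 ν f‖ = (eLpNorm f 2 ν).toReal := by
  rw [toL2_eq h, Lp.norm_toLp]

theorem norm_toL2_sub {f g : Y → F} (hf : MemLp f 2 ν) (hg : MemLp g 2 ν) :
    ‖toL2 ν f - toL2 ν g‖ = (eLpNorm (fun y => f y - g y) 2 ν).toReal := by
  rw [toL2_eq hf, toL2_eq hg, ← MemLp.toLp_sub, Lp.norm_toLp]
  rfl

variable [InnerProductSpace ℝ F]

theorem inner_toL2 {f g : Y → F} (hf : MemLp f 2 ν) (hg : MemLp g 2 ν) :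
    inner ℝ (toL2 ν f) (toL2 ν g) = ∫ y, inner ℝ (f y) (g y) ∂ν := by
  rw [L2.inner_def]
  refine integral_congr_ae ?_
  filter_upwards [coeFn_toL2 hf, coeFn_toL2 hg] with y h1 h2
  rw [h1, h2]

theorem integrable_inner {f g : Y → F} (hf : MemLp f 2 ν) (hg : MemLp g 2 ν) :
    Integrable (fun y => inner ℝ (f y) (g y)) ν := by
  refine (L2.integrable_inner (𝕜 := ℝ) (toL2 ν f) (toL2 ν g)).congr ?_
  filter_upwards [coeFn_toL2 hf, coeFn_toL2 hg] with y h1 h2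
  rw [h1, h2]

theorem integral_norm_inner_le {f g : Y → F} (hf : MemLp f 2 ν) (hg : MemLp g 2 ν) :
    ∫ y, ‖(inner ℝ (f y) (g y) : ℝ)‖ ∂ν ≤ ‖toL2 ν f‖ * ‖toL2 ν g‖ := by
  have h1 : ∫ y, ‖(inner ℝ (f y) (g y) : ℝ)‖ ∂ν ≤ ∫ y, inner ℝ ‖f y‖ ‖g y‖ ∂ν := by
    refine integral_mono (integrable_inner hf hg).norm (integrable_inner hf.norm hg.norm) fun y =>
      ?_
    simp only [Real.inner_apply]
    exact norm_inner_le_norm _ _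
  refine h1.trans ?_
  rw [← inner_toL2 hf.norm hg.norm]
  refine (real_inner_le_norm _ _).trans_eq ?_
  rw [norm_toL2 hf.norm, norm_toL2 hg.norm, norm_toL2 hf, norm_toL2 hg, eLpNorm_norm, eLpNorm_norm]

/-- Cauchy–Schwarz in `Y`, then integration in `X`. The bound `κ` need only be integrable, which
admits the singular kernel `(t - s)^(-α)`. -/
theorem integrable_inner_prod [SFinite μ] [SFinite ν] {w g : X → Y → F} {κ : X → ℝ} {C : ℝ}
    (hw : AEStronglyMeasurable (fun z : X × Y => w z.1 z.2) (μ.prod ν))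
    (hg : AEStronglyMeasurable (fun z : X × Y => g z.1 z.2) (μ.prod ν))
    (hw2 : ∀ᵐ x ∂μ, MemLp (w x) 2 ν ∧ ‖toL2 ν (w x)‖ ≤ κ x)
    (hg2 : ∀ᵐ x ∂μ, MemLp (g x) 2 ν ∧ ‖toL2 ν (g x)‖ ≤ C) (hκ : Integrable κ μ) :
    Integrable (fun z : X × Y => (inner ℝ (w z.1 z.2) (g z.1 z.2) : ℝ)) (μ.prod ν) := by
  have hm := AEStronglyMeasurable.inner (𝕜 := ℝ) hw hg
  refine (integrable_prod_iff hm).2 ⟨?_, ?_⟩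
  · filter_upwards [hw2, hg2] with x h1 h2
    exact integrable_inner h1.1 h2.1
  · refine (hκ.mul_const C).mono' hm.norm.integral_prod_right' ?_
    filter_upwards [hw2, hg2] with x h1 h2
    rw [Real.norm_of_nonneg (integral_nonneg fun _ => norm_nonneg _)]
    exact (integral_norm_inner_le h1.1 h2.1).trans
      (mul_le_mul h1.2 h2.2 (norm_nonneg _) ((norm_nonneg _).trans h1.2))

end L2

end FracWave

/-! ### Mollification, and weak gradients of mollified functions. -/

namespace FracWave

variable {n : ℕ}

theorem memLp_comp_sub_right {F : Type*} [NormedAddCommGroup F] {f : Sp n → F} (hf : MemLp f 2)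
    (y : Sp n) :
    MemLp (fun x => f (x - y)) 2 :=
  hf.comp_measurePreserving (measurePreserving_sub_right volume y)

section Mollify

variable {F : Type*} [NormedAddCommGroup F] [InnerProductSpace ℝ F]

/-- Translations act continuously on `L²`. -/
theorem continuous_correlation {A f : Sp n → F} (hA : MemLp A 2) (hf : MemLp f 2) :
    Continuous fun y => ∫ x, (inner ℝ (A x) (f (x - y)) : ℝ) := by
  let g : C(Sp n, C(Sp n, Sp n)) :=
    (ContinuousMap.mk (fun p : Sp n × Sp n => p.2 - p.1) (by fun_prop)).curry
  have hg : ∀ y, MeasurePreserving (g y) (volume : Measure (Sp n)) volume := fun y =>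
    measurePreserving_sub_right volume y
  have hc : Continuous fun y => Lp.compMeasurePreserving (g y) (hg y) (toL2 volume f) :=
    continuous_const.compMeasurePreservingLp g.continuous hg (by simp)
  have : (fun y => ∫ x, (inner ℝ (A x) (f (x - y)) : ℝ)) = fun y =>
      (inner ℝ (toL2 volume A) (Lp.compMeasurePreserving (g y) (hg y) (toL2 volume f)) : ℝ) := by
    funext y
    rw [← inner_toL2 hA (memLp_comp_sub_right hf y), toL2_eq hf, toL2_eq
      (memLp_comp_sub_right hf y),
      Lp.toLp_compMeasurePreserving]
    rfl
  rw [this]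
  exact continuous_const.inner hc

theorem inner_convolution {A f : Sp n → F} (hA : MemLp A 2) (hf : MemLp f 2) [CompleteSpace F]
    {r : Sp n → ℝ} (hr : Continuous r) (hrc : HasCompactSupport r) :
    ∫ x, (inner ℝ (A x) (convolution r f (ContinuousLinearMap.lsmul ℝ ℝ) volume x) : ℝ)
      = ∫ y, r y * ∫ x, (inner ℝ (A x) (f (x - y)) : ℝ) := by
  have hfm : AEStronglyMeasurable (fun z : Sp n × Sp n => f (z.2 - z.1)) (volume.prod volume) := by
    have := hf.1.comp_quasiMeasurePreserving (quasiMeasurePreserving_sub (G := Sp n) volume volume)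
    exact this.comp_quasiMeasurePreserving Measure.measurePreserving_swap.quasiMeasurePreserving
  have hnorm : ∀ y, ‖toL2 volume (fun x => f (x - y))‖ = ‖toL2 volume f‖ := fun y => by
    rw [norm_toL2 (memLp_comp_sub_right hf y), norm_toL2 hf]
    congr 1
    exact eLpNorm_comp_measurePreserving hf.1 (measurePreserving_sub_right volume y)
  have hi : Integrable (fun z : Sp n × Sp n => (inner ℝ (r z.1 • f (z.2 - z.1)) (A z.2) : ℝ))
      (volume.prod volume) := by
    refine integrable_inner_prod (w := fun y x => r y • f (x - y)) (g := fun _ x => A x)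
      (κ := fun y => |r y| * ‖toL2 volume f‖) (C := ‖toL2 volume A‖) ?_ ?_ ?_ ?_ ?_
    · exact (hr.comp continuous_fst).aestronglyMeasurable.smul hfm
    · exact hA.1.comp_quasiMeasurePreserving Measure.quasiMeasurePreserving_snd
    · refine Eventually.of_forall fun y => ?_
      have hm := (memLp_comp_sub_right hf y).const_smul (r y)
      refine ⟨hm, ?_⟩
      have : toL2 volume (fun x => r y • f (x - y)) = r y • toL2 volume (fun x => f (x - y)) := by
        rw [toL2_eq (memLp_comp_sub_right hf y), ← MemLp.toLp_const_smul, ← toL2_eq hm]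
        rfl
      rw [this, norm_smul, hnorm, Real.norm_eq_abs]
    · exact Eventually.of_forall fun y => ⟨hA, le_rfl⟩
    · exact (hr.abs.integrable_of_hasCompactSupport hrc.norm).mul_const _
  have hswap := integral_integral_swap (f := fun y x => (inner ℝ (r y • f (x - y)) (A x) : ℝ)) hi
  have hloc : LocallyIntegrable f := hf.locallyIntegrable (by norm_num)
  calc _ = ∫ x, ∫ y, (inner ℝ (r y • f (x - y)) (A x) : ℝ) := by
        congr 1
        funext x
        have hex := (hrc.convolutionExists_left (ContinuousLinearMap.lsmul ℝ ℝ) hr hloc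
          x).integrable
        rw [convolution_def, ← integral_inner hex]
        congr 1
        funext y
        rw [real_inner_comm]
        rfl
    _ = _ := by
        rw [← hswap]
        congr 1
        funext y
        rw [← integral_const_mul]
        congr 1
        funext x
        rw [inner_smul_left, real_inner_comm]
        rfl

/-- By Fubini the pairing of `A` with a mollification of `f` is an average of the correlation of `A`
and `f` near `0`, and the correlation is continuous. This gives weak convergence of the
mollifications, which suffices because `zeroTrace` is defined by duality. -/
theorem tendsto_inner_convolution {A f : Sp n → F} (hA : MemLp A 2) (hf : MemLp f 2)
    [CompleteSpace F] {ρ : ℕ → ContDiffBump (0 : Sp n)}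
    (hρ : Tendsto (fun k => (ρ k).rOut) atTop (𝓝 0)) :
    Tendsto (fun k => ∫ x, (inner ℝ (A x) (convolution ((ρ k).normed volume) f
      (ContinuousLinearMap.lsmul ℝ ℝ) volume x) : ℝ)) atTop (𝓝 (∫ x, (inner ℝ (A x) (f x) : ℝ))) :=
        by
  have hc := continuous_correlation hA hf
  have h := ContDiffBump.convolution_tendsto_right_of_continuous hρ (μ := volume)
    (hc.comp continuous_neg) 0
  simp only [Function.comp_apply, neg_zero, sub_zero] at h
  refine h.congr fun k => ?_
  rw [inner_convolution hA hf (ρ k).continuous_normed (ρ k).hasCompactSupport_normed,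
    convolution_def]
  simp

theorem gradient_mul {f g : Sp n → ℝ} {x : Sp n} (hf : DifferentiableAt ℝ f x)
    (hg : DifferentiableAt ℝ g x) :
    gradient (fun y => f y * g y) x = f x • gradient g x + g x • gradient f x := by
  apply (InnerProductSpace.toDual ℝ (Sp n)).injective
  rw [map_add, map_smul, map_smul, toDual_gradient, toDual_gradient, toDual_gradient,
    fderiv_fun_mul hf hg]

theorem continuous_gradient {f : Sp n → ℝ} (hf : ContDiff ℝ ∞ f) : Continuous (gradient f) :=
  (InnerProductSpace.toDual ℝ (Sp n)).symm.continuous.comp (hf.continuous_fderiv (by simp))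

theorem support_gradient_subset (f : Sp n → ℝ) : Function.support (gradient f) ⊆ tsupport f := by
  intro x hx
  refine support_fderiv_subset ℝ (f := f) fun h => hx ?_
  rw [gradient, h, map_zero]

theorem hasCompactSupport_gradient {f : Sp n → ℝ} (hf : HasCompactSupport f) :
    HasCompactSupport (gradient f) :=
  hf.mono' (support_gradient_subset f)

/-- The derivative falls on `r`; the definition of the weak gradient with test function `y ↦ r (x -
y)` then moves it to `f`. -/
theorem gradient_convolution {f : Sp n → ℝ} {p : Sp n → Sp n} (hf : MemLp f 2) (hp : MemLp p 2)
    (hfp : IsWeakGradient f p) {r : Sp n → ℝ} (hr : ContDiff ℝ ∞ r) (hrc : HasCompactSupport r)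
    (x : Sp n) :
    gradient (convolution r f (ContinuousLinearMap.lsmul ℝ ℝ) volume) x
      = convolution r p (ContinuousLinearMap.lsmul ℝ ℝ) volume x := by
  have hfl : LocallyIntegrable f := hf.locallyIntegrable (by norm_num)
  have hpl : LocallyIntegrable p := hp.locallyIntegrable (by norm_num)
  refine HasGradientAt.gradient ?_
  rw [hasGradientAt_iff_hasFDerivAt]
  refine (hrc.hasFDerivAt_convolution_left (ContinuousLinearMap.lsmul ℝ ℝ)
    (hr.of_le (by simp)) hfl x).congr_fderiv ?_
  have hrx : ContDiff ℝ ∞ fun y => r (x - y) := hr.comp (contDiff_const.sub contDiff_id)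
  have hrxc : HasCompactSupport fun y => r (x - y) :=
    hrc.comp_homeomorph (Homeomorph.subLeft x)
  have hw := hfp _ hrx hrxc
  have hgr : ∀ y, gradient (fun y => r (x - y)) y = -gradient r (x - y) := by
    intro y
    apply (InnerProductSpace.toDual ℝ (Sp n)).injective
    have h1 : HasFDerivAt (fun y => r (x - y))
        ((fderiv ℝ r (x - y)).comp (-ContinuousLinearMap.id ℝ (Sp n))) y :=
      HasFDerivAt.comp y (hr.differentiable (by simp) (x - y)).hasFDerivAt
        ((hasFDerivAt_id y).const_sub x)
    rw [map_neg, toDual_gradient, toDual_gradient, h1.fderiv]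
    ext v
    simp
  simp only [hgr, smul_neg, integral_neg, neg_inj] at hw
  have e1 : convolution r p (ContinuousLinearMap.lsmul ℝ ℝ) volume x
      = ∫ y, f y • gradient r (x - y) := by
    rw [hw, convolution_eq_swap]
    simp
  have hgi : Integrable fun y => f y • gradient r (x - y) := by
    have hgc : HasCompactSupport (gradient r) := hasCompactSupport_gradient hrc
    have := hfl.integrable_smul_right_of_hasCompactSupport (g := fun y => gradient r (x - y))
      ((continuous_gradient hr).comp (by fun_prop)) (hgc.comp_homeomorph (Homeomorph.subLeft x))
    exact this
  ext v
  rw [e1, InnerProductSpace.toDual_apply_apply, real_inner_comm, ← integral_inner hgi,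
    convolution_eq_swap, ContinuousLinearMap.integral_apply]
  · congr 1
    funext y
    rw [ContinuousLinearMap.precompL_apply, inner_smul_right, real_inner_comm, inner_gradient_left]
    simp [mul_comm]
  · have := ((hrc.fderiv ℝ).convolutionExists_left
      ((ContinuousLinearMap.lsmul ℝ ℝ).precompL (Sp n)) (hr.continuous_fderiv (by simp)) hfl x)
    exact this.integrable_swap

end Mollify

end FracWave

/-! ### Test functions and `H¹₀(D)`. -/

namespace FracWave

variable {n : ℕ}

/-- `ψ` is a test function in `D`. -/
structure IsTest (D : Set (Sp n)) (ψ : Sp n → ℝ) : Prop where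
  contDiff : ContDiff ℝ ∞ ψ
  hasCompactSupport : HasCompactSupport ψ
  tsupport_subset : tsupport ψ ⊆ D

namespace IsTest

variable {D : Set (Sp n)} {ψ : Sp n → ℝ}

theorem memLp (h : IsTest D ψ) (μ : Measure (Sp n)) [IsFiniteMeasureOnCompacts μ] : MemLp ψ 2 μ :=
  h.contDiff.continuous.memLp_of_hasCompactSupport h.hasCompactSupport

theorem memLp_gradient (h : IsTest D ψ) (μ : Measure (Sp n)) [IsFiniteMeasureOnCompacts μ] :
    MemLp (gradient ψ) 2 μ :=
  (continuous_gradient h.contDiff).memLp_of_hasCompactSupport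
    (hasCompactSupport_gradient h.hasCompactSupport)

end IsTest

/-- `(A, B)` annihilates all pairs `(ψ, ∇ψ)` with `ψ` a test function in `D`. -/
def Annihilates (D : Set (Sp n)) (A : Lp ℝ 2 (volume.restrict D))
    (B : Lp (Sp n) 2 (volume.restrict D)) : Prop :=
  ∀ ψ, IsTest D ψ → inner ℝ A (toL2 _ ψ) + inner ℝ B (toL2 _ (gradient ψ)) = 0

/-- The pairs `(f, ∇f)` with `f ∈ H¹₀(D)`, as the closed span of the pairs `(ψ, ∇ψ)` with `ψ` a test
function in `D`. -/
def zeroTrace (D : Set (Sp n)) :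
    Submodule ℝ (Lp ℝ 2 (volume.restrict D) × Lp (Sp n) 2 (volume.restrict D)) where
  -- A double annihilator, which in a Hilbert space is the closed span. The equation tested with
  -- smooth functions says that some pair annihilates, so it extends to this space by definition.
  carrier := {q | ∀ A B, Annihilates D A B → inner ℝ A q.1 + inner ℝ B q.2 = 0}
  zero_mem' := by simp
  add_mem' := by
    intro q q' hq hq' A B h
    have h1 := hq A B h
    have h2 := hq' A B h
    simp only [Prod.fst_add, Prod.snd_add, inner_add_right]
    linarith
  smul_mem' := by
    intro c q hq A B h
    have h1 := hq A B h
    simp only [Prod.smul_fst, Prod.smul_snd, inner_smul_right]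
    rw [← mul_add, h1, mul_zero]

theorem tendsto_toL2 {Y F : Type*} [MeasurableSpace Y] [NormedAddCommGroup F] {ν : Measure Y}
    {ι : Type*} {l : Filter ι} {f : Y → F} {g : ι → Y → F} (hf : MemLp f 2 ν)
    (hg : ∀ᶠ i in l, MemLp (g i) 2 ν)
    (h : Tendsto (fun i => eLpNorm (fun y => f y - g i y) 2 ν) l (𝓝 0)) :
    Tendsto (fun i => toL2 ν (g i)) l (𝓝 (toL2 ν f)) := by
  rw [tendsto_iff_norm_sub_tendsto_zero]
  have := (ENNReal.tendsto_toReal ENNReal.zero_ne_top).comp h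
  rw [ENNReal.toReal_zero] at this
  refine this.congr' ?_
  filter_upwards [hg] with i hi
  rw [norm_sub_rev, norm_toL2_sub hf hi]
  rfl

theorem mem_zeroTrace_of_vanishesOnBoundary {D : Set (Sp n)} {f : Sp n → ℝ} {p : Sp n → Sp n}
    (hf : MemLp f 2 (volume.restrict D)) (hp : MemLp p 2 (volume.restrict D))
    (h : VanishesOnBoundary D f p) : (toL2 _ f, toL2 _ p) ∈ zeroTrace D := by
  obtain ⟨η, hη, h1, h2⟩ := h
  intro A B hAB
  have ht : ∀ k, IsTest D (η k) := fun k => ⟨(hη k).1, (hη k).2.1, (hη k).2.2⟩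
  have l1 := tendsto_toL2 hf (Eventually.of_forall fun k => (ht k).memLp _) h1
  have l2 := tendsto_toL2 hp (Eventually.of_forall fun k => (ht k).memLp_gradient _) h2
  have l3 := ((tendsto_const_nhds (x := A)).inner (𝕜 := ℝ) l1).add
    ((tendsto_const_nhds (x := B)).inner (𝕜 := ℝ) l2)
  refine tendsto_nhds_unique l3 (tendsto_const_nhds.congr fun k => ?_)
  exact (hAB _ (ht k)).symm

/-- The mollifications of `f` at scales below `R - r` are test functions in the ball of radius `R`,
and their pairings with an annihilating pair converge to those of `(f, p)`. -/
theorem mem_zeroTrace_of_isWeakGradient {r R : ℝ} (hrR : r < R) {f : Sp n → ℝ} {p : Sp n → Sp n}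
    (hf : MemLp f 2) (hp : MemLp p 2) (hfp : IsWeakGradient f p)
    (hsupp : Function.support f ⊆ Metric.closedBall 0 r) :
    (toL2 (volume.restrict (Metric.closedBall 0 R)) f, toL2 _ p)
      ∈ zeroTrace (Metric.closedBall (0 : Sp n) R) := by
  set D := Metric.closedBall (0 : Sp n) R
  intro A B hAB
  have hD : MeasurableSet D := Metric.isClosed_closedBall.measurableSet
  have hb : ∀ m : ℕ, ∃ ρ : ContDiffBump (0 : Sp n), ρ.rOut = (R - r) / (m + 2) := fun m => by
    have : 0 < (R - r) / (m + 2) := div_pos (by linarith) (by positivity)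
    exact ⟨⟨(R - r) / (m + 2) / 2, (R - r) / (m + 2), by positivity, half_lt_self this⟩, rfl⟩
  choose ρ hρ using hb
  have hρ0 : Tendsto (fun m => (ρ m).rOut) atTop (𝓝 0) := by
    simp only [hρ]
    exact Tendsto.const_div_atTop (tendsto_atTop_add_const_right _ _ tendsto_natCast_atTop_atTop) _
  -- Extension of the annihilator by zero turns pairings over `D` into pairings over the whole
  -- space, where convolution lives.
  have ext : ∀ {F : Type} [NormedAddCommGroup F] [InnerProductSpace ℝ F]
      (C : Lp F 2 (volume.restrict D)) (g : Sp n → F), MemLp g 2 (volume.restrict D) →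
      (inner ℝ C (toL2 _ g) : ℝ) = ∫ x, (inner ℝ (D.indicator C x) (g x) : ℝ) := by
    intro F _ _ C g hg
    have hC : toL2 (volume.restrict D) (C : Sp n → F) = C := by
      rw [toL2_eq (Lp.memLp C), Lp.toLp_coeFn]
    conv_lhs => rw [← hC]
    rw [inner_toL2 (Lp.memLp C) hg, ← integral_indicator hD]
    congr 1
    funext x
    by_cases hx : x ∈ D <;> simp [hx]
  have hA : MemLp (D.indicator A) 2 := (memLp_indicator_iff_restrict hD).2 (Lp.memLp A)
  have hB : MemLp (D.indicator B) 2 := (memLp_indicator_iff_restrict hD).2 (Lp.memLp B)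
  have l3 := (tendsto_inner_convolution hA hf hρ0).add (tendsto_inner_convolution hB hp hρ0)
  rw [← ext A f (hf.restrict D), ← ext B p (hp.restrict D)] at l3
  refine tendsto_nhds_unique l3 (tendsto_const_nhds.congr fun k => ?_)
  set s := (ρ k).normed volume with hs
  have hsd : ContDiff ℝ ∞ s := (ρ k).contDiff_normed
  have hsc : HasCompactSupport s := (ρ k).hasCompactSupport_normed
  have hloc : LocallyIntegrable f := hf.locallyIntegrable (by norm_num)
  have htsupp : tsupport (convolution s f (ContinuousLinearMap.lsmul ℝ ℝ) volume) ⊆ D := by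
    refine closure_minimal ?_ Metric.isClosed_closedBall
    refine (support_convolution_subset _).trans ?_
    rintro _ ⟨y, hy, z, hz, rfl⟩
    rw [hs, (ρ k).support_normed_eq, Metric.mem_ball, dist_zero_right, hρ] at hy
    have hz' := hsupp hz
    rw [Metric.mem_closedBall, dist_zero_right] at hz' ⊢
    have h1 : (R - r) / ((k : ℝ) + 2) ≤ R - r :=
      div_le_self (by linarith) (by have := Nat.cast_nonneg (α := ℝ) k; linarith)
    have h2 : ‖y + z‖ ≤ ‖y‖ + ‖z‖ := norm_add_le y z
    change ‖y + z‖ ≤ R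
    linarith
  have ht : IsTest D (convolution s f (ContinuousLinearMap.lsmul ℝ ℝ) volume) :=
    ⟨hsc.contDiff_convolution_left _ hsd hloc,
      HasCompactSupport.intro (isCompact_closedBall 0 R) fun x hx =>
        image_eq_zero_of_notMem_tsupport fun h => hx (htsupp h), htsupp⟩
  have h0 := hAB _ ht
  rw [ext A _ (ht.memLp _), ext B _ (ht.memLp_gradient _)] at h0
  rw [← h0]
  congr 2
  funext x
  rw [gradient_convolution hf hp hfp hsd hsc]

theorem IsWeakGradient.mul {f : Sp n → ℝ} {p : Sp n → Sp n} (hf : LocallyIntegrable f)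
    (hp : LocallyIntegrable p) (h : IsWeakGradient f p) {η : Sp n → ℝ} (hη : ContDiff ℝ ∞ η) :
    IsWeakGradient (fun x => η x * f x) (fun x => η x • p x + f x • gradient η x) := by
  intro ζ hζ hζc
  have h0 := h (fun x => η x * ζ x) (hη.mul hζ) hζc.mul_left
  have hg : ∀ x, gradient (fun x => η x * ζ x) x = η x • gradient ζ x + ζ x • gradient η x :=
    fun x => gradient_mul (hη.differentiable (by simp) x) (hζ.differentiable (by simp) x)
  have cg := continuous_gradient hζ
  have cη := continuous_gradient hη
  have c1 : HasCompactSupport fun x => η x • gradient ζ x :=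
    (hasCompactSupport_gradient hζc).mono fun x hx h0 => hx (by simp [h0])
  have c2 : HasCompactSupport fun x => ζ x • gradient η x :=
    hζc.mono fun x hx h0 => hx (by simp [h0])
  have i1 : Integrable fun x => f x • (η x • gradient ζ x) :=
    hf.integrable_smul_right_of_hasCompactSupport (hη.continuous.smul cg) c1
  have i2 : Integrable fun x => f x • (ζ x • gradient η x) :=
    hf.integrable_smul_right_of_hasCompactSupport (hζ.continuous.smul cη) c2
  have i3 : Integrable fun x => (η x * ζ x) • p x :=
    hp.integrable_smul_left_of_hasCompactSupport (hη.continuous.mul hζ.continuous) hζc.mul_left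
  simp only [hg, smul_add] at h0
  rw [integral_add i1 i2] at h0
  have e1 : ∫ x, (η x * f x) • gradient ζ x = ∫ x, f x • (η x • gradient ζ x) := by
    congr 1
    funext x
    rw [smul_smul, mul_comm]
  have e2 : ∫ x, ζ x • (η x • p x + f x • gradient η x)
      = (∫ x, (η x * ζ x) • p x) + ∫ x, f x • (ζ x • gradient η x) := by
    rw [← integral_add i3 i2]
    congr 1
    funext x
    rw [smul_add, smul_smul, mul_comm (ζ x), smul_comm]
  rw [e1, e2, eq_sub_of_add_eq h0]
  abel

/-- Locally square integrable functions. -/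
def LocL2 {F : Type*} [NormedAddCommGroup F] (f : Sp n → F) : Prop :=
  ∀ K : Set (Sp n), IsCompact K → MemLp f 2 (volume.restrict K)

namespace LocL2

variable {F : Type*} [NormedAddCommGroup F] {f : Sp n → F}

theorem locallyIntegrable (hf : LocL2 f) : LocallyIntegrable f := by
  refine locallyIntegrable_iff.2 fun K hK => ?_
  have : IsFiniteMeasure (volume.restrict K) := ⟨by simpa using hK.measure_lt_top⟩
  exact (hf K hK).integrable (by norm_num)

theorem aestronglyMeasurable (hf : LocL2 f) : AEStronglyMeasurable f volume :=
  hf.locallyIntegrable.aestronglyMeasurable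

theorem memLp_restrict (hf : LocL2 f) {D : Set (Sp n)} (hD : Bornology.IsBounded D) :
    MemLp f 2 (volume.restrict D) :=
  (hf _ hD.isCompact_closure).mono_measure (Measure.restrict_mono subset_closure le_rfl)

theorem smul_hasCompactSupport [NormedSpace ℝ F] (hf : LocL2 f) {η : Sp n → ℝ} (hη : Continuous η)
    (hηc : HasCompactSupport η) : MemLp (fun x => η x • f x) 2 := by
  have h1 := hf _ hηc.isCompact
  obtain ⟨C, hC⟩ := hη.bounded_above_of_compact_support hηc
  have h2 : MemLp (fun x => η x • f x) 2 (volume.restrict (tsupport η)) :=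
    MemLp.smul (p := ∞) (q := 2) h1 (memLp_top_of_bound hη.aestronglyMeasurable C
      (Eventually.of_forall hC))
  rw [← memLp_indicator_iff_restrict (isClosed_tsupport η).measurableSet] at h2
  refine h2.congr_norm ?_ (Eventually.of_forall fun x => ?_)
  · exact hη.aestronglyMeasurable.smul hf.aestronglyMeasurable
  · by_cases hx : x ∈ tsupport η
    · simp [hx]
    · simp [hx, image_eq_zero_of_notMem_tsupport hx]

theorem smul_hasCompactSupport' {F : Type*} [NormedAddCommGroup F] [NormedSpace ℝ F] {f : Sp n → ℝ}
    (hf : LocL2 f) {g : Sp n → F} (hg : Continuous g)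
    (hgc : HasCompactSupport g) : MemLp (fun x => f x • g x) 2 := by
  have h1 := hf.smul_hasCompactSupport hg.norm hgc.norm
  refine h1.congr_norm (hf.aestronglyMeasurable.smul hg.aestronglyMeasurable)
    (Eventually.of_forall fun x => ?_)
  simp [norm_smul, mul_comm]

end LocL2

/-- A cutoff makes any function locally in `H¹` an admissible test element on a slightly larger
ball, with gradient given by the product rule. -/
theorem mul_mem_zeroTrace {r R : ℝ} (hrR : r < R) {f : Sp n → ℝ} {p : Sp n → Sp n}
    (hf : LocL2 f) (hp : LocL2 p) (hfp : IsWeakGradient f p) {η : Sp n → ℝ} (hη : ContDiff ℝ ∞ η)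
    (hηr : Function.support η ⊆ Metric.closedBall 0 r) :
    (toL2 (volume.restrict (Metric.closedBall 0 R)) (fun x => η x * f x),
      toL2 _ (fun x => η x • p x + f x • gradient η x))
      ∈ zeroTrace (Metric.closedBall (0 : Sp n) R) := by
  have hηc : HasCompactSupport η :=
    HasCompactSupport.of_support_subset_isCompact (isCompact_closedBall 0 r) hηr
  refine mem_zeroTrace_of_isWeakGradient hrR (hf.smul_hasCompactSupport hη.continuous hηc)
    ((hp.smul_hasCompactSupport hη.continuous hηc).add
      (hf.smul_hasCompactSupport' (continuous_gradient hη) (hasCompactSupport_gradient hηc)))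
    (hfp.mul hf.locallyIntegrable hp.locallyIntegrable hη) ?_
  exact (Function.support_mul_subset_left _ _).trans hηr

end FracWave

/-! ### Multiplication operators, curves in `L²(D)`, and the Caputo derivative of such curves. -/

namespace FracWave

variable {n : ℕ}

section Multiplication

variable {Y F : Type*} [MeasurableSpace Y] [NormedAddCommGroup F] {ν : Measure Y}

open scoped Classical in
/-- The class of `f` in `L^∞(μ)`, or `0` if `f` is not essentially bounded. -/
noncomputable def toLinf (μ : Measure Y) (f : Y → F) : Lp F ∞ μ :=
  if h : MemLp f ∞ μ then h.toLp f else 0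

theorem coeFn_toLinf {f : Y → F} (h : MemLp f ∞ ν) : toLinf ν f =ᵐ[ν] f := by
  rw [toLinf, dif_pos h]
  exact h.coeFn_toLp

theorem toL2_coeFn (f : Lp F 2 ν) : toL2 ν f = f := by
  rw [toL2_eq (Lp.memLp f), Lp.toLp_coeFn]

theorem toL2_congr {f g : Y → F} (hg : MemLp g 2 ν) (h : f =ᵐ[ν] g) : toL2 ν f = toL2 ν g := by
  rw [toL2_eq hg, toL2_eq ((memLp_congr_ae h).2 hg)]
  exact MemLp.toLp_congr _ _ h

theorem eq_toL2_of_ae_eq {f : Y → F} {g : Lp F 2 ν} (h : f =ᵐ[ν] g) : g = toL2 ν f := by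
  rw [toL2_congr (Lp.memLp g) h, toL2_coeFn]

variable [NormedSpace ℝ F]

/-- Multiplication `L^∞ × L² → L²` of a scalar weight and a vector valued function. -/
noncomputable def mulOp (ν : Measure Y) (F : Type*) [NormedAddCommGroup F] [NormedSpace ℝ F] :
    Lp ℝ ∞ ν →L[ℝ] Lp F 2 ν →L[ℝ] Lp F 2 ν :=
  (ContinuousLinearMap.lsmul ℝ ℝ : ℝ →L[ℝ] F →L[ℝ] F).holderL ν ∞ 2 2

theorem coeFn_mulOp (m : Lp ℝ ∞ ν) (f : Lp F 2 ν) : mulOp ν F m f =ᵐ[ν] fun y => m y • f y :=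
  (ContinuousLinearMap.lsmul ℝ ℝ : ℝ →L[ℝ] F →L[ℝ] F).coeFn_holder m f

/-- Multiplication `L^∞ × L² → L²` of a vector valued weight and a scalar function. -/
noncomputable def vecMulOp (ν : Measure Y) (F : Type*) [NormedAddCommGroup F] [NormedSpace ℝ F] :
    Lp F ∞ ν →L[ℝ] Lp ℝ 2 ν →L[ℝ] Lp F 2 ν :=
  (ContinuousLinearMap.lsmul ℝ ℝ : ℝ →L[ℝ] F →L[ℝ] F).flip.holderL ν ∞ 2 2

theorem coeFn_vecMulOp (m : Lp F ∞ ν) (f : Lp ℝ 2 ν) :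
    vecMulOp ν F m f =ᵐ[ν] fun y => f y • m y :=
  (ContinuousLinearMap.lsmul ℝ ℝ : ℝ →L[ℝ] F →L[ℝ] F).flip.coeFn_holder m f

theorem mulOp_toLinf {m : Y → ℝ} (hm : MemLp m ∞ ν) (f : Lp F 2 ν) :
    mulOp ν F (toLinf ν m) f =ᵐ[ν] fun y => m y • f y := by
  filter_upwards [coeFn_mulOp (toLinf ν m) f, coeFn_toLinf hm] with y h1 h2
  rw [h1, h2]

theorem mulOp_mulOp_comm (m m' : Lp ℝ ∞ ν) (f : Lp F 2 ν) :
    mulOp ν F m (mulOp ν F m' f) = mulOp ν F m' (mulOp ν F m f) := by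
  refine Lp.ext ?_
  filter_upwards [coeFn_mulOp m (mulOp ν F m' f), coeFn_mulOp m' (mulOp ν F m f),
    coeFn_mulOp m f, coeFn_mulOp m' f] with y h1 h2 h3 h4
  rw [h1, h2, h3, h4, smul_comm]

end Multiplication

section MultiplicationInner

variable {Y F : Type*} [MeasurableSpace Y] [NormedAddCommGroup F] {ν : Measure Y}
  [InnerProductSpace ℝ F]

theorem inner_mulOp (m : Lp ℝ ∞ ν) (f g : Lp F 2 ν) :
    inner ℝ (mulOp ν F m f) g = ∫ y, m y * inner ℝ (f y) (g y) ∂ν := by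
  rw [L2.inner_def]
  refine integral_congr_ae ?_
  filter_upwards [coeFn_mulOp m f] with y h1
  rw [h1, inner_smul_left]
  rfl

theorem inner_mulOp_comm (m : Lp ℝ ∞ ν) (f g : Lp F 2 ν) :
    inner ℝ (mulOp ν F m f) g = inner ℝ (mulOp ν F m g) f := by
  rw [inner_mulOp, inner_mulOp]
  simp only [real_inner_comm]

theorem inner_mulOp_right (m : Lp ℝ ∞ ν) (f g : Lp F 2 ν) :
    inner ℝ f (mulOp ν F m g) = inner ℝ (mulOp ν F m f) g := by
  rw [real_inner_comm, inner_mulOp_comm]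

theorem inner_mulOp_self_nonneg {m : Lp ℝ ∞ ν} (hm : ∀ᵐ y ∂ν, 0 ≤ m y) (f : Lp F 2 ν) :
    0 ≤ (inner ℝ (mulOp ν F m f) f : ℝ) := by
  rw [inner_mulOp]
  refine integral_nonneg_of_ae ?_
  filter_upwards [hm] with y hy
  exact mul_nonneg hy real_inner_self_nonneg

end MultiplicationInner

theorem memLp_top_restrict {F : Type*} [NormedAddCommGroup F] {D : Set (Sp n)}
    (hD : MeasurableSet D) (hDb : Bornology.IsBounded D)
    {m : Sp n → F} (hm : Continuous m) : MemLp m ∞ (volume.restrict D) := by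
  obtain ⟨C, hC⟩ := hDb.isCompact_closure.exists_bound_of_continuousOn hm.continuousOn
  refine memLp_top_of_bound hm.aestronglyMeasurable C ?_
  filter_upwards [ae_restrict_mem hD] with x hx
  exact hC x (subset_closure hx)

section Curve

variable {F : Type*} [NormedAddCommGroup F]

/-- The curve in `L²(D)` given by `w(t)`, `t ≥ 0`, extended by `w(0)` to negative times. -/
noncomputable def curve (D : Set (Sp n)) (w : ℝ → Sp n → F) (t : ℝ) :
    Lp F 2 (volume.restrict D) :=
  toL2 (volume.restrict D) (w (max t 0))

theorem curve_of_nonneg (D : Set (Sp n)) (w : ℝ → Sp n → F) {t : ℝ} (ht : 0 ≤ t) :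
    curve D w t = toL2 (volume.restrict D) (w t) := by
  rw [curve, max_eq_left ht]

theorem ContL2Loc.locL2 {w : ℝ → Sp n → F} (hw : ContL2Loc w) {t : ℝ} (ht : 0 ≤ t) :
    LocL2 (w t) := fun K hK => (hw.2 K hK).1 t ht

theorem ContL2Loc.memLp {w : ℝ → Sp n → F} (hw : ContL2Loc w) {D : Set (Sp n)}
    (hD : Bornology.IsBounded D) {t : ℝ} (ht : 0 ≤ t) : MemLp (w t) 2 (volume.restrict D) :=
  (hw.locL2 ht).memLp_restrict hD

/-- The constant extension to negative times makes the curve continuous on the whole line, as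
`abstract_energy_identity` and `continuous_fracInt` require. -/
theorem ContL2Loc.continuous_curve {w : ℝ → Sp n → F} (hw : ContL2Loc w) {D : Set (Sp n)}
    (hD : Bornology.IsBounded D) : Continuous (curve D w) := by
  have h : ContinuousOn (fun t => toL2 (volume.restrict D) (w t)) (Set.Ici 0) := by
    intro t ht
    refine tendsto_toL2 (hw.memLp hD ht) ?_ ?_
    · filter_upwards [self_mem_nhdsWithin] with s hs
      exact hw.memLp hD hs
    · refine tendsto_of_tendsto_of_tendsto_of_le_of_le tendsto_const_nhds
        ((hw.2 _ hD.isCompact_closure).2 t ht) (fun _ => zero_le) fun s => ?_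
      have : eLpNorm (fun y => w t y - w s y) 2 (volume.restrict D)
          = eLpNorm (fun y => w s y - w t y) 2 (volume.restrict D) :=
        eLpNorm_sub_comm (w t) (w s) 2 _
      simp only
      rw [this]
      exact eLpNorm_mono_measure _ (Measure.restrict_mono subset_closure le_rfl)
  exact h.comp_continuous (by fun_prop) fun t => Set.mem_Ici.2 (le_max_right t 0)

theorem coeFn_curve {w : ℝ → Sp n → F} (hw : ContL2Loc w) {D : Set (Sp n)}
    (hD : Bornology.IsBounded D) {t : ℝ} (ht : 0 ≤ t) : curve D w t =ᵐ[volume.restrict D] w t := by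
  rw [curve_of_nonneg D w ht]
  exact coeFn_toL2 (hw.memLp hD ht)

theorem hasDerivAt_curve {u v : ℝ → Sp n → ℝ} (hu : ContL2Loc u) (hv : ContL2Loc v)
    (h : HasTimeDerivL2Loc u v) {D : Set (Sp n)} (hD : Bornology.IsBounded D) {t : ℝ} (ht : 0 < t) :
    HasDerivAt (curve D u) (curve D v t) t := by
  rw [hasDerivAt_iff_tendsto_slope, curve_of_nonneg D v ht.le]
  have hI : Set.Ici (0 : ℝ) \ {t} ∈ 𝓝[≠] t :=
    Filter.inter_mem (mem_nhdsWithin_of_mem_nhds (Ici_mem_nhds ht)) self_mem_nhdsWithin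
  have hle : 𝓝[≠] t ≤ 𝓝[Set.Ici 0 \ {t}] t := by
    rw [nhdsWithin_le_iff]
    exact hI
  have hm : ∀ s, 0 ≤ s → MemLp (fun x => (s - t)⁻¹ * (u s x - u t x)) 2 (volume.restrict D) :=
    fun s hs => ((hu.memLp hD hs).sub (hu.memLp hD ht.le)).const_mul _
  have h1 : Tendsto (fun s => toL2 (volume.restrict D) (fun x => (s - t)⁻¹ * (u s x - u t x)))
      (𝓝[≠] t) (𝓝 (toL2 (volume.restrict D) (v t))) := by
    refine tendsto_toL2 (hv.memLp hD ht.le) ?_ ?_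
    · filter_upwards [hI] with s hs
      exact hm s hs.1
    · refine tendsto_of_tendsto_of_tendsto_of_le_of_le tendsto_const_nhds
        ((h _ hD.isCompact_closure t ht.le).mono_left hle) (fun _ => zero_le) fun s => ?_
      have := eLpNorm_sub_comm (v t) (fun x => (s - t)⁻¹ * (u s x - u t x)) 2 (volume.restrict D)
      refine (Eq.le this).trans ?_
      exact eLpNorm_mono_measure _ (Measure.restrict_mono subset_closure le_rfl)
  refine h1.congr' ?_
  filter_upwards [hI] with s hs
  rw [slope_def_module, curve_of_nonneg D u hs.1, curve_of_nonneg D u ht.le,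
    toL2_eq (hu.memLp hD hs.1), toL2_eq (hu.memLp hD ht.le), toL2_eq (hm s hs.1), ← MemLp.toLp_sub,
    ← MemLp.toLp_const_smul]
  rfl

end Curve

theorem aestronglyMeasurable_prod_restrict {F : Type*} [NormedAddCommGroup F] {w : ℝ × Sp n → F}
    (hw : AEStronglyMeasurable w (volume.restrict (Set.Ioi (0 : ℝ) ×ˢ Set.univ))) {I : Set ℝ}
    (hI : I ⊆ Set.Ioi 0) (D : Set (Sp n)) :
    AEStronglyMeasurable w ((volume.restrict I).prod (volume.restrict D)) := by
  rw [Measure.prod_restrict, ← Measure.volume_eq_prod]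
  exact hw.mono_measure (Measure.restrict_mono (Set.prod_mono hI (Set.subset_univ _)) le_rfl)

section Caputo

variable {α : ℝ} {v : ℝ → Sp n → ℝ}

/-- For almost every `x`, the slice `v(·, x)` agrees almost everywhere in time with that of a
measurable representative, so both have the same Caputo integrals at all `t > 0`. For the
representative, the variable limit becomes an indicator and the integral is a measurable parametric
one. -/
theorem aestronglyMeasurable_caputo
    (hv : AEStronglyMeasurable (fun z : ℝ × Sp n => v z.1 z.2)
      (volume.restrict (Set.Ioi (0 : ℝ) ×ˢ Set.univ))) :
    AEStronglyMeasurable (fun z : ℝ × Sp n => caputo α (fun s => v s z.2) z.1)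
      (volume.restrict (Set.Ioi (0 : ℝ) ×ˢ Set.univ)) := by
  obtain ⟨v', hv', hvv'⟩ := hv
  have hprod : (volume.restrict (Set.Ioi (0 : ℝ) ×ˢ (Set.univ : Set (Sp n))))
      = (volume.restrict (Set.Ioi (0 : ℝ))).prod (volume : Measure (Sp n)) := by
    rw [Measure.volume_eq_prod, ← Measure.prod_restrict, Measure.restrict_univ]
  rw [hprod] at hvv' ⊢
  have hx : ∀ᵐ x : Sp n, ∀ᵐ s ∂(volume.restrict (Set.Ioi (0 : ℝ))), v s x = v' (s, x) :=
    Measure.ae_ae_of_ae_prod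
      ((Measure.measurePreserving_swap (μ := (volume : Measure (Sp n)))
        (ν := volume.restrict (Set.Ioi (0 : ℝ)))).quasiMeasurePreserving.ae hvv')
  have hm : StronglyMeasurable fun z : ℝ × Sp n => (Real.Gamma (1 - α))⁻¹ *
      ∫ s, Set.indicator {q : (ℝ × Sp n) × ℝ | 0 < q.2 ∧ q.2 ≤ q.1.1}
        (fun q => v' (q.2, q.1.2) / (q.1.1 - q.2) ^ α) (z, s) := by
    refine StronglyMeasurable.const_mul (StronglyMeasurable.integral_prod_right ?_) _
    refine StronglyMeasurable.indicator ?_ ?_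
    · have h1 : Measurable fun q : (ℝ × Sp n) × ℝ => v' (q.2, q.1.2) :=
        hv'.measurable.comp (by fun_prop)
      exact (h1.div (by fun_prop)).stronglyMeasurable
    · exact (measurableSet_lt measurable_const measurable_snd).inter
        (measurableSet_le measurable_snd (by fun_prop))
  refine ⟨_, hm, ?_⟩
  have hx' : ∀ᵐ z ∂(volume.restrict (Set.Ioi (0 : ℝ))).prod (volume : Measure (Sp n)),
      ∀ᵐ s ∂(volume.restrict (Set.Ioi (0 : ℝ))), v s z.2 = v' (s, z.2) :=
    Measure.quasiMeasurePreserving_snd.ae hx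
  have ht' : ∀ᵐ z ∂(volume.restrict (Set.Ioi (0 : ℝ))).prod (volume : Measure (Sp n)),
      z.1 ∈ Set.Ioi (0 : ℝ) := Measure.quasiMeasurePreserving_fst.ae
        (ae_restrict_mem measurableSet_Ioi)
  filter_upwards [hx', ht'] with z hz ht
  rw [caputo, intervalIntegral.integral_of_le (le_of_lt ht)]
  congr 1
  rw [← integral_indicator measurableSet_Ioc]
  rw [ae_restrict_iff' measurableSet_Ioi] at hz
  refine integral_congr_ae ?_
  filter_upwards [hz] with s hs
  by_cases h : s ∈ Set.Ioc 0 z.1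
  · rw [Set.indicator_of_mem h, Set.indicator_of_mem (show (z, s) ∈ {q : (ℝ × Sp n) × ℝ |
      0 < q.2 ∧ q.2 ≤ q.1.1} from h), hs h.1]
  · rw [Set.indicator_of_notMem h, Set.indicator_of_notMem (show (z, s) ∉ {q : (ℝ × Sp n) × ℝ |
      0 < q.2 ∧ q.2 ≤ q.1.1} from h)]

/-- The Caputo derivative, taken pointwise in space, is the one taken in `L²(D)`. -/
theorem caputo_ae_eq (hα1 : α < 1) (hv : ContL2Loc v) {D : Set (Sp n)}
    (hD : Bornology.IsBounded D) {t : ℝ} (ht : 0 < t) :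
    (fun x => caputo α (fun s => v s x) t) =ᵐ[volume.restrict D]
      ((Real.Gamma (1 - α))⁻¹ • fracInt α (curve D v) t : Lp ℝ 2 (volume.restrict D)) := by
  set μ := volume.restrict D with hμ
  have : IsFiniteMeasure μ := ⟨by simpa [hμ] using hD.measure_lt_top⟩
  have hc := hv.continuous_curve hD
  obtain ⟨C, hC⟩ := (isCompact_Icc (a := (0 : ℝ)) (b := t)).exists_bound_of_continuousOn
    hc.continuousOn
  set h : Sp n → ℝ := fun x => ∫ s in Set.Ioc 0 t, (t - s) ^ (-α) * v s x with hh
  have hmeas : AEStronglyMeasurable (fun z : ℝ × Sp n => (t - z.1) ^ (-α) • v z.1 z.2)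
      ((volume.restrict (Set.Ioc 0 t)).prod μ) :=
    (Measurable.aestronglyMeasurable (f := fun z : ℝ × Sp n => (t - z.1) ^ (-α))
      (by fun_prop)).smul
      (aestronglyMeasurable_prod_restrict hv.1 Set.Ioc_subset_Ioi_self D)
  have hint : ∀ g : Sp n → ℝ, MemLp g 2 μ →
      Integrable (fun z : ℝ × Sp n => (inner ℝ ((t - z.1) ^ (-α) • v z.1 z.2) (g z.2) : ℝ))
        ((volume.restrict (Set.Ioc 0 t)).prod μ) := by
    intro g hg
    refine integrable_inner_prod (w := fun s x => (t - s) ^ (-α) • v s x) (g := fun _ x => g x)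
      (κ := fun s => (t - s) ^ (-α) * C) (C := ‖toL2 μ g‖) hmeas
      (hg.1.comp_quasiMeasurePreserving Measure.quasiMeasurePreserving_snd) ?_
      (Eventually.of_forall fun _ => ⟨hg, le_rfl⟩) ?_
    · filter_upwards [ae_restrict_mem measurableSet_Ioc] with s hs
      have h1 := hv.memLp hD hs.1.le
      have h2 := h1.const_smul ((t - s) ^ (-α))
      refine ⟨h2, ?_⟩
      have h3 : toL2 μ (fun x => (t - s) ^ (-α) • v s x) = (t - s) ^ (-α) • curve D v s := by
        rw [curve_of_nonneg D v hs.1.le, toL2_eq h1, ← MemLp.toLp_const_smul, ← toL2_eq h2]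
        rfl
      have h4 : 0 ≤ (t - s) ^ (-α) := Real.rpow_nonneg (by linarith [hs.2]) _
      rw [h3, norm_smul, Real.norm_of_nonneg h4]
      exact mul_le_mul_of_nonneg_left (hC s ⟨hs.1.le, hs.2⟩) h4
    · exact ((intervalIntegrable_iff_integrableOn_Ioc_of_le ht.le).1
        (intervalIntegrable_sub_rpow hα1 t 0 t)).mul_const C
  have hhi : Integrable h μ := by
    have := (hint (fun _ => 1) (memLp_const 1)).integral_prod_right
    simpa [hh] using this
  obtain ⟨Φ, hΦ⟩ : ∃ Φ, Φ = fracInt α (curve D v) t := ⟨_, rfl⟩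
  rw [← hΦ]
  have hfi : Integrable (Φ) μ := (Lp.memLp _).integrable (by norm_num)
  -- Two integrable functions with the same integral over every measurable set agree. For the
  -- pointwise integral this is Fubini; for the `L²`-valued integral, the pairing with an indicator
  -- commutes with integration in time.
  have key : h =ᵐ[μ] Φ := by
    refine hhi.ae_eq_of_forall_setIntegral_eq _ _ hfi fun A hA _ => ?_
    have hg : MemLp (A.indicator fun _ => (1 : ℝ)) 2 μ := (memLp_const 1).indicator hA
    have hswap := integral_integral_swap
      (f := fun s x => (inner ℝ ((t - s) ^ (-α) • v s x) (A.indicator (fun _ => (1 : ℝ)) x) : ℝ))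
      (hint _ hg)
    have e0 : ∀ f : Sp n → ℝ, (∫ x, (inner ℝ (f x) (A.indicator (fun _ => (1 : ℝ)) x) : ℝ) ∂μ)
        = ∫ x in A, f x ∂μ := by
      intro f
      rw [← integral_indicator hA]
      congr 1
      funext x
      by_cases hx : x ∈ A <;> simp [hx]
    have e1 : (∫ x, (∫ s in Set.Ioc 0 t, (inner ℝ ((t - s) ^ (-α) • v s x)
        (A.indicator (fun _ => (1 : ℝ)) x) : ℝ)) ∂μ) = ∫ x in A, h x ∂μ := by
      rw [← e0]
      congr 1
      funext x
      by_cases hx : x ∈ A <;> simp [hx, hh]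
    have e2 : (∫ s in Set.Ioc 0 t, (∫ x, (inner ℝ ((t - s) ^ (-α) • v s x)
        (A.indicator (fun _ => (1 : ℝ)) x) : ℝ) ∂μ)) = ∫ x in A, Φ x ∂μ := by
      rw [← e0]
      have e3 : (∫ x, (inner ℝ (Φ x) (A.indicator (fun _ => (1 : ℝ)) x) : ℝ) ∂μ)
          = inner ℝ (toL2 μ (A.indicator fun _ => (1 : ℝ))) (Φ) := by
        conv_rhs => rw [← toL2_coeFn (Φ)]
        rw [real_inner_comm, inner_toL2 (Lp.memLp _) hg]
      rw [e3, hΦ, fracInt_eq hα1 _ ht.le, ← innerSL_apply_apply ℝ,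
        ← ContinuousLinearMap.intervalIntegral_comp_comm, intervalIntegral.integral_of_le ht.le]
      · refine setIntegral_congr_fun measurableSet_Ioc fun s hs => ?_
        simp only [inner_smul_left, innerSL_apply_apply, inner_smul_right, RCLike.conj_to_real]
        rw [integral_const_mul, curve_of_nonneg D v hs.1.le, real_inner_comm,
          inner_toL2 (hv.memLp hD hs.1.le) hg]
      · exact (intervalIntegrable_sub_rpow hα1 t 0 t).smul_continuousOn hc.continuousOn
    rw [← e1, ← e2, hswap]
  filter_upwards [key, Lp.coeFn_smul (Real.Gamma (1 - α))⁻¹ (Φ)] with x h1 h2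
  rw [h2, Pi.smul_apply, ← h1, smul_eq_mul, caputo, intervalIntegral.integral_of_le ht.le]
  congr 1
  refine setIntegral_congr_fun measurableSet_Ioc fun s hs => ?_
  rw [Real.rpow_neg (by linarith [hs.2]), div_eq_inv_mul]

end Caputo

/-- Integration of `L²(D)`-valued curves against products of test functions. -/
theorem integral_smul_inner {F : Type*} [NormedAddCommGroup F] [InnerProductSpace ℝ F]
    {D : Set (Sp n)} {w : ℝ → Sp n → F}
    (hw : AEStronglyMeasurable (fun z : ℝ × Sp n => w z.1 z.2)
      (volume.restrict (Set.Ioi (0 : ℝ) ×ˢ Set.univ)))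
    {w' : ℝ → Lp F 2 (volume.restrict D)} (hw' : Continuous w')
    (hww' : ∀ t, 0 < t → w t =ᵐ[volume.restrict D] w' t) {G : Sp n → F}
    (hG : MemLp G 2 (volume.restrict D)) (hGD : Function.support G ⊆ D) {θ : ℝ → ℝ}
    (hθ : Continuous θ) (hθc : HasCompactSupport θ) (hθ0 : Function.support θ ⊆ Set.Ioi 0) :
    Integrable (fun z : ℝ × Sp n => θ z.1 * (inner ℝ (w z.1 z.2) (G z.2) : ℝ)) ∧
    ∫ z : ℝ × Sp n, θ z.1 * (inner ℝ (w z.1 z.2) (G z.2) : ℝ)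
      = ∫ t, θ t * (inner ℝ (w' t) (toL2 _ G) : ℝ) := by
  have hi : Integrable (fun z : ℝ × Sp n => θ z.1 * (inner ℝ (w z.1 z.2) (G z.2) : ℝ))
      ((volume.restrict (Set.Ioi (0 : ℝ))).prod (volume.restrict D)) := by
    refine (integrable_inner_prod (w := fun t x => θ t • w t x) (g := fun _ x => G x)
      (κ := fun t => |θ t| * ‖w' t‖) (C := ‖toL2 (volume.restrict D) G‖) ?_
      (hG.1.comp_quasiMeasurePreserving Measure.quasiMeasurePreserving_snd) ?_
      (Eventually.of_forall fun _ => ⟨hG, le_rfl⟩) ?_).congr ?_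
    · exact (hθ.comp continuous_fst).aestronglyMeasurable.smul
        (aestronglyMeasurable_prod_restrict hw subset_rfl D)
    · filter_upwards [ae_restrict_mem measurableSet_Ioi] with t ht
      have h1 : MemLp (w t) 2 (volume.restrict D) := (memLp_congr_ae (hww' t ht)).2 (Lp.memLp _)
      have h2 := h1.const_smul (θ t)
      refine ⟨h2, ?_⟩
      have : toL2 (volume.restrict D) (fun x => θ t • w t x) = θ t • w' t := by
        rw [eq_toL2_of_ae_eq (hww' t ht), toL2_eq h1, ← MemLp.toLp_const_smul, ← toL2_eq h2]
        rfl
      rw [this, norm_smul, Real.norm_eq_abs]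
    · refine Integrable.restrict ?_
      exact (hθ.abs.mul hw'.norm).integrable_of_hasCompactSupport hθc.norm.mul_right
    · refine Eventually.of_forall fun z => ?_
      simp only [inner_smul_left, RCLike.conj_to_real]
  have hprod : (volume.restrict (Set.Ioi (0 : ℝ))).prod (volume.restrict D)
      = volume.restrict (Set.Ioi (0 : ℝ) ×ˢ D) := by
    rw [Measure.prod_restrict, ← Measure.volume_eq_prod]
  have hsupp : ∀ z : ℝ × Sp n, z ∉ Set.Ioi (0 : ℝ) ×ˢ D →
      θ z.1 * (inner ℝ (w z.1 z.2) (G z.2) : ℝ) = 0 := by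
    intro z hz
    by_contra h
    refine hz ⟨hθ0 fun h0 => h (by rw [h0, zero_mul]), hGD fun h0 => h ?_⟩
    rw [h0, inner_zero_right, mul_zero]
  refine ⟨?_, ?_⟩
  · rw [hprod] at hi
    exact (integrableOn_iff_integrable_of_support_subset (fun z hz => by
      by_contra h
      exact hz (hsupp z h))).1 hi
  · have hpos : ∫ t, θ t * (inner ℝ (w' t) (toL2 (volume.restrict D) G) : ℝ)
        = ∫ t in Set.Ioi 0, θ t * (inner ℝ (w' t) (toL2 (volume.restrict D) G) : ℝ) := by
      refine (setIntegral_eq_integral_of_forall_compl_eq_zero fun t ht => ?_).symm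
      have : θ t = 0 := by
        by_contra h
        exact ht (hθ0 h)
      rw [this, zero_mul]
    rw [← setIntegral_eq_integral_of_forall_compl_eq_zero hsupp, ← hprod, integral_prod _ hi, hpos]
    refine setIntegral_congr_fun measurableSet_Ioi fun t ht => ?_
    simp only
    rw [integral_const_mul, eq_toL2_of_ae_eq (hww' t ht), inner_toL2 _ hG]
    exact (memLp_congr_ae (hww' t ht)).2 (Lp.memLp _)

end FracWave

/-! ### The wave equation on a bounded set `D`, tested in space and integrated in time. -/

namespace FracWave

variable {n : ℕ}

/-- The weight `c⁻²` on `D`. -/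
noncomputable def massWeight (D : Set (Sp n)) (c : Sp n → ℝ) : Lp ℝ ∞ (volume.restrict D) :=
  toLinf _ fun x => (c x ^ 2)⁻¹

/-- The weight `c⁻² a` on `D`. -/
noncomputable def dampingWeight (D : Set (Sp n)) (c a : Sp n → ℝ) : Lp ℝ ∞ (volume.restrict D) :=
  toLinf _ fun x => a x / c x ^ 2

/-- The Caputo derivative as a curve in `L²(D)`. -/
noncomputable def caputoCurve (α : ℝ) (D : Set (Sp n)) (v : ℝ → Sp n → ℝ) (t : ℝ) :
    Lp ℝ 2 (volume.restrict D) :=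
  (Real.Gamma (1 - α))⁻¹ • fracInt α (curve D v) t

theorem continuous_caputoCurve {α : ℝ} (hα1 : α < 1) {v : ℝ → Sp n → ℝ} (hv : ContL2Loc v)
    {D : Set (Sp n)} (hDb : Bornology.IsBounded D) : Continuous (caputoCurve α D v) :=
  ((continuous_fracInt hα1 (hv.continuous_curve hDb)).const_smul (Real.Gamma (1 - α))⁻¹ :)

section Weights

variable {c a : Sp n → ℝ} {D : Set (Sp n)}

theorem memLp_massWeight (hc : Continuous c) (hc0 : ∀ x, 0 < c x)
    (hD : MeasurableSet D) (hDb : Bornology.IsBounded D) :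
    MemLp (fun x => (c x ^ 2)⁻¹) ∞ (volume.restrict D) :=
  memLp_top_restrict hD hDb ((hc.pow 2).inv₀ fun x => (pow_pos (hc0 x) 2).ne')

theorem memLp_dampingWeight (hc : Continuous c) (ha : Continuous a) (hc0 : ∀ x, 0 < c x)
    (hD : MeasurableSet D) (hDb : Bornology.IsBounded D) :
    MemLp (fun x => a x / c x ^ 2) ∞ (volume.restrict D) :=
  memLp_top_restrict hD hDb (ha.div (hc.pow 2) fun x => (pow_pos (hc0 x) 2).ne')

theorem coeFn_massWeight (hc : Continuous c) (hc0 : ∀ x, 0 < c x)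
    (hD : MeasurableSet D) (hDb : Bornology.IsBounded D) :
    massWeight D c =ᵐ[volume.restrict D] fun x => (c x ^ 2)⁻¹ :=
  coeFn_toLinf (memLp_massWeight hc hc0 hD hDb)

theorem coeFn_dampingWeight (hc : Continuous c) (ha : Continuous a) (hc0 : ∀ x, 0 < c x)
    (hD : MeasurableSet D) (hDb : Bornology.IsBounded D) :
    dampingWeight D c a =ᵐ[volume.restrict D] fun x => a x / c x ^ 2 :=
  coeFn_toLinf (memLp_dampingWeight hc ha hc0 hD hDb)

theorem lintegral_energy_eq {w : Sp n → ℝ} {p : Sp n → Sp n} (hc : Continuous c)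
    (hc0 : ∀ x, 0 < c x) (hD : MeasurableSet D) (hDb : Bornology.IsBounded D)
    (hw : MemLp w 2 (volume.restrict D)) (hp : MemLp p 2 (volume.restrict D)) :
    energy c D w p = ENNReal.ofReal
      (inner ℝ (mulOp _ ℝ (massWeight D c) (toL2 (volume.restrict D) w)) (toL2 _ w)
        + inner ℝ (toL2 (volume.restrict D) p) (toL2 _ p)) := by
  have h1 : (inner ℝ (mulOp _ ℝ (massWeight D c) (toL2 (volume.restrict D) w)) (toL2 _ w) : ℝ)
      = ∫ x in D, w x ^ 2 / c x ^ 2 := by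
    rw [inner_mulOp]
    refine integral_congr_ae ?_
    filter_upwards [coeFn_massWeight hc hc0 hD hDb, coeFn_toL2 hw] with x e1 e2
    rw [e1, e2, Real.inner_apply]
    ring
  have i1 : Integrable (fun x => w x ^ 2 / c x ^ 2) (volume.restrict D) := by
    refine (L2.integrable_inner (𝕜 := ℝ)
      (mulOp _ ℝ (massWeight D c) (toL2 (volume.restrict D) w)) (toL2 _ w)).congr ?_
    filter_upwards [mulOp_toLinf (memLp_massWeight hc hc0 hD hDb) (toL2 (volume.restrict D) w),
      coeFn_toL2 hw] with x e1 e2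
    rw [massWeight, e1, e2, Real.inner_apply, smul_eq_mul]
    ring
  have h2 : (inner ℝ (toL2 (volume.restrict D) p) (toL2 _ p) : ℝ) = ∫ x in D, ‖p x‖ ^ 2 := by
    rw [inner_toL2 hp hp]
    simp only [real_inner_self_eq_norm_sq]
  have i2 : Integrable (fun x => ‖p x‖ ^ 2) (volume.restrict D) := by
    simpa only [real_inner_self_eq_norm_sq] using integrable_inner hp hp
  rw [h1, h2, energy, ENNReal.ofReal_add (integral_nonneg fun x => by positivity)
    (integral_nonneg fun x => by positivity),
    ofReal_integral_eq_lintegral_ofReal i1 (Eventually.of_forall fun x => by positivity),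
    ofReal_integral_eq_lintegral_ofReal i2 (Eventually.of_forall fun x => by positivity)]

end Weights

theorem integral_neg_add_add {X : Type*} [MeasurableSpace X] {μ : Measure X} {f g h : X → ℝ}
    (hf : Integrable f μ) (hg : Integrable g μ) (hh : Integrable h μ) :
    ∫ x, (-(f x) + g x + h x) ∂μ = -∫ x, f x ∂μ + ∫ x, g x ∂μ + ∫ x, h x ∂μ := by
  have h1 := integral_add (hf.neg.add hg) hh
  have h2 := integral_add hf.neg hg
  simp only [Pi.add_apply, Pi.neg_apply, integral_neg] at h1 h2
  rw [h1, h2]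

section Solution

variable {α : ℝ} {c a u₀ : Sp n → ℝ} {u ut : ℝ → Sp n → ℝ} {Du : ℝ → Sp n → Sp n} {D : Set (Sp n)}

theorem dampedCaputo_ae_eq (hα1 : α < 1) (hut : ContL2Loc ut) (hc : Continuous c)
    (ha : Continuous a) (hc0 : ∀ x, 0 < c x) (hD : MeasurableSet D) (hDb : Bornology.IsBounded D)
    {t : ℝ} (ht : 0 < t) :
    (fun x => (a x / c x ^ 2) * caputo α (fun s => ut s x) t)
      =ᵐ[volume.restrict D] mulOp _ ℝ (dampingWeight D c a) (caputoCurve α D ut t) := by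
  filter_upwards [mulOp_toLinf (memLp_dampingWeight hc ha hc0 hD hDb)
    (caputoCurve α D ut t), caputo_ae_eq hα1 hut hDb ht] with x h1 h2
  rw [dampingWeight, h1, h2, smul_eq_mul]
  rfl

theorem aestronglyMeasurable_dampedCaputo (hut : ContL2Loc ut) {b : Sp n → ℝ} (hb : Continuous b) :
    AEStronglyMeasurable (fun z : ℝ × Sp n => b z.2 * caputo α (fun s => ut s z.2) z.1)
      (volume.restrict (Set.Ioi (0 : ℝ) ×ˢ Set.univ)) :=
  (hb.comp continuous_snd).aestronglyMeasurable.mul (aestronglyMeasurable_caputo hut.1)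

theorem IsSolution.integral_test_eq_zero (hu : IsSolution α c a u₀ u ut Du) (hα1 : α < 1)
    (hc : ContDiff ℝ ∞ c) (ha : ContDiff ℝ ∞ a) (hc0 : ∀ x, 0 < c x)
    (hD : MeasurableSet D) (hDb : Bornology.IsBounded D) {ψ : Sp n → ℝ} (hψ : IsTest D ψ)
    {θ : ℝ → ℝ} (hθ : ContDiff ℝ ∞ θ) (hθc : HasCompactSupport θ) (hθs : tsupport θ ⊆ Set.Ioi 0) :
    ∫ t, (-(deriv θ t * inner ℝ (mulOp _ ℝ (massWeight D c) (curve D ut t)) (toL2 _ ψ))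
      + θ t * (inner ℝ (curve D Du t) (toL2 _ (gradient ψ))
        + inner ℝ (mulOp _ ℝ (dampingWeight D c a) (caputoCurve α D ut t)) (toL2 _ ψ))) = 0 := by
  have cW := hu.cont_ut.continuous_curve hDb
  have cP := hu.cont_Du.continuous_curve hDb
  have cF := continuous_caputoCurve hα1 hu.cont_ut hDb
  have cF' : Continuous fun r => mulOp _ ℝ (dampingWeight D c a) (caputoCurve α D ut r) :=
    (mulOp _ ℝ (dampingWeight D c a)).continuous.comp cF
  have cW' : Continuous fun r => mulOp _ ℝ (massWeight D c) (curve D ut r) :=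
    (mulOp _ ℝ (massWeight D c)).continuous.comp cW
  have hcc : Continuous fun x => (c x ^ 2)⁻¹ :=
    (hc.continuous.pow 2).inv₀ fun x => (pow_pos (hc0 x) 2).ne'
  have hac : Continuous fun x => a x / c x ^ 2 :=
    ha.continuous.div (hc.continuous.pow 2) fun x => (pow_pos (hc0 x) 2).ne'
  have hψ0 : Function.support ψ ⊆ D := (subset_tsupport ψ).trans hψ.tsupport_subset
  have hgψ0 : Function.support (gradient ψ) ⊆ D :=
    (support_gradient_subset ψ).trans hψ.tsupport_subset
  have hθ' : Continuous (deriv θ) := hθ.continuous_deriv (by simp)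
  have E1 : ∀ t, 0 < t → (fun x => (c x ^ 2)⁻¹ * ut t x) =ᵐ[volume.restrict D]
      mulOp _ ℝ (massWeight D c) (curve D ut t) := fun t ht => by
    filter_upwards [mulOp_toLinf (memLp_massWeight hc.continuous hc0 hD hDb) (curve D ut t),
      coeFn_curve hu.cont_ut hDb ht.le] with x h1 h2
    rw [massWeight, h1, h2, smul_eq_mul]
  have M1 : AEStronglyMeasurable (fun z : ℝ × Sp n => (c z.2 ^ 2)⁻¹ * ut z.1 z.2)
      (volume.restrict (Set.Ioi (0 : ℝ) ×ˢ Set.univ)) :=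
    (hcc.comp continuous_snd).aestronglyMeasurable.mul hu.cont_ut.1
  obtain ⟨I1, J1⟩ := integral_smul_inner (D := D) (w := fun t x => (c x ^ 2)⁻¹ * ut t x) (G := ψ)
    (θ := deriv θ) M1 cW' E1 (hψ.memLp _) hψ0 hθ' hθc.deriv
    ((support_deriv_subset).trans hθs)
  obtain ⟨I2, J2⟩ := integral_smul_inner (D := D) hu.cont_Du.1 cP
    (fun t ht => (coeFn_curve hu.cont_Du hDb ht.le).symm) (hψ.memLp_gradient _) hgψ0 hθ.continuous
    hθc ((subset_tsupport θ).trans hθs)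
  obtain ⟨I3, J3⟩ := integral_smul_inner (D := D)
    (w := fun t x => (a x / c x ^ 2) * caputo α (fun s => ut s x) t)
    (aestronglyMeasurable_dampedCaputo hu.cont_ut hac) cF'
      (fun t ht => dampedCaputo_ae_eq hα1 hu.cont_ut hc.continuous ha.continuous hc0 hD hDb ht)
      (hψ.memLp _) hψ0 hθ.continuous hθc ((subset_tsupport θ).trans hθs)
  -- The factor `c⁻²` cancels the `c²` inside the gradient of the distributional equation, leaving
  -- `∇ψ` there and the weights `c⁻²` and `a c⁻²` in the other two terms.
  have heq := hu.equation (fun z => θ z.1 * (ψ z.2 / c z.2 ^ 2)) ?_ ?_ ?_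
  · have hint : ∀ z : ℝ × Sp n,
        (-(ut z.1 z.2 * deriv (fun s => θ s * (ψ z.2 / c z.2 ^ 2)) z.1)
          + inner ℝ (Du z.1 z.2) (gradient (fun y => c y ^ 2 * (θ z.1 * (ψ y / c y ^ 2))) z.2)
          + a z.2 * caputo α (fun s => ut s z.2) z.1 * (θ z.1 * (ψ z.2 / c z.2 ^ 2)))
        = -(deriv θ z.1 * inner ℝ ((c z.2 ^ 2)⁻¹ * ut z.1 z.2) (ψ z.2))
          + θ z.1 * inner ℝ (Du z.1 z.2) (gradient ψ z.2)
          + θ z.1 * inner ℝ ((a z.2 / c z.2 ^ 2) * caputo α (fun s => ut s z.2) z.1) (ψ z.2) := by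
      intro z
      have hg : (fun y => c y ^ 2 * (θ z.1 * (ψ y / c y ^ 2))) = fun y => θ z.1 * ψ y := by
        funext y
        have := (hc0 y).ne'
        field_simp
      have hg' : gradient (fun y => θ z.1 * ψ y) z.2 = θ z.1 • gradient ψ z.2 := by
        rw [gradient_mul (differentiableAt_const _) (hψ.contDiff.differentiable (by simp) _),
          gradient_fun_const, smul_zero, add_zero]
      have hd : deriv (fun s => θ s * (ψ z.2 / c z.2 ^ 2)) z.1
          = deriv θ z.1 * (ψ z.2 / c z.2 ^ 2) :=
        deriv_mul_const (hθ.differentiable (by simp) _) _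
      rw [hg, hg', hd, inner_smul_right, Real.inner_apply, Real.inner_apply]
      ring
    simp only [hint] at heq
    rw [integral_neg_add_add I1 I2 I3, J1, J2, J3] at heq
    have L1 : Integrable fun t => deriv θ t *
        (inner ℝ (mulOp _ ℝ (massWeight D c) (curve D ut t)) (toL2 (volume.restrict D) ψ) : ℝ) :=
      (hθ'.mul (cW'.inner continuous_const)).integrable_of_hasCompactSupport hθc.deriv.mul_right
    have L2 : Integrable fun t => θ t *
        (inner ℝ (curve D Du t) (toL2 (volume.restrict D) (gradient ψ)) : ℝ) :=
      (hθ.continuous.mul (cP.inner continuous_const)).integrable_of_hasCompactSupport hθc.mul_right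
    have L3 : Integrable fun t => θ t *
        (inner ℝ (mulOp _ ℝ (dampingWeight D c a) (caputoCurve α D ut t))
          (toL2 (volume.restrict D) ψ) : ℝ) :=
      (hθ.continuous.mul (cF'.inner continuous_const)).integrable_of_hasCompactSupport
        hθc.mul_right
    simp only [mul_add, ← add_assoc]
    rw [integral_neg_add_add L1 L2 L3]
    exact heq
  · exact (hθ.comp contDiff_fst).mul ((hψ.contDiff.comp contDiff_snd).div
      ((hc.comp contDiff_snd).pow 2) fun z => (pow_pos (hc0 _) 2).ne')
  · refine HasCompactSupport.intro (hθc.isCompact.prod hψ.hasCompactSupport.isCompact) ?_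
    intro z hz
    by_contra h
    refine hz ⟨subset_tsupport _ fun h0 => h ?_, subset_tsupport _ fun h0 => h ?_⟩
    · rw [h0, zero_mul]
    · rw [h0, zero_div, mul_zero]
  · have : tsupport (fun z : ℝ × Sp n => θ z.1 * (ψ z.2 / c z.2 ^ 2))
        ⊆ tsupport θ ×ˢ Set.univ := by
      refine closure_minimal (fun z hz => ⟨subset_tsupport _ fun h0 => hz ?_, trivial⟩)
        ((isClosed_tsupport θ).prod isClosed_univ)
      simp only [h0, zero_mul]
    exact this.trans (Set.prod_mono hθs subset_rfl)

/-- The equation, integrated in time and tested in space. -/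
theorem IsSolution.annihilates (hu : IsSolution α c a u₀ u ut Du) (hα1 : α < 1)
    (hc : ContDiff ℝ ∞ c) (ha : ContDiff ℝ ∞ a) (hc0 : ∀ x, 0 < c x)
    (hD : MeasurableSet D) (hDb : Bornology.IsBounded D) {s t : ℝ} (hs : 0 < s) (hst : s ≤ t) :
    Annihilates D
      (mulOp _ ℝ (massWeight D c) (curve D ut t - curve D ut s)
        + ∫ r in s..t, mulOp _ ℝ (dampingWeight D c a) (caputoCurve α D ut r))
      (∫ r in s..t, curve D Du r) := by
  intro ψ hψ
  have cW := hu.cont_ut.continuous_curve hDb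
  have cP := hu.cont_Du.continuous_curve hDb
  have cF := continuous_caputoCurve hα1 hu.cont_ut hDb
  have cF' : Continuous fun r => mulOp _ ℝ (dampingWeight D c a) (caputoCurve α D ut r) :=
    (mulOp _ ℝ (dampingWeight D c a)).continuous.comp cF
  have cW' : Continuous fun r => mulOp _ ℝ (massWeight D c) (curve D ut r) :=
    (mulOp _ ℝ (massWeight D c)).continuous.comp cW
  have hcc : Continuous fun x => (c x ^ 2)⁻¹ :=
    (hc.continuous.pow 2).inv₀ fun x => (pow_pos (hc0 x) 2).ne'
  have hac : Continuous fun x => a x / c x ^ 2 :=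
    ha.continuous.div (hc.continuous.pow 2) fun x => (pow_pos (hc0 x) 2).ne'
  have key := sub_eq_neg_integral_of_weak_deriv
    (f := fun t => inner ℝ (mulOp _ ℝ (massWeight D c) (curve D ut t)) (toL2 _ ψ))
    (k := fun t => inner ℝ (curve D Du t) (toL2 _ (gradient ψ))
      + inner ℝ (mulOp _ ℝ (dampingWeight D c a) (caputoCurve α D ut t)) (toL2 _ ψ))
    (cW'.inner continuous_const)
    ((cP.inner continuous_const).add (cF'.inner continuous_const))
    (fun θ hθ hθc hθs => hu.integral_test_eq_zero hα1 hc ha hc0 hD hDb hψ hθ hθc hθs) hs hst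
  have e1 : (inner ℝ (∫ r in s..t, mulOp _ ℝ (dampingWeight D c a) (caputoCurve α D ut r))
      (toL2 _ ψ) : ℝ) = ∫ r in s..t,
        (inner ℝ (mulOp _ ℝ (dampingWeight D c a) (caputoCurve α D ut r)) (toL2 _ ψ) : ℝ) := by
    rw [real_inner_comm, ← innerSL_apply_apply ℝ,
      ← ContinuousLinearMap.intervalIntegral_comp_comm _ (cF'.intervalIntegrable _ _)]
    simp only [innerSL_apply_apply, real_inner_comm]
  have e2 : (inner ℝ (∫ r in s..t, curve D Du r) (toL2 _ (gradient ψ)) : ℝ)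
      = ∫ r in s..t, (inner ℝ (curve D Du r) (toL2 _ (gradient ψ)) : ℝ) := by
    rw [real_inner_comm, ← innerSL_apply_apply ℝ,
      ← ContinuousLinearMap.intervalIntegral_comp_comm _ (cP.intervalIntegrable _ _)]
    simp only [innerSL_apply_apply, real_inner_comm]
  rw [inner_add_left, e1, e2, map_sub, inner_sub_left]
  rw [intervalIntegral.integral_add ((cP.inner continuous_const).intervalIntegrable _ _)
    ((cF'.inner continuous_const).intervalIntegrable _ _)] at key
  linarith

/-- The equation tested against an element of `H¹₀(D)`. -/
theorem IsSolution.inner_eq_zero (hu : IsSolution α c a u₀ u ut Du) (hα1 : α < 1)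
    (hc : ContDiff ℝ ∞ c) (ha : ContDiff ℝ ∞ a) (hc0 : ∀ x, 0 < c x)
    (hD : MeasurableSet D) (hDb : Bornology.IsBounded D) {s t : ℝ} (hs : 0 < s) (hst : s ≤ t)
    {f : Lp ℝ 2 (volume.restrict D)} {p : Lp (Sp n) 2 (volume.restrict D)}
    (hfp : (f, p) ∈ zeroTrace D) :
    (inner ℝ (mulOp _ ℝ (massWeight D c) (curve D ut t - curve D ut s)
        + ∫ r in s..t, mulOp _ ℝ (dampingWeight D c a) (caputoCurve α D ut r)) f
      + inner ℝ (∫ r in s..t, curve D Du r) p : ℝ) = 0 :=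
  hfp _ _ (hu.annihilates hα1 hc ha hc0 hD hDb hs hst)

/-- The operator `S` stands for any nonnegative weight, so the work of the damping is nonnegative
locally in space and not only in total. -/
theorem IsSolution.caputo_nonneg (hu : IsSolution α c a u₀ u ut Du) (hα0 : 0 < α) (hα1 : α < 1)
    (hDb : Bornology.IsBounded D)
    {S : Lp ℝ 2 (volume.restrict D) →L[ℝ] Lp ℝ 2 (volume.restrict D)}
    (hS : ∀ x y, (inner ℝ (S x) y : ℝ) = inner ℝ (S y) x)
    (hS0 : ∀ x, (0 : ℝ) ≤ inner ℝ (S x) x) {t : ℝ} (ht : 0 ≤ t) :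
    0 ≤ ∫ r in (0 : ℝ)..t, (inner ℝ (S (caputoCurve α D ut r)) (curve D ut r) : ℝ) := by
  have h := integral_fracInt_nonneg hS hS0 (hu.cont_ut.continuous_curve hDb) hα0 hα1 ht
  have e : ∀ r, (inner ℝ (S (caputoCurve α D ut r)) (curve D ut r) : ℝ)
      = (Real.Gamma (1 - α))⁻¹ * inner ℝ (S (curve D ut r)) (fracInt α (curve D ut) r) := by
    intro r
    rw [hS, caputoCurve, inner_smul_right]
  simp only [e]
  rw [intervalIntegral.integral_const_mul]
  exact mul_nonneg (inv_nonneg.2 (Real.Gamma_pos_of_pos (by linarith)).le) h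

end Solution

end FracWave

/-! ### Energy balance under a Dirichlet condition. -/

namespace FracWave

variable {n : ℕ} {α : ℝ} {c a u₀ : Sp n → ℝ} {u ut : ℝ → Sp n → ℝ} {Du : ℝ → Sp n → Sp n}

/-- The energy in `D`, as a quadratic form on `L²(D)`. -/
noncomputable def quadEnergy (D : Set (Sp n)) (c : Sp n → ℝ) (ut : ℝ → Sp n → ℝ)
    (Du : ℝ → Sp n → Sp n) (t : ℝ) : ℝ :=
  inner ℝ (mulOp _ ℝ (massWeight D c) (curve D ut t)) (curve D ut t)
    + inner ℝ (curve D Du t) (curve D Du t)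

theorem massWeight_nonneg {D : Set (Sp n)} (hc : Continuous c) (hc0 : ∀ x, 0 < c x)
    (hD : MeasurableSet D) (hDb : Bornology.IsBounded D) :
    ∀ᵐ x ∂volume.restrict D, 0 ≤ massWeight D c x := by
  filter_upwards [coeFn_massWeight hc hc0 hD hDb] with x hx
  rw [hx]
  positivity

theorem dampingWeight_nonneg {D : Set (Sp n)} (hc : Continuous c) (ha : Continuous a)
    (hc0 : ∀ x, 0 < c x) (ha0 : ∀ x, 0 ≤ a x) (hD : MeasurableSet D)
    (hDb : Bornology.IsBounded D) : ∀ᵐ x ∂volume.restrict D, 0 ≤ dampingWeight D c a x := by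
  filter_upwards [coeFn_dampingWeight hc ha hc0 hD hDb] with x hx
  rw [hx]
  have := ha0 x
  positivity

theorem IsSolution.energy_eq (hu : IsSolution α c a u₀ u ut Du) (hc : Continuous c)
    (hc0 : ∀ x, 0 < c x) {D : Set (Sp n)} (hD : MeasurableSet D) (hDb : Bornology.IsBounded D)
    {t : ℝ} (ht : 0 ≤ t) :
    energy c D (ut t) (Du t) = ENNReal.ofReal (quadEnergy D c ut Du t) := by
  rw [quadEnergy, curve_of_nonneg D ut ht, curve_of_nonneg D Du ht]
  exact lintegral_energy_eq hc hc0 hD hDb (hu.cont_ut.memLp hDb ht) (hu.cont_Du.memLp hDb ht)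

theorem quadEnergy_nonneg {D : Set (Sp n)} (hc : Continuous c) (hc0 : ∀ x, 0 < c x)
    (hD : MeasurableSet D) (hDb : Bornology.IsBounded D) (t : ℝ) :
    0 ≤ quadEnergy D c ut Du t :=
  add_nonneg (inner_mulOp_self_nonneg (massWeight_nonneg hc hc0 hD hDb) _) real_inner_self_nonneg

/-- The power dissipated in `D`. -/
theorem IsSolution.integral_dissipation (hu : IsSolution α c a u₀ u ut Du) (hα1 : α < 1)
    (hc : Continuous c) (ha : Continuous a) (hc0 : ∀ x, 0 < c x) {D : Set (Sp n)}
    (hD : MeasurableSet D) (hDb : Bornology.IsBounded D) {t : ℝ} (ht : 0 ≤ t) :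
    IntegrableOn (fun z : ℝ × Sp n =>
        (a z.2 * caputo α (fun s => ut s z.2) z.1) * (ut z.1 z.2 / c z.2 ^ 2))
      (Set.Ioo 0 t ×ˢ D) ∧
    ∫ z in Set.Ioo 0 t ×ˢ D,
        (a z.2 * caputo α (fun s => ut s z.2) z.1) * (ut z.1 z.2 / c z.2 ^ 2)
      = ∫ r in (0 : ℝ)..t, (inner ℝ (mulOp _ ℝ (dampingWeight D c a) (caputoCurve α D ut r))
          (curve D ut r) : ℝ) := by
  have cW := hu.cont_ut.continuous_curve hDb
  have cF' : Continuous fun r => mulOp _ ℝ (dampingWeight D c a) (caputoCurve α D ut r) :=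
    (mulOp _ ℝ (dampingWeight D c a)).continuous.comp (continuous_caputoCurve hα1 hu.cont_ut hDb)
  have hac : Continuous fun x => a x / c x ^ 2 :=
    ha.div (hc.pow 2) fun x => (pow_pos (hc0 x) 2).ne'
  obtain ⟨C, hC⟩ := (isCompact_Icc (a := (0 : ℝ)) (b := t)).exists_bound_of_continuousOn
    cW.continuousOn
  have hae : ∀ r, 0 < r → (fun x => (a x / c x ^ 2) * caputo α (fun s => ut s x) r)
      =ᵐ[volume.restrict D] mulOp _ ℝ (dampingWeight D c a) (caputoCurve α D ut r) :=
    fun r hr => dampedCaputo_ae_eq hα1 hu.cont_ut hc ha hc0 hD hDb hr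
  have hmem : ∀ r, 0 < r → MemLp (fun x => (a x / c x ^ 2) * caputo α (fun s => ut s x) r) 2
      (volume.restrict D) := fun r hr => (memLp_congr_ae (hae r hr)).2 (Lp.memLp _)
  have hi : Integrable (fun z : ℝ × Sp n =>
      (inner ℝ ((a z.2 / c z.2 ^ 2) * caputo α (fun s => ut s z.2) z.1) (ut z.1 z.2) : ℝ))
      ((volume.restrict (Set.Ioo 0 t)).prod (volume.restrict D)) := by
    refine integrable_inner_prod
      (w := fun r x => (a x / c x ^ 2) * caputo α (fun s => ut s x) r) (g := ut)
      (κ := fun r => ‖mulOp _ ℝ (dampingWeight D c a) (caputoCurve α D ut r)‖) (C := C)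
      (aestronglyMeasurable_prod_restrict (aestronglyMeasurable_dampedCaputo hu.cont_ut hac)
        Set.Ioo_subset_Ioi_self D)
      (aestronglyMeasurable_prod_restrict hu.cont_ut.1 Set.Ioo_subset_Ioi_self D) ?_ ?_ ?_
    · filter_upwards [ae_restrict_mem measurableSet_Ioo] with r hr
      refine ⟨hmem r hr.1, ?_⟩
      rw [eq_toL2_of_ae_eq (hae r hr.1)]
    · filter_upwards [ae_restrict_mem measurableSet_Ioo] with r hr
      refine ⟨hu.cont_ut.memLp hDb hr.1.le, ?_⟩
      rw [← curve_of_nonneg D ut hr.1.le]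
      exact hC r ⟨hr.1.le, hr.2.le⟩
    · exact (cF'.norm.integrableOn_Icc (a := 0) (b := t)).mono_set Set.Ioo_subset_Icc_self
  have hfun : (fun z : ℝ × Sp n =>
      (inner ℝ ((a z.2 / c z.2 ^ 2) * caputo α (fun s => ut s z.2) z.1) (ut z.1 z.2) : ℝ))
      = fun z : ℝ × Sp n =>
        (a z.2 * caputo α (fun s => ut s z.2) z.1) * (ut z.1 z.2 / c z.2 ^ 2) := by
    funext z
    rw [Real.inner_apply]
    ring
  have hprod : (volume.restrict (Set.Ioo (0 : ℝ) t)).prod (volume.restrict D)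
      = volume.restrict (Set.Ioo (0 : ℝ) t ×ˢ D) := by
    rw [Measure.prod_restrict, ← Measure.volume_eq_prod]
  have hv := integral_prod _ hi
  rw [hprod] at hi
  rw [hfun] at hi
  rw [hprod, hfun] at hv
  refine ⟨hi, hv.trans ?_⟩
  rw [intervalIntegral.integral_of_le ht, integral_Ioc_eq_integral_Ioo]
  refine setIntegral_congr_fun measurableSet_Ioo fun r hr => ?_
  simp only
  rw [eq_toL2_of_ae_eq (hae r hr.1), curve_of_nonneg D ut hr.1.le,
    inner_toL2 (hmem r hr.1) (hu.cont_ut.memLp hDb hr.1.le)]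

/-- Dissipation of energy in a domain with a Dirichlet boundary condition. -/
theorem IsSolution.dissipation (hu : IsSolution α c a u₀ u ut Du) (hα0 : 0 < α) (hα1 : α < 1)
    (hc : ContDiff ℝ ∞ c) (ha : ContDiff ℝ ∞ a) (hc0 : ∀ x, 0 < c x) (ha0 : ∀ x, 0 ≤ a x)
    {D : Set (Sp n)} (hD : MeasurableSet D) (hDb : Bornology.IsBounded D) {T : ℝ}
    (hbd : ∀ t ∈ Set.Ioo 0 T, VanishesOnBoundary D (u t) (Du t)) {t : ℝ} (ht : t ∈ Set.Icc 0 T) :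
    energy c D (ut t) (Du t) ≠ ⊤ ∧
    IntegrableOn (fun z : ℝ × Sp n =>
        (a z.2 * caputo α (fun s => ut s z.2) z.1) * (ut z.1 z.2 / c z.2 ^ 2))
      (Set.Ioo 0 t ×ˢ D) ∧
    (energy c D (ut t) (Du t)).toReal = (energy c D (ut 0) (Du 0)).toReal
      - 2 * ∫ z in Set.Ioo 0 t ×ˢ D,
          (a z.2 * caputo α (fun s => ut s z.2) z.1) * (ut z.1 z.2 / c z.2 ^ 2) ∧
    0 ≤ ∫ z in Set.Ioo 0 t ×ˢ D,
      (a z.2 * caputo α (fun s => ut s z.2) z.1) * (ut z.1 z.2 / c z.2 ^ 2) := by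
  obtain ⟨hint, hval⟩ := hu.integral_dissipation hα1 hc.continuous ha.continuous hc0 hD hDb ht.1
  have cF' : Continuous fun r => mulOp _ ℝ (dampingWeight D c a) (caputoCurve α D ut r) :=
    (mulOp _ ℝ (dampingWeight D c a)).continuous.comp (continuous_caputoCurve hα1 hu.cont_ut hDb)
  have hid := abstract_energy_identity (U := curve D u) (W := curve D ut)
    (G := fun r => mulOp _ ℝ (dampingWeight D c a) (caputoCurve α D ut r)) (P := curve D Du)
    (K := mulOp _ ℝ (massWeight D c)) (M := ContinuousLinearMap.id ℝ _)
    (R := ContinuousLinearMap.id ℝ _) (Q := 0) (T := T)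
    (hu.cont_ut.continuous_curve hDb) cF' (hu.cont_Du.continuous_curve hDb)
    (fun r hr => hasDerivAt_curve hu.cont_u hu.cont_ut hu.timeDeriv hDb hr)
    (fun x y => inner_mulOp_comm _ _ _) (fun x y => real_inner_comm _ _)
    -- With `M` and `R` the identity and `Q = 0`, the test element is the increment of `(u, ∇u)`
    -- itself; the Dirichlet condition places it in `H¹₀(D)` at times strictly between `0` and `T`.
    (fun s r hs hsr hrT => by
      have hz : ∀ q ∈ Set.Ioo 0 T, (curve D u q, curve D Du q) ∈ zeroTrace D := fun q hq => by
        rw [curve_of_nonneg D u hq.1.le, curve_of_nonneg D Du hq.1.le]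
        exact mem_zeroTrace_of_vanishesOnBoundary (hu.cont_u.memLp hDb hq.1.le)
          (hu.cont_Du.memLp hDb hq.1.le) (hbd q hq)
      have hsub := (zeroTrace D).sub_mem (hz r ⟨hs.trans hsr, hrT⟩) (hz s ⟨hs, hsr.trans hrT⟩)
      simpa using hu.inner_eq_zero hα1 hc ha hc0 hD hDb hs hsr.le hsub) ht.1 ht.2
  simp only [ContinuousLinearMap.coe_id', id_eq, _root_.zero_apply, inner_zero_right,
    zero_add] at hid
  rw [hval, hu.energy_eq hc.continuous hc0 hD hDb ht.1,
    hu.energy_eq hc.continuous hc0 hD hDb le_rfl,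
    ENNReal.toReal_ofReal (quadEnergy_nonneg hc.continuous hc0 hD hDb t),
    ENNReal.toReal_ofReal (quadEnergy_nonneg hc.continuous hc0 hD hDb 0)]
  exact ⟨ENNReal.ofReal_ne_top, hint, hid, hu.caputo_nonneg hα0 hα1 hDb
    (fun x y => inner_mulOp_comm _ _ _)
    (fun x => inner_mulOp_self_nonneg
      (dampingWeight_nonneg hc.continuous ha.continuous hc0 ha0 hD hDb) x) ht.1⟩

end FracWave

/-! ### The weighted energy as a functional of the weight, and its time derivative. -/

namespace FracWave

section WeightForm

variable {Y F : Type*} [MeasurableSpace Y] {ν : Measure Y} [NormedAddCommGroup F]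
  [InnerProductSpace ℝ F]

/-- The functional `m ↦ ∫ m ⟪f, g⟫` on weights. -/
noncomputable def weightForm (f g : Lp F 2 ν) : Lp ℝ ∞ ν →L[ℝ] ℝ :=
  (innerSL ℝ g).comp ((mulOp ν F).flip f)

theorem weightForm_apply (f g : Lp F 2 ν) (m : Lp ℝ ∞ ν) :
    weightForm f g m = inner ℝ (mulOp ν F m f) g := by
  simp [weightForm, real_inner_comm]

theorem Continuous.weightForm {X : Type*} [TopologicalSpace X] {f g : X → Lp F 2 ν}
    (hf : Continuous f) (hg : Continuous g) : Continuous fun x => weightForm (f x) (g x) :=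
  ((innerSL ℝ).continuous.comp hg).clm_comp ((mulOp ν F).flip.continuous.comp hf)

theorem integral_weightForm_apply {f g : ℝ → Lp F 2 ν} (hf : Continuous f) (hg : Continuous g)
    (s t : ℝ) (m : Lp ℝ ∞ ν) : (∫ r in s..t, weightForm (f r) (g r)) m
      = ∫ r in s..t, (inner ℝ (mulOp ν F m (f r)) (g r) : ℝ) := by
  have h := ContinuousLinearMap.intervalIntegral_apply (a := s) (b := t)
    ((Continuous.weightForm hf hg).intervalIntegrable (μ := volume) s t) m
  simpa only [weightForm_apply] using h

theorem inner_mulOp_right_comm (m : Lp ℝ ∞ ν) (x y : Lp F 2 ν) :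
    (inner ℝ x (mulOp ν F m y) : ℝ) = inner ℝ y (mulOp ν F m x) := by
  rw [inner_mulOp_right, inner_mulOp_comm, ← inner_mulOp_right]

theorem inner_mulOp_mulOp_comm (m m' : Lp ℝ ∞ ν) (x y : Lp F 2 ν) :
    (inner ℝ (mulOp ν F m x) (mulOp ν F m' y) : ℝ)
      = inner ℝ (mulOp ν F m y) (mulOp ν F m' x) := by
  rw [inner_mulOp_right, mulOp_mulOp_comm, inner_mulOp_comm, real_inner_comm]

end WeightForm

/-- The difference quotient splits into that of `N` at the frozen element `ξ t`, plus `N s` applied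
to that of `ξ`. Thus `N` need only be continuous in norm: the energy functional is differentiated
only against cutoffs, not on all of `L^∞`. -/
theorem hasDerivAt_clm_apply_of_continuousAt {X : Type*} [NormedAddCommGroup X] [NormedSpace ℝ X]
    {N : ℝ → X →L[ℝ] ℝ} {ξ : ℝ → X} {ξ' : X} {d t : ℝ} (hN : ContinuousAt N t)
    (hd : HasDerivAt (fun s => N s (ξ t)) d t) (hξ : HasDerivAt ξ ξ' t) :
    HasDerivAt (fun s => N s (ξ s)) (d + N t ξ') t := by
  rw [hasDerivAt_iff_tendsto_slope] at hd hξ ⊢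
  have h := (isBoundedBilinearMap_apply (𝕜 := ℝ) (E := X) (F := ℝ)).continuous.tendsto (N t, ξ')
  refine (hd.add (h.comp ((hN.tendsto.mono_left nhdsWithin_le_nhds).prodMk_nhds hξ))).congr
    fun s => ?_
  simp only [slope_def_module, Function.comp_apply, map_smul, map_sub, smul_eq_mul]
  ring

theorem add_add_smul_apply {X : Type*} [NormedAddCommGroup X] [NormedSpace ℝ X]
    (f g h : X →L[ℝ] ℝ) (k : ℝ) (x : X) : (f + g + k • h) x = f x + g x + k * h x := rfl

variable {n : ℕ}

theorem norm_toLinf_le {D : Set (Sp n)} (hD : MeasurableSet D) (hDb : Bornology.IsBounded D)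
    {m : Sp n → ℝ} (hm : MemLp m ∞ (volume.restrict D)) {C : ℝ} (hC0 : 0 ≤ C)
    (hC : ∀ x ∈ D, |m x| ≤ C) : ‖toLinf (volume.restrict D) m‖ ≤ C := by
  have : IsFiniteMeasure (volume.restrict D) := ⟨by simpa using hDb.measure_lt_top⟩
  refine (Lp.norm_le_of_ae_bound hC0 ?_).trans_eq ?_
  · filter_upwards [coeFn_toLinf hm, ae_restrict_mem hD] with x h1 h2
    rw [h1]
    exact hC x h2
  · simp

theorem continuous_deriv_fst {η : ℝ → Sp n → ℝ}
    (hη : ContDiff ℝ ∞ fun z : ℝ × Sp n => η z.1 z.2) :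
    Continuous fun z : ℝ × Sp n => deriv (fun s => η s z.2) z.1 := by
  have h1 : ∀ z : ℝ × Sp n, deriv (fun s => η s z.2) z.1
      = fderiv ℝ (fun z : ℝ × Sp n => η z.1 z.2) z (1, 0) := by
    intro z
    have h2 : HasDerivAt (fun s : ℝ => (s, z.2)) ((1 : ℝ), (0 : Sp n)) z.1 :=
      (hasDerivAt_id z.1).prodMk (hasDerivAt_const z.1 z.2)
    have h3 : HasFDerivAt (fun z : ℝ × Sp n => η z.1 z.2)
        (fderiv ℝ (fun z : ℝ × Sp n => η z.1 z.2) z) ((fun s : ℝ => (s, z.2)) z.1) :=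
      (hη.differentiable (by simp) z).hasFDerivAt
    exact (h3.comp_hasDerivAt z.1 h2).deriv
  simp only [h1]
  exact (hη.continuous_fderiv (by simp)).clm_apply continuous_const

/-- A smooth family of weights is differentiable in `L^∞(D)`. -/
theorem hasDerivAt_toLinf {D : Set (Sp n)} (hD : IsCompact D) {η : ℝ → Sp n → ℝ}
    (hη : ContDiff ℝ ∞ fun z : ℝ × Sp n => η z.1 z.2) (t : ℝ) :
    HasDerivAt (fun t => toLinf (volume.restrict D) (η t))
      (toLinf (volume.restrict D) fun x => deriv (fun s => η s x) t) t := by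
  have hDm := hD.isClosed.measurableSet
  have hslice : ∀ x, ContDiff ℝ ∞ fun s => η s x := fun x =>
    hη.comp (contDiff_id.prodMk contDiff_const)
  have hd : ∀ s x, HasDerivAt (fun s => η s x) (deriv (fun s => η s x) s) s := fun s x =>
    ((hslice x).differentiable (by simp) s).hasDerivAt
  have hdc := continuous_deriv_fst hη
  have hηc : ∀ s, Continuous (η s) := fun s =>
    hη.continuous.comp (continuous_const.prodMk continuous_id)
  have hdtc : ∀ s, Continuous fun x => deriv (fun s => η s x) s := fun s =>
    hdc.comp (continuous_const.prodMk continuous_id)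
  have hm : ∀ {m : Sp n → ℝ}, Continuous m → MemLp m ∞ (volume.restrict D) := fun hmc =>
    memLp_top_restrict hDm hD.isBounded hmc
  rw [hasDerivAt_iff_isLittleO, Asymptotics.isLittleO_iff]
  intro ε hε
  -- Uniform continuity of `∂ₜη` on a compact set makes the mean value estimate uniform in `x`,
  -- which is differentiability in the `L^∞` norm.
  have hunif := ((isCompact_Icc (a := t - 1) (b := t + 1)).prod
    hD).uniformContinuousOn_of_continuous
    hdc.continuousOn
  obtain ⟨δ, hδ, hδ'⟩ := Metric.uniformContinuousOn_iff.1 hunif ε hε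
  filter_upwards [Metric.ball_mem_nhds t (lt_min hδ one_pos)] with s hs
  have hst := Metric.mem_ball.1 hs
  have hsδ : ∀ r ∈ Set.uIcc t s, ∀ x ∈ D,
      ‖deriv (fun s => η s x) r - deriv (fun s => η s x) t‖ ≤ ε := by
    intro r hr x hx
    have hrt : |r - t| ≤ |s - t| := Set.abs_sub_left_of_mem_uIcc hr
    rw [Real.dist_eq] at hst
    have h1 := (lt_min_iff.1 (hrt.trans_lt hst))
    have h2 := abs_lt.1 h1.2
    refine (hδ' (r, x) ⟨⟨by linarith [h2.1], by linarith [h2.2]⟩, hx⟩ (t, x)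
      ⟨⟨by linarith, by linarith⟩, hx⟩ ?_).le
    rw [Prod.dist_eq, dist_self, max_eq_left dist_nonneg, Real.dist_eq]
    exact h1.1
  have hb : ∀ x ∈ D, |η s x - η t x - (s - t) * deriv (fun s => η s x) t| ≤ ε * |s - t| := by
    intro x hx
    have := (convex_uIcc t s).norm_image_sub_le_of_norm_hasDerivWithin_le
      (f := fun r => η r x - r * deriv (fun s => η s x) t)
      (f' := fun r => deriv (fun s => η s x) r - 1 * deriv (fun s => η s x) t) (C := ε)
      (fun r _ => ((hd r x).sub ((hasDerivAt_id r).mul_const _)).hasDerivWithinAt)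
      (fun r hr => by rw [one_mul]; exact hsδ r hr x hx) Set.left_mem_uIcc Set.right_mem_uIcc
    rw [Real.norm_eq_abs, Real.norm_eq_abs] at this
    convert this using 2
    ring
  have hcs : Continuous fun x => η s x - η t x - (s - t) * deriv (fun s => η s x) t :=
    ((hηc s).sub (hηc t)).sub (continuous_const.mul (hdtc t))
  have he : toLinf (volume.restrict D) (η s) - toLinf (volume.restrict D) (η t)
      - (s - t) • toLinf (volume.restrict D) (fun x => deriv (fun s => η s x) t)
      = toLinf (volume.restrict D)
        (fun x => η s x - η t x - (s - t) * deriv (fun s => η s x) t) := by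
    refine Lp.ext ?_
    filter_upwards [coeFn_toLinf (hm (hηc s)), coeFn_toLinf (hm (hηc t)),
      coeFn_toLinf (hm (hdtc t)),
      coeFn_toLinf (hm hcs),
      Lp.coeFn_sub (toLinf (volume.restrict D) (η s) - toLinf (volume.restrict D) (η t))
        ((s - t) • toLinf (volume.restrict D) (fun x => deriv (fun s => η s x) t)),
      Lp.coeFn_sub (toLinf (volume.restrict D) (η s)) (toLinf (volume.restrict D) (η t)),
      Lp.coeFn_smul (s - t) (toLinf (volume.restrict D) (fun x => deriv (fun s => η s x) t))]
      with x e1 e2 e3 e4 e5 e6 e7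
    rw [e4, e5, Pi.sub_apply, e6, Pi.sub_apply, e7, Pi.smul_apply, e1, e2, e3, smul_eq_mul]
  rw [he, Real.norm_eq_abs]
  exact norm_toLinf_le hDm hD.isBounded
    (hm hcs) (by positivity) hb

theorem map_sub_mem_zeroTrace {D : Set (Sp n)}
    {M : Lp ℝ 2 (volume.restrict D) →L[ℝ] Lp ℝ 2 (volume.restrict D)}
    {R : Lp (Sp n) 2 (volume.restrict D) →L[ℝ] Lp (Sp n) 2 (volume.restrict D)}
    {Q : Lp ℝ 2 (volume.restrict D) →L[ℝ] Lp (Sp n) 2 (volume.restrict D)}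
    {f f' : Lp ℝ 2 (volume.restrict D)} {p p' : Lp (Sp n) 2 (volume.restrict D)}
    (h : (M f, R p + Q f) ∈ zeroTrace D) (h' : (M f', R p' + Q f') ∈ zeroTrace D) :
    (M (f - f'), R (p - p') + Q (f - f')) ∈ zeroTrace D := by
  have h2 := (zeroTrace D).sub_mem h h'
  rw [Prod.mk_sub_mk, add_sub_add_comm, ← map_sub, ← map_sub, ← map_sub] at h2
  exact h2

section Weighted

variable {α : ℝ} {c a u₀ : Sp n → ℝ} {u ut : ℝ → Sp n → ℝ} {Du : ℝ → Sp n → Sp n}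

/-- The energy weighted by `m`, plus the weighted energy dissipated up to time `t`, as a functional
of the weight `m`. -/
noncomputable def weightedEnergy (α : ℝ) (D : Set (Sp n)) (c a : Sp n → ℝ) (ut : ℝ → Sp n → ℝ)
    (Du : ℝ → Sp n → Sp n) (t : ℝ) : Lp ℝ ∞ (volume.restrict D) →L[ℝ] ℝ :=
  weightForm (mulOp _ ℝ (massWeight D c) (curve D ut t)) (curve D ut t)
    + weightForm (curve D Du t) (curve D Du t)
    + (2 : ℝ) • ∫ r in (0 : ℝ)..t, weightForm
        (mulOp _ ℝ (dampingWeight D c a) (caputoCurve α D ut r)) (curve D ut r)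

theorem IsSolution.continuous_dissipation (hu : IsSolution α c a u₀ u ut Du) (hα1 : α < 1)
    {D : Set (Sp n)} (hDb : Bornology.IsBounded D) :
    Continuous fun r => weightForm
        (mulOp _ ℝ (dampingWeight D c a) (caputoCurve α D ut r)) (curve D ut r) :=
  Continuous.weightForm ((mulOp _ ℝ (dampingWeight D c a)).continuous.comp
    (continuous_caputoCurve hα1 hu.cont_ut hDb)) (hu.cont_ut.continuous_curve hDb)

theorem IsSolution.continuous_weightedEnergy (hu : IsSolution α c a u₀ u ut Du) (hα1 : α < 1)
    {D : Set (Sp n)} (hDb : Bornology.IsBounded D) :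
    Continuous (weightedEnergy α D c a ut Du) := by
  have cW := hu.cont_ut.continuous_curve hDb
  have cP := hu.cont_Du.continuous_curve hDb
  have h1 := Continuous.weightForm ((mulOp _ ℝ (massWeight D c)).continuous.comp cW) cW
  have h2 := Continuous.weightForm cP cP
  have h3 := intervalIntegral.continuous_primitive
    (fun a b => (hu.continuous_dissipation hα1 hDb).intervalIntegrable (μ := volume) a b) 0
  exact (h1.add h2).add (h3.const_smul (2 : ℝ))

theorem IsSolution.weightedEnergy_apply (hu : IsSolution α c a u₀ u ut Du) (hα1 : α < 1)
    {D : Set (Sp n)} (hDb : Bornology.IsBounded D) (t : ℝ) (m : Lp ℝ ∞ (volume.restrict D)) :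
    weightedEnergy α D c a ut Du t m =
      inner ℝ (mulOp _ ℝ m (mulOp _ ℝ (massWeight D c) (curve D ut t))) (curve D ut t)
      + inner ℝ (mulOp _ _ m (curve D Du t)) (curve D Du t)
      + 2 * ∫ r in (0 : ℝ)..t, (inner ℝ
          (mulOp _ ℝ m (mulOp _ ℝ (dampingWeight D c a) (caputoCurve α D ut r)))
          (curve D ut r) : ℝ) := by
  have h1 := integral_weightForm_apply
    (f := fun r => mulOp _ ℝ (dampingWeight D c a) (caputoCurve α D ut r)) (g := curve D ut)
    ((mulOp _ ℝ (dampingWeight D c a)).continuous.comp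
    (continuous_caputoCurve hα1 hu.cont_ut hDb)) (hu.cont_ut.continuous_curve hDb) 0 t m
  refine (add_add_smul_apply _ _ _ _ _).trans ?_
  refine congrArg₂ (· + ·) (congrArg₂ (· + ·) (weightForm_apply _ _ _) (weightForm_apply _ _ _)) ?_
  exact congrArg (2 * ·) h1

/-- Multiplication by a cutoff maps a solution to curves in `H¹₀`. -/
theorem IsSolution.cutoff_mem_zeroTrace (hu : IsSolution α c a u₀ u ut Du) {r R : ℝ} (hrR : r < R)
    {η : Sp n → ℝ} (hη : ContDiff ℝ ∞ η) (hηr : Function.support η ⊆ Metric.closedBall 0 r)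
    {t : ℝ} (ht : 0 ≤ t) :
    (mulOp _ ℝ (toLinf _ η) (curve (Metric.closedBall 0 R) u t),
      mulOp _ (Sp n) (toLinf _ η) (curve (Metric.closedBall 0 R) Du t)
        + vecMulOp _ (Sp n) (toLinf _ (gradient η)) (curve (Metric.closedBall 0 R) u t))
      ∈ zeroTrace (Metric.closedBall (0 : Sp n) R) := by
  have hDb : Bornology.IsBounded (Metric.closedBall (0 : Sp n) R) := Metric.isBounded_closedBall
  have hD : MeasurableSet (Metric.closedBall (0 : Sp n) R) :=
    Metric.isClosed_closedBall.measurableSet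
  have h := mul_mem_zeroTrace hrR (hu.cont_u.locL2 ht) (hu.cont_Du.locL2 ht) (hu.weakGradient t ht)
    hη hηr
  have m1 := memLp_top_restrict hD hDb hη.continuous
  have m2 := memLp_top_restrict hD hDb (continuous_gradient hη)
  have e1 : mulOp _ ℝ (toLinf _ η) (curve (Metric.closedBall 0 R) u t)
      = toL2 (volume.restrict (Metric.closedBall 0 R)) (fun x => η x * u t x) := by
    refine eq_toL2_of_ae_eq ?_
    filter_upwards [mulOp_toLinf m1 (curve (Metric.closedBall 0 R) u t),
      coeFn_curve hu.cont_u hDb ht] with x h1 h2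
    rw [h1, h2, smul_eq_mul]
  have e2 : mulOp _ (Sp n) (toLinf _ η) (curve (Metric.closedBall 0 R) Du t)
        + vecMulOp _ (Sp n) (toLinf _ (gradient η)) (curve (Metric.closedBall 0 R) u t)
      = toL2 (volume.restrict (Metric.closedBall 0 R))
        (fun x => η x • Du t x + u t x • gradient η x) := by
    refine eq_toL2_of_ae_eq ?_
    filter_upwards [mulOp_toLinf m1 (curve (Metric.closedBall 0 R) Du t),
      coeFn_curve hu.cont_u hDb ht, coeFn_curve hu.cont_Du hDb ht, coeFn_toLinf m2,
      coeFn_vecMulOp (toLinf _ (gradient η)) (curve (Metric.closedBall 0 R) u t),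
      Lp.coeFn_add (mulOp _ (Sp n) (toLinf _ η) (curve (Metric.closedBall 0 R) Du t))
        (vecMulOp _ (Sp n) (toLinf _ (gradient η)) (curve (Metric.closedBall 0 R) u t))]
      with x h1 h2 h3 h4 h5 h6
    rw [h6, Pi.add_apply, h1, h5, h2, h3, h4]
  rw [e1, e2]
  exact h

/-- The local energy identity. -/
theorem IsSolution.hasDerivAt_weightedEnergy (hu : IsSolution α c a u₀ u ut Du) (hα1 : α < 1)
    (hc : ContDiff ℝ ∞ c) (ha : ContDiff ℝ ∞ a) (hc0 : ∀ x, 0 < c x) {D : Set (Sp n)}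
    (hD : MeasurableSet D) (hDb : Bornology.IsBounded D) {η : Sp n → ℝ}
    (hη : ∀ t, 0 ≤ t → (mulOp _ ℝ (toLinf _ η) (curve D u t),
      mulOp _ (Sp n) (toLinf _ η) (curve D Du t)
        + vecMulOp _ (Sp n) (toLinf _ (gradient η)) (curve D u t)) ∈ zeroTrace D)
    {t : ℝ} (ht : 0 < t) :
    HasDerivAt (fun t => weightedEnergy α D c a ut Du t (toLinf _ η))
      (-2 * inner ℝ (curve D Du t)
        (vecMulOp _ (Sp n) (toLinf _ (gradient η)) (curve D ut t))) t := by
  have cW := hu.cont_ut.continuous_curve hDb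
  have cP := hu.cont_Du.continuous_curve hDb
  have cF' : Continuous fun r => mulOp _ ℝ (dampingWeight D c a) (caputoCurve α D ut r) :=
    (mulOp _ ℝ (dampingWeight D c a)).continuous.comp (continuous_caputoCurve hα1 hu.cont_ut hDb)
  have cQ : Continuous fun r => (inner ℝ (curve D Du r)
      (vecMulOp _ (Sp n) (toLinf _ (gradient η)) (curve D ut r)) : ℝ) :=
    cP.inner ((vecMulOp _ (Sp n) (toLinf _ (gradient η))).continuous.comp cW)
  have cG : Continuous fun r => (inner ℝ (mulOp _ ℝ (dampingWeight D c a) (caputoCurve α D ut r))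
      (mulOp _ ℝ (toLinf _ η) (curve D ut r)) : ℝ) :=
    cF'.inner ((mulOp _ ℝ (toLinf _ η)).continuous.comp cW)
  have hid : ∀ q, 0 ≤ q → weightedEnergy α D c a ut Du q (toLinf _ η)
      = weightedEnergy α D c a ut Du 0 (toLinf _ η) - 2 * ∫ r in (0 : ℝ)..q,
        (inner ℝ (curve D Du r)
          (vecMulOp _ (Sp n) (toLinf _ (gradient η)) (curve D ut r)) : ℝ) := by
    intro q hq
    -- With these operators the test element is the increment of `(η u, ∇(η u))`, since `∇(η u) = η
    -- ∇u + u ∇η`; the operator `Q` produces the flux.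
    have h := abstract_energy_identity (U := curve D u) (W := curve D ut)
      (G := fun r => mulOp _ ℝ (dampingWeight D c a) (caputoCurve α D ut r)) (P := curve D Du)
      (K := mulOp _ ℝ (massWeight D c)) (M := mulOp _ ℝ (toLinf _ η))
      (R := mulOp _ (Sp n) (toLinf _ η)) (Q := vecMulOp _ (Sp n) (toLinf _ (gradient η))) (T := q)
      cW cF' cP (fun r hr => hasDerivAt_curve hu.cont_u hu.cont_ut hu.timeDeriv hDb hr)
      (inner_mulOp_mulOp_comm _ _) (inner_mulOp_right_comm _)
      (fun s r hs hsr hrT => by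
        exact hu.inner_eq_zero hα1 hc ha hc0 hD hDb hs hsr.le
          (map_sub_mem_zeroTrace (hη _ (hs.trans hsr).le) (hη _ hs.le))) hq le_rfl
    have h1 := intervalIntegral.integral_add (cQ.intervalIntegrable (μ := volume) 0 q)
      (cG.intervalIntegrable (μ := volume) 0 q)
    have h2 : (∫ r in (0 : ℝ)..q, (inner ℝ (mulOp _ ℝ (dampingWeight D c a) (caputoCurve α D ut r))
          (mulOp _ ℝ (toLinf _ η) (curve D ut r)) : ℝ))
        = ∫ r in (0 : ℝ)..q, (inner ℝ (mulOp _ ℝ (toLinf _ η)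
          (mulOp _ ℝ (dampingWeight D c a) (caputoCurve α D ut r))) (curve D ut r) : ℝ) :=
      intervalIntegral.integral_congr fun r _ => inner_mulOp_right _ _ _
    have h3 : ∀ r, (inner ℝ (mulOp _ ℝ (massWeight D c) (curve D ut r))
          (mulOp _ ℝ (toLinf _ η) (curve D ut r)) : ℝ)
        = inner ℝ (mulOp _ ℝ (toLinf _ η) (mulOp _ ℝ (massWeight D c) (curve D ut r)))
          (curve D ut r) := fun r => inner_mulOp_right _ _ _
    have h4 : ∀ r, (inner ℝ (curve D Du r) (mulOp _ (Sp n) (toLinf _ η) (curve D Du r)) : ℝ)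
        = inner ℝ (mulOp _ (Sp n) (toLinf _ η) (curve D Du r)) (curve D Du r) :=
      fun r => inner_mulOp_right _ _ _
    have e1 := hu.weightedEnergy_apply (c := c) (a := a) hα1 hDb q (toLinf _ η)
    have e2 := hu.weightedEnergy_apply (c := c) (a := a) hα1 hDb 0 (toLinf _ η)
    have h5 := h3 q
    have h6 := h3 0
    have h7 := h4 q
    have h8 := h4 0
    have h9 : (∫ r in (0 : ℝ)..0, (inner ℝ (mulOp _ ℝ (toLinf _ η)
          (mulOp _ ℝ (dampingWeight D c a) (caputoCurve α D ut r))) (curve D ut r) : ℝ)) = 0 :=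
      intervalIntegral.integral_same
    linarith
  have hd : HasDerivAt (fun q => weightedEnergy α D c a ut Du 0 (toLinf _ η) - 2 *
      ∫ r in (0 : ℝ)..q, (inner ℝ (curve D Du r)
          (vecMulOp _ (Sp n) (toLinf _ (gradient η)) (curve D ut r)) : ℝ))
      (-2 * inner ℝ (curve D Du t)
        (vecMulOp _ (Sp n) (toLinf _ (gradient η)) (curve D ut t))) t := by
    have h1 := intervalIntegral.integral_hasDerivAt_right (cQ.intervalIntegrable 0 t)
      (cQ.stronglyMeasurableAtFilter volume _) cQ.continuousAt
    exact ((h1.const_mul 2).const_sub _).congr_deriv (by ring)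
  refine hd.congr_of_eventuallyEq ?_
  filter_upwards [Ioi_mem_nhds ht] with q hq
  exact hid q (le_of_lt hq)

end Weighted

end FracWave

/-! ### Vanishing of the energy inside shrinking weights. -/

namespace FracWave

variable {n : ℕ}

section LocalEnergy

variable {α : ℝ} {c a u₀ : Sp n → ℝ} {u ut : ℝ → Sp n → ℝ} {Du : ℝ → Sp n → Sp n}

theorem IsSolution.integrable_weighted (hu : IsSolution α c a u₀ u ut Du) (hc : Continuous c)
    (hc0 : ∀ x, 0 < c x) {D : Set (Sp n)} (hD : MeasurableSet D) (hDb : Bornology.IsBounded D)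
    {m : Sp n → ℝ} (hm : Continuous m) {t : ℝ} (ht : 0 ≤ t) :
    Integrable (fun x => m x * (ut t x ^ 2 / c x ^ 2 + ‖Du t x‖ ^ 2)) (volume.restrict D) ∧
    (inner ℝ (mulOp _ ℝ (toLinf _ m) (mulOp _ ℝ (massWeight D c) (curve D ut t))) (curve D ut t)
      + inner ℝ (mulOp _ _ (toLinf _ m) (curve D Du t)) (curve D Du t) : ℝ)
      = ∫ x in D, m x * (ut t x ^ 2 / c x ^ 2 + ‖Du t x‖ ^ 2) := by
  have h1 := L2.integrable_inner (𝕜 := ℝ)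
    (mulOp _ ℝ (toLinf _ m) (mulOp _ ℝ (massWeight D c) (curve D ut t))) (curve D ut t)
  have h2 := L2.integrable_inner (𝕜 := ℝ)
    (mulOp _ _ (toLinf _ m) (curve D Du t)) (curve D Du t)
  have he : (fun x => (inner ℝ
      ((mulOp _ ℝ (toLinf _ m) (mulOp _ ℝ (massWeight D c) (curve D ut t))) x) (curve D ut t x)
      + inner ℝ (mulOp _ _ (toLinf _ m) (curve D Du t) x) (curve D Du t x) : ℝ))
      =ᵐ[volume.restrict D] fun x => m x * (ut t x ^ 2 / c x ^ 2 + ‖Du t x‖ ^ 2) := by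
    have hmm := memLp_top_restrict hD hDb hm
    filter_upwards [mulOp_toLinf hmm (mulOp _ ℝ (massWeight D c) (curve D ut t)),
      mulOp_toLinf (memLp_massWeight hc hc0 hD hDb) (curve D ut t),
      mulOp_toLinf hmm (curve D Du t), coeFn_curve hu.cont_ut hDb ht,
      coeFn_curve hu.cont_Du hDb ht] with x e1 e2 e3 e4 e5
    rw [e1, massWeight, e2, e3, e4, e5, real_inner_smul_left, real_inner_smul_left,
      real_inner_smul_left, real_inner_self_eq_norm_sq, real_inner_self_eq_norm_sq,
      Real.norm_eq_abs, sq_abs]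
    ring
  refine ⟨(h1.add h2).congr he, ?_⟩
  rw [L2.inner_def, L2.inner_def]
  exact (integral_add h1 h2).symm.trans (integral_congr_ae he)

theorem IsSolution.integral_damping_nonneg (hu : IsSolution α c a u₀ u ut Du) (hα0 : 0 < α)
    (hα1 : α < 1) (hc : Continuous c) (ha : Continuous a) (hc0 : ∀ x, 0 < c x)
    (ha0 : ∀ x, 0 ≤ a x) {D : Set (Sp n)} (hD : MeasurableSet D) (hDb : Bornology.IsBounded D)
    {m : Lp ℝ ∞ (volume.restrict D)} (hm : ∀ᵐ x ∂volume.restrict D, 0 ≤ m x)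
    {t : ℝ} (ht : 0 ≤ t) :
    0 ≤ ∫ r in (0 : ℝ)..t, (inner ℝ
          (mulOp _ ℝ m (mulOp _ ℝ (dampingWeight D c a) (caputoCurve α D ut r)))
          (curve D ut r) : ℝ) := by
  refine hu.caputo_nonneg hα0 hα1 hDb
    (S := (mulOp _ ℝ m).comp (mulOp _ ℝ (dampingWeight D c a))) (fun x y => ?_) (fun x => ?_) ht
  · exact (inner_mulOp_right _ _ _).symm.trans
      ((inner_mulOp_mulOp_comm _ _ _ _).trans (inner_mulOp_right _ _ _))
  · refine (inner_mulOp m (mulOp _ ℝ (dampingWeight D c a) x) x).symm ▸ ?_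
    refine integral_nonneg_of_ae ?_
    filter_upwards [hm, coeFn_mulOp (dampingWeight D c a) x,
      dampingWeight_nonneg hc ha hc0 ha0 hD hDb] with y h1 h2 h3
    rw [h2, inner_smul_left]
    exact mul_nonneg h1 (mul_nonneg h3 real_inner_self_nonneg)

theorem IsSolution.neg_inner_vecMulOp (hu : IsSolution α c a u₀ u ut Du) {D : Set (Sp n)}
    (hD : MeasurableSet D) (hDb : Bornology.IsBounded D)
    {g : Sp n → Sp n} (hg : Continuous g) {t : ℝ} (ht : 0 ≤ t) :
    Integrable (fun x => ut t x * inner ℝ (Du t x) (g x)) (volume.restrict D) ∧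
    (inner ℝ (curve D Du t) (vecMulOp _ (Sp n) (toLinf _ g) (curve D ut t)) : ℝ)
      = ∫ x in D, ut t x * inner ℝ (Du t x) (g x) := by
  have h1 := L2.integrable_inner (𝕜 := ℝ) (curve D Du t)
    (vecMulOp _ (Sp n) (toLinf _ g) (curve D ut t))
  have he : (fun x => (inner ℝ (curve D Du t x)
      (vecMulOp _ (Sp n) (toLinf _ g) (curve D ut t) x) : ℝ))
      =ᵐ[volume.restrict D] fun x => ut t x * inner ℝ (Du t x) (g x) := by
    filter_upwards [coeFn_vecMulOp (toLinf _ g) (curve D ut t),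
      coeFn_toLinf (memLp_top_restrict hD hDb hg), coeFn_curve hu.cont_ut hDb ht,
      coeFn_curve hu.cont_Du hDb ht] with x e1 e2 e3 e4
    rw [e1, e2, e3, e4, inner_smul_right]
  refine ⟨h1.congr he, ?_⟩
  rw [L2.inner_def]
  exact integral_congr_ae he

/-- The energy flux is at most `c` times the energy density: `2 |w| ‖p‖ ≤ c (w² / c² + ‖p‖²)`, the
difference being `c (|w| / c - ‖p‖)²`. -/
theorem flux_le {c w : ℝ} (hc : 0 < c) (p g : Sp n) {d : ℝ} (hd : d ≤ -(c * ‖g‖)) :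
    d * (w ^ 2 / c ^ 2 + ‖p‖ ^ 2) - 2 * (w * inner ℝ p g) ≤ 0 := by
  have h1 : |w * inner ℝ p g| ≤ |w| * (‖p‖ * ‖g‖) := by
    rw [abs_mul]
    exact mul_le_mul_of_nonneg_left (abs_real_inner_le_norm p g) (abs_nonneg w)
  have h2 : d * (w ^ 2 / c ^ 2 + ‖p‖ ^ 2) ≤ -(c * ‖g‖) * (w ^ 2 / c ^ 2 + ‖p‖ ^ 2) :=
    mul_le_mul_of_nonneg_right hd (by positivity)
  have h3 : 2 * (|w| * (‖p‖ * ‖g‖)) ≤ c * ‖g‖ * (w ^ 2 / c ^ 2 + ‖p‖ ^ 2) := by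
    have h4 : c * ‖g‖ * (w ^ 2 / c ^ 2 + ‖p‖ ^ 2) - 2 * (|w| * (‖p‖ * ‖g‖))
        = c * ‖g‖ * (|w| / c - ‖p‖) ^ 2 := by
      rw [← sq_abs w]
      field_simp
      ring
    have : 0 ≤ c * ‖g‖ * (|w| / c - ‖p‖) ^ 2 := by positivity
    linarith
  have h5 := neg_abs_le (w * inner ℝ p g)
  linarith

/-- The energy inside a family of weights which shrinks at least at the speed `c`. -/
theorem IsSolution.ae_eq_zero_of_shrinking_weight (hu : IsSolution α c a u₀ u ut Du) (hα0 : 0 < α)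
    (hα1 : α < 1) (hc : ContDiff ℝ ∞ c) (ha : ContDiff ℝ ∞ a) (hc0 : ∀ x, 0 < c x)
    (ha0 : ∀ x, 0 ≤ a x) {τ r : ℝ} {η : ℝ → Sp n → ℝ}
    (hη : ContDiff ℝ ∞ fun z : ℝ × Sp n => η z.1 z.2) (hη0 : ∀ t x, 0 ≤ η t x)
    (hηr : ∀ t ∈ Set.Icc 0 τ, Function.support (η t) ⊆ Metric.closedBall 0 r)
    (hηc : ∀ t ∈ Set.Ioo 0 τ, ∀ x,
      deriv (fun s => η s x) t ≤ -(c x * ‖gradient (η t) x‖))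
    (h0 : ∀ᵐ x, η 0 x ≠ 0 → ut 0 x = 0 ∧ Du 0 x = 0) :
    ∀ t ∈ Set.Icc 0 τ, ∀ᵐ x, η t x ≠ 0 → ut t x = 0 ∧ Du t x = 0 := by
  intro t ht
  have hDb : Bornology.IsBounded (Metric.closedBall (0 : Sp n) (r + 1)) :=
    Metric.isBounded_closedBall
  have hDm : MeasurableSet (Metric.closedBall (0 : Sp n) (r + 1)) :=
    Metric.isClosed_closedBall.measurableSet
  have hηt : ∀ t, ContDiff ℝ ∞ (η t) := fun t => hη.comp (contDiff_const.prodMk contDiff_id)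
  have hdη : ∀ t, Continuous fun x => deriv (fun s => η s x) t := fun t =>
    (continuous_deriv_fst hη).comp (continuous_const.prodMk continuous_id)
  -- The margin between the radii `r` and `r + 1` is the room for mollification in
  -- `cutoff_mem_zeroTrace`.
  obtain ⟨D, hDdef⟩ : ∃ D, D = Metric.closedBall (0 : Sp n) (r + 1) := ⟨_, rfl⟩
  have hDc : IsCompact D := hDdef ▸ isCompact_closedBall 0 (r + 1)
  have hzt : ∀ q ∈ Set.Icc 0 τ, ∀ t, 0 ≤ t → (mulOp _ ℝ (toLinf _ (η q)) (curve D u t),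
      mulOp _ (Sp n) (toLinf _ (η q)) (curve D Du t)
        + vecMulOp _ (Sp n) (toLinf _ (gradient (η q))) (curve D u t)) ∈ zeroTrace D := by
    intro q hq t ht
    rw [hDdef]
    exact hu.cutoff_mem_zeroTrace (lt_add_one r) (hηt q) (hηr q hq) ht
  rw [← hDdef] at hDb hDm
  have hsuppD : ∀ t ∈ Set.Icc 0 τ, ∀ x, η t x ≠ 0 → x ∈ D := fun t ht x hx => by
    rw [hDdef]
    exact Metric.closedBall_subset_closedBall (by linarith) (hηr t ht hx)
  have hder : ∀ t ∈ Set.Ioo 0 τ, HasDerivAt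
      (fun s => weightedEnergy α D c a ut Du s (toLinf _ (η s)))
      (-2 * inner ℝ (curve D Du t)
        (vecMulOp _ (Sp n) (toLinf _ (gradient (η t))) (curve D ut t))
        + weightedEnergy α D c a ut Du t (toLinf _ fun x => deriv (fun s => η s x) t)) t :=
    fun t ht => hasDerivAt_clm_apply_of_continuousAt
      (hu.continuous_weightedEnergy hα1 hDb).continuousAt
      (hu.hasDerivAt_weightedEnergy hα1 hc ha hc0 hDm hDb (hzt t ⟨ht.1.le, ht.2.le⟩) ht.1)
      (hasDerivAt_toLinf hDc hη t)
  have hcont : Continuous fun s => weightedEnergy α D c a ut Du s (toLinf _ (η s)) :=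
    (hu.continuous_weightedEnergy hα1 hDb).clm_apply
      (continuous_iff_continuousAt.2 fun t => (hasDerivAt_toLinf hDc hη t).continuousAt)
  have hnonpos : ∀ t ∈ Set.Ioo 0 τ, -2 * inner ℝ (curve D Du t)
        (vecMulOp _ (Sp n) (toLinf _ (gradient (η t))) (curve D ut t))
        + weightedEnergy α D c a ut Du t (toLinf _ fun x => deriv (fun s => η s x) t) ≤ 0 := by
    intro t ht
    obtain ⟨i1, e1⟩ := hu.neg_inner_vecMulOp hDm hDb (continuous_gradient (hηt t)) ht.1.le
    obtain ⟨i2, e2⟩ := hu.integrable_weighted hc.continuous hc0 hDm hDb (hdη t) ht.1.le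
    have e3 := hu.weightedEnergy_apply (c := c) (a := a) hα1 hDb t
      (toLinf _ fun x => deriv (fun s => η s x) t)
    have e4 := integral_sub i2 (i1.const_mul 2)
    have e5 : ∫ x in D, (2 * (ut t x * inner ℝ (Du t x) (gradient (η t) x)) : ℝ)
        = 2 * ∫ x in D, ut t x * inner ℝ (Du t x) (gradient (η t) x) := integral_const_mul _ _
    have e6 : ∫ x in D, (deriv (fun s => η s x) t * (ut t x ^ 2 / c x ^ 2 + ‖Du t x‖ ^ 2)
        - 2 * (ut t x * inner ℝ (Du t x) (gradient (η t) x)) : ℝ) ≤ 0 :=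
      integral_nonpos fun x => flux_le (hc0 x) _ _ (hηc t ht x)
    -- The weight `-∂ₜη ≥ 0` is frozen at the present time `t` while the work runs over all of `[0,
    -- t]`; positivity of the memory term is available precisely for such time-independent weights.
    have e7 := hu.integral_damping_nonneg hα0 hα1 hc.continuous ha.continuous hc0 ha0 hDm hDb
      (m := -toLinf _ fun x => deriv (fun s => η s x) t) (by
        filter_upwards [Lp.coeFn_neg (toLinf (volume.restrict D) fun x => deriv (fun s => η s x) t),
          coeFn_toLinf (memLp_top_restrict hDm hDb (hdη t))] with x h1 h2
        rw [h1, Pi.neg_apply, h2]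
        have h3 := hηc t ht x
        have h4 := mul_nonneg (hc0 x).le (norm_nonneg (gradient (η t) x))
        linarith) ht.1.le
    have e8 : ∀ r, (inner ℝ (mulOp _ ℝ (-toLinf _ fun x => deriv (fun s => η s x) t)
          (mulOp _ ℝ (dampingWeight D c a) (caputoCurve α D ut r))) (curve D ut r) : ℝ)
        = -inner ℝ (mulOp _ ℝ (toLinf _ fun x => deriv (fun s => η s x) t)
          (mulOp _ ℝ (dampingWeight D c a) (caputoCurve α D ut r))) (curve D ut r) := by
      intro r
      rw [map_neg, neg_apply, inner_neg_left]
    rw [intervalIntegral.integral_congr fun r _ => e8 r, intervalIntegral.integral_neg] at e7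
    linarith
  have hanti := antitoneOn_of_hasDerivWithinAt_nonpos (convex_Icc 0 τ) hcont.continuousOn
    (fun x hx => by
      rw [interior_Icc] at hx ⊢
      exact (hder x hx).hasDerivWithinAt)
    (fun x hx => by
      rw [interior_Icc] at hx
      exact hnonpos x hx)
  have hle := hanti ⟨le_rfl, ht.1.trans ht.2⟩ ht ht.1
  have z0 := hu.weightedEnergy_apply (c := c) (a := a) hα1 hDb 0 (toLinf _ (η 0))
  have zt := hu.weightedEnergy_apply (c := c) (a := a) hα1 hDb t (toLinf _ (η t))
  obtain ⟨-, f0⟩ := hu.integrable_weighted hc.continuous hc0 hDm hDb (hηt 0).continuous le_rfl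
  obtain ⟨j, ft⟩ := hu.integrable_weighted hc.continuous hc0 hDm hDb (hηt t).continuous ht.1
  have g0 : ∫ x in D, η 0 x * (ut 0 x ^ 2 / c x ^ 2 + ‖Du 0 x‖ ^ 2) = 0 := by
    refine integral_eq_zero_of_ae ?_
    filter_upwards [ae_restrict_of_ae h0] with x hx
    by_cases hx0 : η 0 x = 0
    · simp [hx0]
    · simp [hx hx0]
  have hd := hu.integral_damping_nonneg hα0 hα1 hc.continuous ha.continuous hc0 ha0 hDm hDb
      (m := toLinf _ (η t)) (by
        filter_upwards [coeFn_toLinf (memLp_top_restrict hDm hDb (hηt t).continuous)] with x h2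
        rw [h2]
        exact hη0 t x) ht.1
  have hs : (∫ r in (0 : ℝ)..0, (inner ℝ (mulOp _ ℝ (toLinf _ (η 0))
          (mulOp _ ℝ (dampingWeight D c a) (caputoCurve α D ut r))) (curve D ut r) : ℝ)) = 0 :=
      intervalIntegral.integral_same
  have hpos : ∀ x, 0 ≤ η t x * (ut t x ^ 2 / c x ^ 2 + ‖Du t x‖ ^ 2) := fun x =>
    mul_nonneg (hη0 t x) (by positivity)
  -- The weighted energy and twice the work are both nonnegative, and their sum is at most its
  -- initial value zero.
  have hz : ∫ x in D, η t x * (ut t x ^ 2 / c x ^ 2 + ‖Du t x‖ ^ 2) = 0 :=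
    le_antisymm (by simp only at hle; linarith) (integral_nonneg hpos)
  have hae := (integral_eq_zero_iff_of_nonneg hpos j).1 hz
  filter_upwards [(ae_restrict_iff' hDm).1 hae] with x hx hxη
  have h1 := (mul_eq_zero.1 (hx (hsuppD t ht x hxη))).resolve_left hxη
  have h2 : 0 ≤ ut t x ^ 2 / c x ^ 2 := by positivity
  have h3 : 0 ≤ ‖Du t x‖ ^ 2 := by positivity
  constructor
  · have h4 : ut t x ^ 2 / c x ^ 2 = 0 := by linarith
    simpa [(hc0 x).ne'] using h4
  · have h4 : ‖Du t x‖ ^ 2 = 0 := by linarith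
    simpa using h4

end LocalEnergy

end FracWave

/-! ### Smooth weights for backward cones, and finite propagation speed. -/

namespace FracWave

variable {n : ℕ}

theorem norm_gradient (f : Sp n → ℝ) (x : Sp n) : ‖gradient f x‖ = ‖fderiv ℝ f x‖ :=
  (InnerProductSpace.toDual ℝ (Sp n)).symm.norm_map _

section SmoothNorm

/-- A smooth approximation of the norm. -/
noncomputable def smoothNorm (ε : ℝ) (x : Sp n) : ℝ := √(ε ^ 2 + ‖x‖ ^ 2)

theorem contDiff_smoothNorm {ε : ℝ} (hε : 0 < ε) : ContDiff ℝ ∞ (smoothNorm ε : Sp n → ℝ) :=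
  (contDiff_const.add (contDiff_norm_sq ℝ)).sqrt fun x => by positivity

theorem norm_le_smoothNorm (ε : ℝ) (x : Sp n) : ‖x‖ ≤ smoothNorm ε x :=
  Real.le_sqrt_of_sq_le (by nlinarith [sq_nonneg ε])

theorem smoothNorm_zero {ε : ℝ} (hε : 0 ≤ ε) : smoothNorm ε (0 : Sp n) = ε := by
  simp [smoothNorm, Real.sqrt_sq hε]

theorem norm_fderiv_smoothNorm_le {ε : ℝ} (hε : 0 < ε) (x : Sp n) :
    ‖fderiv ℝ (smoothNorm ε) x‖ ≤ 1 := by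
  have h := (((hasStrictFDerivAt_norm_sq x).hasFDerivAt).const_add (ε ^ 2)).sqrt
    (by positivity : ε ^ 2 + ‖x‖ ^ 2 ≠ 0)
  have h' : HasFDerivAt (smoothNorm ε) _ x := h
  rw [h'.fderiv, norm_smul, ← Nat.cast_smul_eq_nsmul ℝ, norm_smul, innerSL_apply_norm]
  have h1 := norm_le_smoothNorm ε x
  have h2 : 0 < √(ε ^ 2 + ‖x‖ ^ 2) := Real.sqrt_pos.2 (by positivity)
  rw [smoothNorm] at h1
  simp only [one_div, mul_inv_rev, norm_mul, norm_inv, Real.norm_eq_abs, Nat.cast_ofNat,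
    Nat.abs_ofNat, abs_of_pos h2]
  field_simp
  linarith

end SmoothNorm

section Glue

/-- A smooth antitone function which is positive exactly on the negative half line. -/
noncomputable def negGlue (s : ℝ) : ℝ := expNegInvGlue (-s)

theorem contDiff_negGlue : ContDiff ℝ ∞ negGlue := expNegInvGlue.contDiff.comp contDiff_neg

theorem negGlue_nonneg (s : ℝ) : 0 ≤ negGlue s := expNegInvGlue.nonneg _

theorem negGlue_ne_zero {s : ℝ} : negGlue s ≠ 0 ↔ s < 0 := by
  rw [negGlue, Ne, expNegInvGlue.zero_iff_nonpos, neg_nonpos, not_le]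

theorem deriv_negGlue_nonpos (s : ℝ) : deriv negGlue s ≤ 0 := by
  have h : Antitone negGlue := fun x y hxy => expNegInvGlue.monotone (neg_le_neg hxy)
  exact h.deriv_nonpos

theorem hasDerivAt_negGlue (s : ℝ) : HasDerivAt negGlue (deriv negGlue s) s :=
  (contDiff_negGlue.differentiable (by simp) s).hasDerivAt

end Glue

/-- The weight of the intersection of the backward cones given by `φ` and `σ`, where `σ` recedes
with the speed `M`. -/
noncomputable def coneWeight (φ σ : Sp n → ℝ) (τ M R t : ℝ) (x : Sp n) : ℝ :=
  negGlue (φ x + t - τ) * negGlue (σ x + M * t - R)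

section ConeWeight

variable {φ σ : Sp n → ℝ} {τ M R : ℝ}

theorem contDiff_coneWeight (hφ : ContDiff ℝ ∞ φ) (hσ : ContDiff ℝ ∞ σ) :
    ContDiff ℝ ∞ fun z : ℝ × Sp n => coneWeight φ σ τ M R z.1 z.2 :=
  (contDiff_negGlue.comp (((hφ.comp contDiff_snd).add contDiff_fst).sub contDiff_const)).mul
    (contDiff_negGlue.comp (((hσ.comp contDiff_snd).add (contDiff_const.mul contDiff_fst)).sub
      contDiff_const))

theorem coneWeight_ne_zero {t : ℝ} {x : Sp n} :
    coneWeight φ σ τ M R t x ≠ 0 ↔ φ x < τ - t ∧ σ x + M * t < R := by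
  rw [coneWeight, mul_ne_zero_iff, negGlue_ne_zero, negGlue_ne_zero, sub_neg, sub_neg,
    lt_sub_iff_add_lt]

/-- Writing the weight as `A B`, its time derivative is `A' B + M A B'` and its gradient `A' B ∇φ +
A B' ∇σ`, with `A', B' ≤ 0`. The first terms compare through `c |∇φ| ≤ 1`, the second through `|∇σ|
≤ 1` and `c ≤ M`. -/
theorem deriv_coneWeight_le {c : Sp n → ℝ} (hφ : ContDiff ℝ ∞ φ) (hσ : ContDiff ℝ ∞ σ) {t : ℝ}
    {x : Sp n} (hc : 0 ≤ c x) (hcφ : c x * ‖fderiv ℝ φ x‖ ≤ 1) (hσ1 : ‖fderiv ℝ σ x‖ ≤ 1)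
    (hM : φ x < τ - t → c x ≤ M) :
    deriv (fun s => coneWeight φ σ τ M R s x) t
      ≤ -(c x * ‖gradient (coneWeight φ σ τ M R t) x‖) := by
  have hA : HasDerivAt (fun s => φ x + s - τ) 1 t := ((hasDerivAt_id t).const_add _).sub_const _
  have hB : HasDerivAt (fun s => σ x + M * s - R) M t := by
    simpa using (((hasDerivAt_id t).const_mul M).const_add (σ x)).sub_const R
  have hA1 := (hasDerivAt_negGlue (φ x + t - τ)).comp t hA
  have hB1 := (hasDerivAt_negGlue (σ x + M * t - R)).comp t hB
  have h1 : HasDerivAt (fun s => coneWeight φ σ τ M R s x) _ t := hA1.mul hB1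
  have hA' : HasFDerivAt (fun y => φ y + t - τ) (fderiv ℝ φ x) x :=
    ((hφ.differentiable (by simp) x).hasFDerivAt.add_const _).sub_const _
  have hB' : HasFDerivAt (fun y => σ y + M * t - R) (fderiv ℝ σ x) x :=
    ((hσ.differentiable (by simp) x).hasFDerivAt.add_const _).sub_const _
  have hA2 := (hasDerivAt_negGlue (φ x + t - τ)).comp_hasFDerivAt x hA'
  have hB2 := (hasDerivAt_negGlue (σ x + M * t - R)).comp_hasFDerivAt x hB'
  have h2 : HasFDerivAt (coneWeight φ σ τ M R t) _ x := hA2.mul hB2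
  rw [h1.deriv, norm_gradient, h2.fderiv]
  simp only [Function.comp_apply, mul_one]
  set A := negGlue (φ x + t - τ) with hAdef
  set B := negGlue (σ x + M * t - R)
  set A' := deriv negGlue (φ x + t - τ)
  set B' := deriv negGlue (σ x + M * t - R)
  have hA0 : 0 ≤ A := negGlue_nonneg _
  have hB0 : 0 ≤ B := negGlue_nonneg _
  have hA'0 : A' ≤ 0 := deriv_negGlue_nonpos _
  have hB'0 : B' ≤ 0 := deriv_negGlue_nonpos _
  -- The bound `c ≤ M` is needed only inside the section of the cone, since `A` vanishes outside it.
  have hAc : A * c x ≤ A * M := by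
    by_cases h : φ x < τ - t
    · exact mul_le_mul_of_nonneg_left (hM h) hA0
    · have : A = 0 := by
        by_contra h0
        exact h (by linarith [negGlue_ne_zero.1 h0])
      simp [this]
  have h3 : ‖A • B' • fderiv ℝ σ x + B • A' • fderiv ℝ φ x‖
      ≤ A * (-B' * ‖fderiv ℝ σ x‖) + B * (-A' * ‖fderiv ℝ φ x‖) := by
    refine (norm_add_le _ _).trans_eq ?_
    rw [norm_smul, norm_smul, norm_smul, norm_smul, Real.norm_of_nonneg hA0,
      Real.norm_of_nonneg hB0, Real.norm_of_nonpos hA'0, Real.norm_of_nonpos hB'0]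
  have h4 := mul_le_mul_of_nonneg_left h3 hc
  have h5 : c x * (A * (-B' * ‖fderiv ℝ σ x‖)) ≤ A * M * -B' := by
    calc c x * (A * (-B' * ‖fderiv ℝ σ x‖)) = (A * c x * -B') * ‖fderiv ℝ σ x‖ := by ring
      _ ≤ (A * c x * -B') * 1 := mul_le_mul_of_nonneg_left hσ1
          (mul_nonneg (mul_nonneg hA0 hc) (neg_nonneg.2 hB'0))
      _ = A * c x * -B' := mul_one _
      _ ≤ A * M * -B' := mul_le_mul_of_nonneg_right hAc (neg_nonneg.2 hB'0)
  have h6 : c x * (B * (-A' * ‖fderiv ℝ φ x‖)) ≤ B * -A' := by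
    calc c x * (B * (-A' * ‖fderiv ℝ φ x‖)) = (B * -A') * (c x * ‖fderiv ℝ φ x‖) := by ring
      _ ≤ (B * -A') * 1 := mul_le_mul_of_nonneg_left hcφ (mul_nonneg hB0 (neg_nonneg.2 hA'0))
      _ = B * -A' := mul_one _
  linarith

end ConeWeight

section Cone

variable {α : ℝ} {c a u₀ : Sp n → ℝ} {u ut : ℝ → Sp n → ℝ} {Du : ℝ → Sp n → Sp n}

theorem IsConeFunction.mul_norm_fderiv_le {φ : Sp n → ℝ} (h : IsConeFunction c φ) (x : Sp n) :
    c x * ‖fderiv ℝ φ x‖ ≤ 1 := by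
  have := h.2 x
  rw [← mul_pow, norm_gradient] at this
  exact (abs_le.1 ((sq_le_one_iff_abs_le_one _).1 this)).2

/-- Vanishing of the initial velocity and gradient propagates in backward cones. -/
theorem IsSolution.ae_eq_zero_of_cone (hu : IsSolution α c a u₀ u ut Du) (hα0 : 0 < α)
    (hα1 : α < 1) (hc : ContDiff ℝ ∞ c) (ha : ContDiff ℝ ∞ a) (hc0 : ∀ x, 0 < c x)
    (ha0 : ∀ x, 0 ≤ a x) {φ : Sp n → ℝ} {τ M : ℝ} (hφ : IsConeFunction c φ)
    (hM : ∀ x ∈ coneSection φ τ 0, c x ≤ M)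
    (h0 : ∀ᵐ x, x ∈ coneSection φ τ 0 → ut 0 x = 0 ∧ Du 0 x = 0) :
    ∀ t ∈ Set.Icc 0 τ, ∀ᵐ x, x ∈ coneSection φ τ t → ut t x = 0 ∧ Du t x = 0 := by
  intro t ht
  -- The second cutoff confines the weight to the ball of radius `R`, and `R → ∞` recovers the
  -- section. The speed `max M 0` covers an empty base, where `M` could be negative.
  have key : ∀ R : ℕ, ∀ᵐ x, coneWeight φ (smoothNorm 1) τ (max M 0) R t x ≠ 0 →
      ut t x = 0 ∧ Du t x = 0 := by
    intro R
    refine hu.ae_eq_zero_of_shrinking_weight (r := R) (τ := τ) hα0 hα1 hc ha hc0 ha0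
      (contDiff_coneWeight hφ.1 (contDiff_smoothNorm one_pos))
      (fun t x => mul_nonneg (negGlue_nonneg _) (negGlue_nonneg _)) ?_ ?_ ?_ t ht
    · intro s hs x hx
      have h1 := (coneWeight_ne_zero.1 hx).2
      have h2 := norm_le_smoothNorm 1 x
      have h3 : 0 ≤ max M 0 * s := mul_nonneg (le_max_right _ _) hs.1
      rw [mem_closedBall_zero_iff]
      linarith
    · intro s hs x
      refine deriv_coneWeight_le hφ.1 (contDiff_smoothNorm one_pos) (hc0 x).le
        (hφ.mul_norm_fderiv_le x) (norm_fderiv_smoothNorm_le one_pos x) fun hx => ?_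
      refine (hM x ?_).trans (le_max_left _ _)
      change φ x < τ - 0
      linarith [hs.1]
    · filter_upwards [h0] with x hx hx0
      exact hx (coneWeight_ne_zero.1 hx0).1
  filter_upwards [ae_all_iff.2 key] with x hx hxt
  obtain ⟨R, hR⟩ := exists_nat_gt (smoothNorm 1 x + max M 0 * t)
  exact hx R (coneWeight_ne_zero.2 ⟨hxt, hR⟩)

theorem exists_speed_bound {φ : Sp n → ℝ} {τ : ℝ} (hc : Continuous c)
    (h : Bornology.IsBounded (coneSection φ τ 0) ∨ BddAbove (Set.range c)) :
    ∃ M, ∀ x ∈ coneSection φ τ 0, c x ≤ M := by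
  rcases h with h | ⟨M, hM⟩
  · obtain ⟨M, hM⟩ := h.isCompact_closure.exists_bound_of_continuousOn hc.continuousOn
    exact ⟨M, fun x hx => (le_abs_self _).trans (hM x (subset_closure hx))⟩
  · exact ⟨M, fun x _ => hM ⟨x, rfl⟩⟩

theorem isOpen_coneSection {φ : Sp n → ℝ} (hφ : Continuous φ) (τ t : ℝ) :
    IsOpen (coneSection φ τ t) := isOpen_lt hφ continuous_const

theorem energy_eq_zero_iff {U : Set (Sp n)} (hU : MeasurableSet U) {w : Sp n → ℝ}
    {p : Sp n → Sp n} (hc : Continuous c) (hc0 : ∀ x, 0 < c x)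
    (hw : AEStronglyMeasurable w volume) (hp : AEStronglyMeasurable p volume) :
    energy c U w p = 0 ↔ ∀ᵐ x, x ∈ U → w x = 0 ∧ p x = 0 := by
  have m1 : AEMeasurable (fun x => ENNReal.ofReal (w x ^ 2 / c x ^ 2)) (volume.restrict U) :=
    ((hw.aemeasurable.pow_const 2).div (hc.measurable.pow_const 2).aemeasurable).ennreal_ofReal
      |>.restrict
  have m2 : AEMeasurable (fun x => ENNReal.ofReal (‖p x‖ ^ 2)) (volume.restrict U) :=
    (hp.norm.aemeasurable.pow_const 2).ennreal_ofReal.restrict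
  have e1 : ∀ x, ENNReal.ofReal (w x ^ 2 / c x ^ 2) = 0 ↔ w x = 0 := fun x => by
    rw [ENNReal.ofReal_eq_zero]
    constructor
    · intro h
      have h2 : w x ^ 2 / c x ^ 2 = 0 := le_antisymm h (by positivity)
      simpa [(hc0 x).ne'] using h2
    · intro h
      simp [h]
  have e2 : ∀ x, ENNReal.ofReal (‖p x‖ ^ 2) = 0 ↔ p x = 0 := fun x => by
    rw [ENNReal.ofReal_eq_zero]
    constructor
    · intro h
      have h2 : ‖p x‖ ^ 2 = 0 := le_antisymm h (by positivity)
      simpa using h2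
    · intro h
      simp [h]
  rw [energy, add_eq_zero, lintegral_eq_zero_iff' m1, lintegral_eq_zero_iff' m2, ← ae_restrict_iff'
    hU,
    EventuallyEq, EventuallyEq, ← eventually_and]
  refine eventually_congr (Eventually.of_forall fun x => ?_)
  simp only [Pi.zero_apply, e1, e2]

theorem IsSolution.energy_cone (hu : IsSolution α c a u₀ u ut Du) (hα0 : 0 < α)
    (hα1 : α < 1) (hc : ContDiff ℝ ∞ c) (ha : ContDiff ℝ ∞ a) (hc0 : ∀ x, 0 < c x)
    (ha0 : ∀ x, 0 ≤ a x) {φ : Sp n → ℝ} {τ : ℝ} (hφ : IsConeFunction c φ)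
    (hb : Bornology.IsBounded (coneSection φ τ 0) ∨ BddAbove (Set.range c))
    (h0 : energy c (coneSection φ τ 0) (ut 0) (Du 0) = 0) {t : ℝ} (ht : t ∈ Set.Icc 0 τ) :
    energy c (coneSection φ τ t) (ut t) (Du t) = 0 := by
  obtain ⟨M, hM⟩ := exists_speed_bound hc.continuous hb
  have h : ∀ t, 0 ≤ t → (energy c (coneSection φ τ t) (ut t) (Du t) = 0 ↔ _) := fun t ht =>
    energy_eq_zero_iff (isOpen_coneSection hφ.1.continuous τ t).measurableSet hc.continuous hc0
      (hu.cont_ut.locL2 ht).aestronglyMeasurable (hu.cont_Du.locL2 ht).aestronglyMeasurable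
  exact (h t ht.1).2
    (hu.ae_eq_zero_of_cone hα0 hα1 hc ha hc0 ha0 hφ hM ((h 0 le_rfl).1 h0) t ht)

theorem IsWeakGradient.ae_eq_zero {f : Sp n → ℝ} {p : Sp n → Sp n} (h : IsWeakGradient f p)
    (hp : LocallyIntegrable p) {U : Set (Sp n)} (hU : IsOpen U) (hf : ∀ᵐ x, x ∈ U → f x = 0) :
    ∀ᵐ x, x ∈ U → p x = 0 := by
  refine hU.ae_eq_zero_of_integral_contDiff_smul_eq_zero (hp.locallyIntegrableOn U) fun g hg hgc
    hgU => ?_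
  have h1 := h g hg hgc
  have h2 : ∫ x, f x • gradient g x = 0 := by
    refine integral_eq_zero_of_ae ?_
    filter_upwards [hf] with x hx
    by_cases hxU : x ∈ U
    · simp [hx hxU]
    · have : gradient g x = 0 := by
        by_contra h0
        exact hxU (hgU (support_gradient_subset g h0))
      simp [this]
  rw [h2] at h1
  exact neg_eq_zero.1 h1.symm

/-- Vanishing of the initial value propagates in backward cones. -/
theorem IsSolution.value_cone (hu : IsSolution α c a u₀ u ut Du) (hα0 : 0 < α)
    (hα1 : α < 1) (hc : ContDiff ℝ ∞ c) (ha : ContDiff ℝ ∞ a) (hc0 : ∀ x, 0 < c x)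
    (ha0 : ∀ x, 0 ≤ a x) {φ : Sp n → ℝ} {τ : ℝ} (hφ : IsConeFunction c φ)
    (hb : Bornology.IsBounded (coneSection φ τ 0) ∨ BddAbove (Set.range c))
    (h0 : ∀ᵐ x, x ∈ coneSection φ τ 0 → u₀ x = 0) {t : ℝ} (ht : t ∈ Set.Icc 0 τ) :
    ∀ᵐ x, x ∈ coneSection φ τ t → u t x = 0 := by
  obtain ⟨M, hM⟩ := exists_speed_bound hc.continuous hb
  have hu0 : ∀ᵐ x, x ∈ coneSection φ τ 0 → u 0 x = 0 := by
    filter_upwards [h0, hu.init_u] with x h1 h2 hx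
    rw [h2, h1 hx]
  have hDu0 := (hu.weakGradient 0 le_rfl).ae_eq_zero (hu.cont_Du.locL2 le_rfl).locallyIntegrable
    (isOpen_coneSection hφ.1.continuous τ 0) hu0
  -- The prescribed initial velocity is a multiple of `u₀`, so vanishing of `u₀` alone makes the
  -- initial energy on the base vanish.
  have hut : ∀ s ∈ Set.Icc 0 τ, ∀ᵐ x, x ∈ coneSection φ τ s → ut s x = 0 ∧ Du s x = 0 := by
    refine hu.ae_eq_zero_of_cone hα0 hα1 hc ha hc0 ha0 hφ hM ?_
    filter_upwards [h0, hu.init_ut, hDu0] with x h1 h2 h3 hx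
    refine ⟨?_, h3 hx⟩
    rw [h2, h1 hx, mul_zero]
  have hsub : ∀ s, s ≤ t → coneSection φ τ t ⊆ coneSection φ τ s := fun s hs x hx => by
    change φ x < τ - s
    have : φ x < τ - t := hx
    linarith
  have key : ∀ R : ℕ, ∀ᵐ x, x ∈ coneSection φ τ t ∩ Metric.ball 0 R → u t x = 0 := by
    intro R
    have hDb : Bornology.IsBounded (coneSection φ τ t ∩ Metric.ball 0 R) :=
      Metric.isBounded_ball.subset Set.inter_subset_right
    have hDm : MeasurableSet (coneSection φ τ t ∩ Metric.ball 0 R) :=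
      ((isOpen_coneSection hφ.1.continuous τ t).inter Metric.isOpen_ball).measurableSet
    obtain ⟨D, hD⟩ : ∃ D, D = coneSection φ τ t ∩ Metric.ball 0 R := ⟨_, rfl⟩
    rw [← hD] at hDb hDm ⊢
    have hDt : D ⊆ coneSection φ τ t := hD ▸ Set.inter_subset_left
    have hzero : ∀ (w : ℝ → Sp n → ℝ), ContL2Loc w → ∀ s, 0 ≤ s →
        (∀ᵐ x, x ∈ D → w s x = 0) → curve D w s = 0 := by
      intro w hw s hs h
      refine Lp.ext ?_
      filter_upwards [coeFn_curve hw hDb hs, (ae_restrict_iff' hDm).2 h,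
        Lp.coeFn_zero ℝ 2 (volume.restrict D)] with x h1 h2 h3
      rw [h1, h2, h3, Pi.zero_apply]
    have hc0' : curve D u 0 = 0 := by
      refine hzero u hu.cont_u 0 le_rfl ?_
      filter_upwards [hu0] with x hx hxD
      exact hx (hsub 0 ht.1 (hDt hxD))
    have hct : curve D u t = curve D u 0 := by
      have hcont := hu.cont_u.continuous_curve hDb
      rcases ht.1.eq_or_lt with h | h
      · rw [← h]
      -- The sections decrease in time, so `D` lies in all earlier ones and `∂ₜu = 0` on it. The
      -- two-sided derivative of the curve exists only at positive times; time `0` is reached by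
      -- letting `s → 0`.
      have hconst : ∀ s ∈ Set.Ioo 0 t, curve D u t = curve D u s := fun s hs => by
        refine constant_of_has_deriv_right_zero hcont.continuousOn (fun q hq => ?_) t
          ⟨hs.2.le, le_rfl⟩
        have hq0 : 0 < q := hs.1.trans_le hq.1
        have hd := hasDerivAt_curve hu.cont_u hu.cont_ut hu.timeDeriv hDb hq0
        rw [hzero ut hu.cont_ut q hq0.le] at hd
        · exact hd.hasDerivWithinAt
        · filter_upwards [hut q ⟨hq0.le, hq.2.le.trans ht.2⟩] with x hx hxD
          exact (hx (hsub q hq.2.le (hDt hxD))).1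
      refine tendsto_nhds_unique (l := 𝓝[>] (0 : ℝ)) (tendsto_const_nhds.congr' ?_)
        ((hcont.tendsto 0).mono_left nhdsWithin_le_nhds)
      filter_upwards [Ioo_mem_nhdsGT h] with s hs
      exact hconst s hs
    have h2 := coeFn_curve hu.cont_u hDb ht.1
    rw [hct, hc0'] at h2
    rw [← ae_restrict_iff' hDm]
    filter_upwards [h2, Lp.coeFn_zero ℝ 2 (volume.restrict D)] with x h1 h3
    rw [← h1, h3, Pi.zero_apply]
  filter_upwards [ae_all_iff.2 key] with x hx hxt
  obtain ⟨R, hR⟩ := exists_nat_gt ‖x‖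
  exact hx R ⟨hxt, mem_ball_zero_iff.2 hR⟩

theorem isConeFunction_smoothNorm {M : ℝ} (hc0 : ∀ x, 0 < c x) (hM : ∀ x, c x ≤ M) {ε : ℝ}
    (hε : 0 < ε) (x₀ : Sp n) : IsConeFunction c fun x => M⁻¹ * smoothNorm ε (x - x₀) := by
  have hM0 : 0 < M := (hc0 x₀).trans_le (hM x₀)
  have hs : ContDiff ℝ ∞ fun x : Sp n => smoothNorm ε (x - x₀) :=
    (contDiff_smoothNorm hε).comp (contDiff_id.sub contDiff_const)
  refine ⟨contDiff_const.mul hs, fun x => ?_⟩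
  have h1 : ‖gradient (fun x => M⁻¹ * smoothNorm ε (x - x₀)) x‖ ≤ M⁻¹ := by
    rw [norm_gradient, fderiv_const_mul (hs.differentiable (by simp) x), norm_smul,
      fderiv_comp_sub, Real.norm_of_nonneg (inv_nonneg.2 hM0.le)]
    exact mul_le_of_le_one_right (inv_nonneg.2 hM0.le) (norm_fderiv_smoothNorm_le hε _)
  rw [← mul_pow]
  refine pow_le_one₀ (mul_nonneg (hc0 x).le (norm_nonneg _)) ?_
  calc c x * ‖gradient (fun x => M⁻¹ * smoothNorm ε (x - x₀)) x‖ ≤ M * M⁻¹ :=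
        mul_le_mul (hM x) h1 (norm_nonneg _) hM0.le
    _ = 1 := mul_inv_cancel₀ hM0.ne'

/-- The support of a solution expands at most at the speed `M`. -/
theorem IsSolution.ae_eq_zero_of_notMem_cthickening (hu : IsSolution α c a u₀ u ut Du) (hα0 : 0 < α)
    (hα1 : α < 1) (hc : ContDiff ℝ ∞ c) (ha : ContDiff ℝ ∞ a) (hc0 : ∀ x, 0 < c x)
    (ha0 : ∀ x, 0 ≤ a x) {M : ℝ} (hM : ∀ x, c x ≤ M) {K : Set (Sp n)}
    (h0 : ∀ᵐ x, x ∉ K → u₀ x = 0) {t : ℝ} (ht : 0 ≤ t) :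
    ∀ᵐ x, x ∉ Metric.cthickening (M * t) K → u t x = 0 := by
  have hM0 : 0 < M := (hc0 0).trans_le (hM 0)
  rw [ae_iff]
  refine measure_null_of_locally_null _ fun x₀ hx₀ => ?_
  simp only [Set.mem_ofPred_eq, Classical.not_imp] at hx₀
  have hx₁ : ENNReal.ofReal (M * t) < Metric.infEDist x₀ K := not_le.1 hx₀.1
  -- A radius with `M t < d < dist(x₀, K)`; for empty `K` the distance is infinite and needs no
  -- separate case.
  obtain ⟨d, hd0, hd1, hd2⟩ := ENNReal.lt_iff_exists_real_btwn.1 hx₁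
  have hd : M * t < d := (ENNReal.ofReal_lt_ofReal_iff_of_nonneg (by positivity)).1 hd1
  have hball : ∀ y, ‖y - x₀‖ < d → y ∉ K := fun y hy hyK => by
    refine (hd2.trans_le (Metric.infEDist_le_edist_of_mem hyK)).not_gt ?_
    rw [edist_comm, edist_dist, dist_eq_norm]
    exact (ENNReal.ofReal_lt_ofReal_iff_of_nonneg (norm_nonneg _)).2 hy
  -- The smoothed distance equals `ε` at `x₀`. With `ε < d - M t` the point `x₀` lies in the section
  -- at time `t`, while the base lies in the ball of radius `d`, which misses `K`.
  have hε : 0 < (d - M * t) / 2 := by linarith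
  have hφ := isConeFunction_smoothNorm hc0 hM hε x₀
  have hbase : ∀ y ∈ coneSection (fun x => M⁻¹ * smoothNorm ((d - M * t) / 2) (x - x₀)) (M⁻¹ * d) 0,
      ‖y - x₀‖ < d := fun y hy => by
    have h1 : M⁻¹ * smoothNorm ((d - M * t) / 2) (y - x₀) < M⁻¹ * d - 0 := hy
    rw [sub_zero] at h1
    exact (norm_le_smoothNorm _ _).trans_lt (lt_of_mul_lt_mul_left h1 (inv_nonneg.2 hM0.le))
  have hval := hu.value_cone hα0 hα1 hc ha hc0 ha0 hφ (τ := M⁻¹ * d)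
    (Or.inr ⟨M, Set.forall_mem_range.2 hM⟩) (by
      filter_upwards [h0] with y hy hyb
      exact hy (hball y (hbase y hyb))) (t := t) ⟨ht, by
      rw [inv_mul_eq_div, le_div_iff₀ hM0]
      linarith⟩
  refine ⟨_, inter_mem (mem_nhdsWithin_of_mem_nhds
    ((isOpen_coneSection hφ.1.continuous (M⁻¹ * d) t).mem_nhds ?_)) self_mem_nhdsWithin,
    measure_mono_null ?_ (ae_iff.1 hval)⟩
  · change M⁻¹ * smoothNorm ((d - M * t) / 2) (x₀ - x₀) < M⁻¹ * d - t
    rw [sub_self, smoothNorm_zero hε.le]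
    have h1 : t = M⁻¹ * (M * t) := by field_simp
    have h2 : 0 < M⁻¹ * (d - M * t) := mul_pos (inv_pos.2 hM0) (by linarith)
    rw [mul_sub, ← h1] at h2
    rw [mul_div_assoc', mul_sub, ← h1]
    linarith
  · rintro y ⟨hy1, hy2⟩
    simp only [Set.mem_ofPred_eq, Classical.not_imp] at hy2 ⊢
    exact ⟨hy1, hy2.2⟩

end Cone

end FracWave
theorem theorem2p1 (n : ℕ) (α : ℝ) (hα0 : 0 < α) (hα1 : α < 1)
    (c a : FracWave.Sp n → ℝ) (hc : ContDiff ℝ ∞ c) (ha : ContDiff ℝ ∞ a)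
    (c₀ : ℝ) (hc₀ : 0 < c₀) (hcc₀ : ∀ x, c₀ ≤ c x) (ha0 : ∀ x, 0 ≤ a x)
    (u₀ : FracWave.Sp n → ℝ) (u ut : ℝ → FracWave.Sp n → ℝ)
    (Du : ℝ → FracWave.Sp n → FracWave.Sp n)
    (hu : FracWave.IsSolution α c a u₀ u ut Du) :
    -- finite propagation speed
    FracWave.HasFinitePropagationSpeed c u₀ u ut Du ∧
    -- dissipation of energy
    ∀ U : Set (FracWave.Sp n), FracWave.IsSmoothBounded U →
      ∀ T : ℝ, 0 < T → (∀ t ∈ Set.Ioo 0 T, FracWave.VanishesOnBoundary U (u t) (Du t)) →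
        ∀ t ∈ Set.Icc 0 T,
          FracWave.energy c U (ut t) (Du t) ≠ ⊤ ∧
          IntegrableOn (fun z : ℝ × FracWave.Sp n =>
              (a z.2 * FracWave.caputo α (fun s => ut s z.2) z.1) * (ut z.1 z.2 / c z.2 ^ 2))
            (Set.Ioo 0 t ×ˢ U) ∧
          (FracWave.energy c U (ut t) (Du t)).toReal =
            (FracWave.energy c U (ut 0) (Du 0)).toReal
              - 2 * ∫ z in Set.Ioo 0 t ×ˢ U,
                  (a z.2 * FracWave.caputo α (fun s => ut s z.2) z.1)
                    * (ut z.1 z.2 / c z.2 ^ 2) ∧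
          0 ≤ ∫ z in Set.Ioo 0 t ×ˢ U,
                (a z.2 * FracWave.caputo α (fun s => ut s z.2) z.1)
                  * (ut z.1 z.2 / c z.2 ^ 2) := by
  have hc0 : ∀ x, 0 < c x := fun x => hc₀.trans_le (hcc₀ x)
  exact ⟨⟨fun _ _ hφ _ hb h0 _ ht => hu.energy_cone hα0 hα1 hc ha hc0 ha0 hφ hb h0 ht,
    fun _ _ hφ _ hb h0 _ ht => hu.value_cone hα0 hα1 hc ha hc0 ha0 hφ hb h0 ht,
    fun _ hM _ _ h0 _ ht => hu.ae_eq_zero_of_notMem_cthickening hα0 hα1 hc ha hc0 ha0 hM h0 ht⟩,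
    fun _ hU _ _ hbd _ ht => hu.dissipation hα0 hα1 hc ha hc0 ha0 hU.isOpen.measurableSet
      hU.isBounded hbd ht⟩
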